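/- Let $\mathbb H$ be the upper half-plane, $q=e^{2\pi i\tau}$, $\eta$ the Dedekind eta function, $(a)_n=a(a+1)\cdots(a+n-1)$, $\theta_x=x\,\partial/\partial x$, $\theta_y=y\,\partial/\partial y$. **Definitions.** Let $\Gamma\subset\mathrm{SL}(2,\mathbb Z)$ be a congruence subgroup, $G$ a subgroup of the normalizer of $\Gamma$ in $\mathrm{SL}(2,\mathbb R)$ containing $\Gamma$, $\chi_1$ a character of $\Gamma$ and $\chi_2$ a character of $G$ with $\chi_2|_\Gamma=\chi_1^2$. A holomorphic $F:\mathbb H^2\to\mathbb C$ is a *bimodular form* of weight $k$ on $(\Gamma,G)$ with characters $(\chi_1,\chi_2)$ if in each of the two variables it is a modular form of weight $k$ with character $\chi_1$ on $\Gamma$ (holomorphic at the cusps; e.g. $F(\gamma\tau_1,\tau_2)=\chi_1(\gamma)(c\tau_1+d)^kF(\tau_1,\tau_2)$), and $$F(\gamma\tau_1,\gamma\tau_2)=\chi_2(\gamma)(c\tau_1+d)^k(c\tau_2+d)^kF(\tau_1,\tau_2)$$ for all $\gamma=\begin{pmatrix}*&*\\c&d\end{pmatrix}\in G$. A *bimodular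 function* is a meromorphic function on $\mathbb H^2$ satisfying these transformation laws with $k=0$ and trivial characters. $\Gamma+w$ denotes the group generated by $\Gamma$ and $w$, and $w_N=\frac1{\sqrt N}\begin{pmatrix}0&-1\\N&0\end{pmatrix}$. **Proposition.** For $a=1/2$ let $$t(\tau)=\frac{\theta_2(\tau)^4}{\theta_3(\tau)^4},\quad f(\tau)=\theta_4(\tau)^2,\quad \theta_2=\sum_{n\in\mathbb Z}q^{(n+1/2)^2},\ \theta_3=\sum_{n\in\mathbb Z}q^{n^2},\ \theta_4=\sum_{n\in\mathbb Z}(-1)^nq^{n^2}.$$ For $a=1/3$ let $$t(\tau)=-27\frac{\eta(3\tau)^{12}}{\eta(\tau)^{12}},\qquad f(\tau)=\sum_{m,n\in\mathbb Z}q^{m^2+mn+n^2}.$$ For $a=1/4$ let $$t(\tau)=-64\frac{\eta(2\tau)^{24}}{\eta(\tau)^{24}},\qquad f(\tau)=(2E_2(2\tau)-E_2(\tau))^{1/2},\qquad E_2=1-24\sum_{n\ge1}\frac{nq^n}{1-q^n},$$ where the branch of $f$ near $i\infty$ is the one tending to $1$. Put $t_j=t(\tau_j)$ and $$x=-\frac{t_1+t_2}{(1-t_1)(1-t_2)},\qquad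 y=\frac{t_1t_2}{(t_1+t_2)^2},\qquad F=f(\tau_1)f(\tau_2).$$ 1. In each case, for all $\tau_1,\tau_2$ with sufficiently large imaginary parts and $t_1+t_2\ne0$, $$F(\tau_1,\tau_2)=\sum_{n=0}^\infty\sum_{m=0}^{\lfloor n/2\rfloor}\frac{(a)_n(1-a)_n}{(n!)^2}\binom n{2m}\binom{2m}mx^ny^m,$$ the double series being absolutely convergent. 2. At every point $(\tau_1,\tau_2)\in\mathbb H^2$ with $t_1\neq1$, $t_2\ne1$, $t_1+t_2\neq0$ at which the Jacobian determinant of $(\tau_1,\tau_2)\mapsto(x,y)$ does not vanish, $F$ is locally a holomorphic function of $(x,y)$ and as such satisfies $$\theta_x(\theta_x-2\theta_y)F-x(\theta_x+a)(\theta_x+1-a)F=0,\qquad \theta_y^2F-y(2\theta_y-\theta_x+1)(2\theta_y-\theta_x)F=0.$$ (For $a=1/4$, where $F$ is determined only up to sign, holomorphic branches of $F$ exist near each such point, and this holds for every such branch.) 3. For $a=1/2$, $x$ and $y$ are bimodular functions and $F$ is a bimodular form of weight $1$ on $(\Gamma_0(4),\Gamma_0(4)+w)$, $w=\begin{pmatrix}1&0\\2&1\end{pmatrix}$,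 with characters determined by $\chi_1\begin{pmatrix}*&*\\c&d\end{pmatrix}=(-1)^{c/4}\left(\frac{-4}d\right)$ and $\chi_2(w)=-1$. 4. For $a=1/3$, $x$ and $y$ are bimodular functions and $F$ is a bimodular form of weight $1$ on $(\Gamma_0(3),\Gamma_0(3)+w_3)$, with characters determined by $\chi_1\begin{pmatrix}*&*\\ *&d\end{pmatrix}=\left(\frac{-3}d\right)$ and $\chi_2(w_3)=-1$. 5. For $a=1/4$, $x$ and $y$ are bimodular functions and $F^2$ is a bimodular form of weight $2$ on $(\Gamma_0(2),\Gamma_0(2)+w_2)$, with trivial characters. -/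

import Mathlib

open Complex UpperHalfPlane Filter Topology CongruenceSubgroup
open scoped MatrixGroups ModularForm

noncomputable section

namespace Bimodular

/-! ### Bimodular forms and bimodular functions

A function of two variables on the product of two upper half-planes is given as a function
`ℂ → ℂ → ℂ`; only its values at pairs of points of the upper half-plane matter. -/

/-- The product of two upper half-planes, as an open subset of `ℂ × ℂ`. -/
def upperHalfPlaneProd : Set (ℂ × ℂ) := {p | 0 < p.1.im ∧ 0 < p.2.im}

/-- The inclusion of `SL(2, ℤ)` in `SL(2, ℝ)`. -/
def toReal : SL(2, ℤ) →* SL(2, ℝ) := Matrix.SpecialLinearGroup.map (Int.castRingHom ℝ)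

/-- `Γ` is a congruence subgroup of `SL(2, ℤ)`, and `G` is a subgroup of the normalizer of `Γ`
in `SL(2, ℝ)` that contains `Γ`. -/
structure IsBimodularPair (Γ : Subgroup SL(2, ℤ)) (G : Subgroup SL(2, ℝ)) : Prop where
  congruence : IsCongruenceSubgroup Γ
  le : Γ.map toReal ≤ G
  le_normalizer : G ≤ Subgroup.normalizer (Γ.map toReal : Set SL(2, ℝ))

/-- `F` is a bimodular form of weight `k` on `(Γ, G)` with characters `(χ₁, χ₂)`: it is
holomorphic, it is a modular form of weight `k` with character `χ₁` on `Γ` in each of the two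
variables (including holomorphy at all cusps), and it transforms with the character `χ₂` under
the diagonal action of `G`. -/
structure IsBimodularForm (k : ℤ) (Γ : Subgroup SL(2, ℤ)) (G : Subgroup SL(2, ℝ))
    (χ₁ : Γ →* ℂˣ) (χ₂ : G →* ℂˣ) (F : ℂ → ℂ → ℂ) : Prop where
  pair : IsBimodularPair Γ G
  compat : ∀ (γ : Γ) (h : toReal γ ∈ G), χ₂ ⟨toReal γ, h⟩ = χ₁ γ ^ 2
  holomorphic : DifferentiableOn ℂ (fun p : ℂ × ℂ => F p.1 p.2) upperHalfPlaneProd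
  left : ∀ (γ : Γ) (τ₁ τ₂ : ℍ), F ↑((γ : SL(2, ℤ)) • τ₁) τ₂ =
    χ₁ γ * (((γ : SL(2, ℤ)) 1 0 : ℂ) * τ₁ + ((γ : SL(2, ℤ)) 1 1 : ℂ)) ^ k * F τ₁ τ₂
  right : ∀ (γ : Γ) (τ₁ τ₂ : ℍ), F τ₁ ↑((γ : SL(2, ℤ)) • τ₂) =
    χ₁ γ * (((γ : SL(2, ℤ)) 1 0 : ℂ) * τ₂ + ((γ : SL(2, ℤ)) 1 1 : ℂ)) ^ k * F τ₁ τ₂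
  diag : ∀ (g : G) (τ₁ τ₂ : ℍ), F ↑((g : SL(2, ℝ)) • τ₁) ↑((g : SL(2, ℝ)) • τ₂) =
    χ₂ g * (((g : SL(2, ℝ)) 1 0 : ℂ) * τ₁ + ((g : SL(2, ℝ)) 1 1 : ℂ)) ^ k *
      (((g : SL(2, ℝ)) 1 0 : ℂ) * τ₂ + ((g : SL(2, ℝ)) 1 1 : ℂ)) ^ k * F τ₁ τ₂
  cusps_left : ∀ (γ : SL(2, ℤ)) (τ₂ : ℍ),
    IsBoundedAtImInfty ((fun τ₁ : ℍ => F τ₁ τ₂) ∣[k] γ)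
  cusps_right : ∀ (γ : SL(2, ℤ)) (τ₁ : ℍ),
    IsBoundedAtImInfty ((fun τ₂ : ℍ => F τ₁ τ₂) ∣[k] γ)

/-- `f` is meromorphic on the product of two upper half-planes: near each point it is a quotient
`g / h` of holomorphic functions, with `h` not identically zero near that point. -/
def IsMeromorphic (f : ℂ → ℂ → ℂ) : Prop :=
  ∀ p ∈ upperHalfPlaneProd, ∃ g h : ℂ × ℂ → ℂ, AnalyticAt ℂ g p ∧ AnalyticAt ℂ h p ∧
    (∃ᶠ q in 𝓝 p, h q ≠ 0) ∧ ∀ᶠ q in 𝓝 p, h q ≠ 0 → f q.1 q.2 = g q / h q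

/-- `f` is a bimodular function on `(Γ, G)`: it is meromorphic, invariant under `Γ` in each
variable, and invariant under the diagonal action of `G`. (The functions to which this is applied
are given by fractions, whose value is `0` where the denominator vanishes; invariance is required
at those points too.) -/
structure IsBimodularFunction (Γ : Subgroup SL(2, ℤ)) (G : Subgroup SL(2, ℝ))
    (f : ℂ → ℂ → ℂ) : Prop where
  pair : IsBimodularPair Γ G
  meromorphic : IsMeromorphic f
  left : ∀ (γ : Γ) (τ₁ τ₂ : ℍ), f ↑((γ : SL(2, ℤ)) • τ₁) τ₂ = f τ₁ τ₂
  right : ∀ (γ : Γ) (τ₁ τ₂ : ℍ), f τ₁ ↑((γ : SL(2, ℤ)) • τ₂) = f τ₁ τ₂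
  diag : ∀ (g : G) (τ₁ τ₂ : ℍ),
    f ↑((g : SL(2, ℝ)) • τ₁) ↑((g : SL(2, ℝ)) • τ₂) = f τ₁ τ₂

/-! ### The groups -/

/-- The group `Γ + w` generated by `Γ` and `w` in `SL(2, ℝ)`. -/
def adjoin (Γ : Subgroup SL(2, ℤ)) (w : SL(2, ℝ)) : Subgroup SL(2, ℝ) :=
  Γ.map toReal ⊔ Subgroup.zpowers w

theorem mem_adjoin (Γ : Subgroup SL(2, ℤ)) (w : SL(2, ℝ)) : w ∈ adjoin Γ w :=
  (le_sup_right : Subgroup.zpowers w ≤ adjoin Γ w) (Subgroup.mem_zpowers w)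

/-- The matrix `(1 0; 2 1)`. -/
def wMat : SL(2, ℝ) := ⟨!![1, 0; 2, 1], by simp [Matrix.det_fin_two]⟩

/-- The Atkin-Lehner (Fricke) involution `w_N = (0 -1; N 0) / √N` of `Γ₀(N)`. -/
def atkinLehner (N : ℕ) [NeZero N] : SL(2, ℝ) :=
  ⟨!![0, -1 / √(N : ℝ); √(N : ℝ), 0], by
    have h : √(N : ℝ) ≠ 0 := by
      have : (0 : ℝ) < N := by exact_mod_cast Nat.pos_of_ne_zero (NeZero.ne N)
      positivity
    rw [Matrix.det_fin_two_of]
    field_simp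
    norm_num⟩

/-! ### The modular functions and forms of one variable

Throughout `q = exp (2 π i τ)`. -/

/-- `q ^ r = exp (2 π i r τ)`. -/
def qpow (r τ : ℂ) : ℂ := cexp (2 * Real.pi * Complex.I * r * τ)

def theta₂ (τ : ℂ) : ℂ := ∑' n : ℤ, qpow (((n : ℂ) + 1 / 2) ^ 2) τ

def theta₃ (τ : ℂ) : ℂ := ∑' n : ℤ, qpow ((n : ℂ) ^ 2) τ

def theta₄ (τ : ℂ) : ℂ := ∑' n : ℤ, (-1 : ℂ) ^ n * qpow ((n : ℂ) ^ 2) τ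

def E₂ (τ : ℂ) : ℂ := 1 - 24 * ∑' n : ℕ+, (n : ℂ) * qpow n τ / (1 - qpow n τ)

/-- `t` for `a = 1/2`. -/
def tHalf (τ : ℂ) : ℂ := theta₂ τ ^ 4 / theta₃ τ ^ 4

/-- `f` for `a = 1/2`. -/
def fHalf (τ : ℂ) : ℂ := theta₄ τ ^ 2

/-- `t` for `a = 1/3`. -/
def tThird (τ : ℂ) : ℂ := -27 * (ModularForm.eta (3 * τ) ^ 12 / ModularForm.eta τ ^ 12)

/-- `f` for `a = 1/3`. -/
def fThird (τ : ℂ) : ℂ :=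
  ∑' p : ℤ × ℤ, qpow ((p.1 : ℂ) ^ 2 + (p.1 : ℂ) * (p.2 : ℂ) + (p.2 : ℂ) ^ 2) τ

/-- `t` for `a = 1/4`. -/
def tQuarter (τ : ℂ) : ℂ := -64 * (ModularForm.eta (2 * τ) ^ 24 / ModularForm.eta τ ^ 24)

/-- `f` for `a = 1/4`, with the principal branch of the square root; since
`2 E₂(2τ) - E₂(τ)` tends to `1` at `i∞`, this is the holomorphic branch with limit `1` when
`Im τ` is large. -/
def fQuarter (τ : ℂ) : ℂ := (2 * E₂ (2 * τ) - E₂ τ) ^ (1 / 2 : ℂ)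

/-! ### The functions of two variables -/

def xFun (t : ℂ → ℂ) (τ₁ τ₂ : ℂ) : ℂ := -((t τ₁ + t τ₂) / ((1 - t τ₁) * (1 - t τ₂)))

def yFun (t : ℂ → ℂ) (τ₁ τ₂ : ℂ) : ℂ := t τ₁ * t τ₂ / (t τ₁ + t τ₂) ^ 2

def FFun (f : ℂ → ℂ) (τ₁ τ₂ : ℂ) : ℂ := f τ₁ * f τ₂

/-! ### The series expansion -/

/-- The term `(a)_n (1-a)_n / (n!)² * C(n, 2m) * C(2m, m) * x^n * y^m`. -/
def seriesTerm (a x y : ℂ) (n m : ℕ) : ℂ :=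
  (ascPochhammer ℂ n).eval a * (ascPochhammer ℂ n).eval (1 - a) / (n.factorial : ℂ) ^ 2 *
    (n.choose (2 * m) : ℂ) * ((2 * m).choose m : ℂ) * x ^ n * y ^ m

/-- For all `τ₁`, `τ₂` with sufficiently large imaginary part at which `y` is defined, the double
series converges absolutely and its sum is `f(τ₁) f(τ₂)`. -/
def HasHypergeometricExpansion (a : ℂ) (t f : ℂ → ℂ) : Prop :=
  ∃ C : ℝ, ∀ τ₁ τ₂ : ℍ, C < τ₁.im → C < τ₂.im → t τ₁ + t τ₂ ≠ 0 →
    Summable (fun n : ℕ => ∑ m ∈ Finset.range (n / 2 + 1),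
      ‖seriesTerm a (xFun t τ₁ τ₂) (yFun t τ₁ τ₂) n m‖) ∧
    HasSum (fun n : ℕ => ∑ m ∈ Finset.range (n / 2 + 1),
      seriesTerm a (xFun t τ₁ τ₂) (yFun t τ₁ τ₂) n m) (FFun f τ₁ τ₂)

/-! ### The system of partial differential equations -/

/-- `θ_x = x ∂/∂x`. -/
def thetaX (Φ : ℂ → ℂ → ℂ) : ℂ → ℂ → ℂ := fun x y => x * deriv (fun s => Φ s y) x

/-- `θ_y = y ∂/∂y`. -/
def thetaY (Φ : ℂ → ℂ → ℂ) : ℂ → ℂ → ℂ := fun x y => y * deriv (fun s => Φ x s) y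

/-- The function `Φ` satisfies, at the point `(x, y)`, the two equations
`θ_x (θ_x - 2 θ_y) Φ - x (θ_x + a) (θ_x + 1 - a) Φ = 0` and
`θ_y² Φ - y (2 θ_y - θ_x + 1) (2 θ_y - θ_x) Φ = 0`. -/
def HypergeometricSystem (a : ℂ) (Φ : ℂ → ℂ → ℂ) (x y : ℂ) : Prop :=
  (let Ψ : ℂ → ℂ → ℂ := thetaX Φ - (2 : ℂ) • thetaY Φ
   let Ξ : ℂ → ℂ → ℂ := thetaX Φ + (1 - a) • Φ
   thetaX Ψ x y - x * (thetaX Ξ x y + a * Ξ x y) = 0) ∧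
  (let Ψ : ℂ → ℂ → ℂ := (2 : ℂ) • thetaY Φ - thetaX Φ
   thetaY (thetaY Φ) x y - y * (2 * thetaY Ψ x y - thetaX Ψ x y + Ψ x y) = 0)

/-- The Jacobian determinant of `(τ₁, τ₂) ↦ (x, y)`. -/
def jacobian (x y : ℂ → ℂ → ℂ) (τ₁ τ₂ : ℂ) : ℂ :=
  deriv (fun s => x s τ₂) τ₁ * deriv (fun s => y τ₁ s) τ₂ -
    deriv (fun s => x τ₁ s) τ₂ * deriv (fun s => y s τ₂) τ₁

/-- `x` and `y` are finite at `(τ₁, τ₂)` and are local coordinates there. -/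
def IsRegularPoint (t : ℂ → ℂ) (τ₁ τ₂ : ℂ) : Prop :=
  t τ₁ ≠ 1 ∧ t τ₂ ≠ 1 ∧ t τ₁ + t τ₂ ≠ 0 ∧ jacobian (xFun t) (yFun t) τ₁ τ₂ ≠ 0

/-- Near `(τ₁, τ₂)`, the function `F` is a holomorphic function `Φ` of `x` and `y`, and `Φ`
satisfies the system of partial differential equations with parameter `a`. -/
def SatisfiesSystemAt (a : ℂ) (x y F : ℂ → ℂ → ℂ) (τ₁ τ₂ : ℂ) : Prop :=
  ∃ Φ : ℂ → ℂ → ℂ,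
    AnalyticAt ℂ (fun p : ℂ × ℂ => Φ p.1 p.2) (x τ₁ τ₂, y τ₁ τ₂) ∧
    (∀ᶠ p : ℂ × ℂ in 𝓝 (τ₁, τ₂), F p.1 p.2 = Φ (x p.1 p.2) (y p.1 p.2)) ∧
    ∀ᶠ p : ℂ × ℂ in 𝓝 (x τ₁ τ₂, y τ₁ τ₂), HypergeometricSystem a Φ p.1 p.2

/-- `B` is, near `(τ₁, τ₂)`, a holomorphic square root of the square of `F`. -/
def IsBranchAt (F B : ℂ → ℂ → ℂ) (τ₁ τ₂ : ℂ) : Prop :=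
  AnalyticAt ℂ (fun p : ℂ × ℂ => B p.1 p.2) (τ₁, τ₂) ∧
    ∀ᶠ p : ℂ × ℂ in 𝓝 (τ₁, τ₂), B p.1 p.2 ^ 2 = F p.1 p.2 ^ 2

end Bimodular

end

open Bimodular

/-! Put z = t/(t-1) and w = x²y. Then x = z₁ + z₂ - 2z₁z₂ and w = z₁(1-z₁)z₂(1-z₂). Each pair (t, f)
uniformizes the hypergeometric equation of ₂F₁(a, 1-a; 1; z): with g = f² and D = q d/dq one has D t
= t g and (1-t)²(2g D²g - 3(Dg)²) = -4a(1-a) t g⁴, and the latter is that equation for f in the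
variable z. `Uniformizes` records this; once a root of g is chosen, parts 1 and 2 follow from it
uniformly in a.

The three instances of `Uniformizes` rest on the Liouville theorem `OnDisc.eq_const_of_fricke`: a
holomorphic function of q on the whole unit disc that is invariant under τ ↦ -1/(Nτ) and τ ↦ τ + h,
with N h² < 4, is constant. To prove a modular identity, a power of the difference of its sides is
divided by an eta product of the same weight, which has no zero in the half-plane and a smaller
order at q = 0; the quotient is constant and vanishes at the cusp. Levels 2 and 3 use h = 1. Level 4
uses N = 4 and h = 1/2, which generate a conjugate of the modular group permuting the fourth powers
of the theta functions.

Part 1: the double series is ∑ Aₙ Qₙ(x, w) with polynomials Qₙ. For fixed z₂ the operator z(1-z)∂² +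
(1-2z)∂ sends Qₙ to n²Qₙ₋₁ - n(n+1)Qₙ (`legZ_ode`), and the recursion of Aₙ makes the sum telescope,
so the series solves the hypergeometric equation in z₁. It is holomorphic at z₁ = 0, so its
Wronskian with f vanishes and it is a multiple of f(τ₁); symmetry in z₁, z₂ and the value 1 at the
origin identify it with f(τ₁)f(τ₂) (`Uniformizes.hypG_eq`).

Part 2: writing F = Φ(x, y) and differentiating twice in τ₁ alone gives one linear relation between
the two operators of the system applied to Φ (`Uniformizes.hyper_along`); τ₂ gives another. Up to
factors that do not vanish at a regular point their determinant is the Jacobian, so both operators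
annihilate Φ.

Parts 3 to 5: t(wτ) = 1/t(τ), and x, y do not change when both t₁ and t₂ are inverted. The form f
(or g) has a character on Γ₀(N), checked on generators (`Gamma0_le`), and a factor ω under w with ω²
= χ₂(w). Boundedness is checked at representatives of the cusps. -/

noncomputable section

namespace Bimodular

/-! ### Functions of the nome -/

/-- The nome `q = exp (2 π i τ)`. -/
def nome (τ : ℂ) : ℂ := cexp (2 * Real.pi * Complex.I * τ)

lemma nome_ne_zero (τ : ℂ) : nome τ ≠ 0 := Complex.exp_ne_zero _

lemma norm_nome (τ : ℂ) : ‖nome τ‖ = Real.exp (-2 * Real.pi * τ.im) := by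
  rw [nome, Complex.norm_exp]
  congr 1
  simp

lemma nome_mem_ball {τ : ℂ} (hτ : 0 < τ.im) : nome τ ∈ Metric.ball (0 : ℂ) 1 := by
  rw [mem_ball_zero_iff, norm_nome, Real.exp_lt_one_iff]
  have := mul_pos Real.pi_pos hτ
  linarith

lemma nome_add (σ τ : ℂ) : nome (σ + τ) = nome σ * nome τ := by
  rw [nome, nome, nome, ← Complex.exp_add]; ring_nf

lemma nome_natCast_mul (n : ℕ) (τ : ℂ) : nome (n * τ) = nome τ ^ n := by
  rw [nome, nome, ← Complex.exp_nat_mul]; ring_nf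

lemma nome_one : nome 1 = 1 := by
  rw [nome, mul_one, Complex.exp_two_pi_mul_I]

lemma nome_half : nome (1 / 2) = -1 := by
  rw [nome, ← Complex.exp_pi_mul_I]; ring_nf

lemma nome_add_one (τ : ℂ) : nome (τ + 1) = nome τ := by
  rw [nome_add, nome_one, mul_one]

lemma nome_add_half (τ : ℂ) : nome (τ + 1 / 2) = -nome τ := by
  rw [nome_add, nome_half, mul_neg_one]

lemma exists_nome_eq {q : ℂ} (hq : q ∈ Metric.ball (0 : ℂ) 1) (h0 : q ≠ 0) :
    ∃ τ : ℂ, 0 < τ.im ∧ nome τ = q := by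
  have hpi : (2 * Real.pi * Complex.I : ℂ) ≠ 0 := Complex.two_pi_I_ne_zero
  have h1 : nome (Complex.log q / (2 * Real.pi * Complex.I)) = q := by
    rw [nome, mul_div_cancel₀ _ hpi, Complex.exp_log h0]
  refine ⟨_, ?_, h1⟩
  have h2 := norm_nome (Complex.log q / (2 * Real.pi * Complex.I))
  rw [h1] at h2
  rw [mem_ball_zero_iff, h2, Real.exp_lt_one_iff] at hq
  by_contra hc
  nlinarith [Real.pi_pos]

lemma hasDerivAt_nome (τ : ℂ) : HasDerivAt nome (2 * Real.pi * Complex.I * nome τ) τ := by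
  have h := ((hasDerivAt_id τ).const_mul (2 * Real.pi * Complex.I : ℂ)).cexp
  simp only [id, mul_one] at h
  exact h.congr_deriv (mul_comm _ _)

lemma tendsto_nome : Tendsto nome (comap Complex.im atTop) (𝓝 0) := by
  rw [tendsto_zero_iff_norm_tendsto_zero]
  simp only [norm_nome]
  have h1 : Tendsto (fun y : ℝ => Real.exp (-2 * Real.pi * y)) atTop (𝓝 0) := by
    refine Real.tendsto_exp_atBot.comp ?_
    exact tendsto_id.const_mul_atTop_of_neg (by linarith [Real.pi_pos])
  exact h1.comp tendsto_comap

/-- The normalised derivative `(2 π i)⁻¹ d/dτ`. -/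
def D (f : ℂ → ℂ) (τ : ℂ) : ℂ := (2 * Real.pi * Complex.I)⁻¹ * deriv f τ

lemma deriv_eq_D (f : ℂ → ℂ) (τ : ℂ) : deriv f τ = 2 * Real.pi * Complex.I * D f τ := by
  rw [D, mul_inv_cancel_left₀ Complex.two_pi_I_ne_zero]

lemma D_eq_of_hasDerivAt {f : ℂ → ℂ} {c τ : ℂ}
    (h : HasDerivAt f (2 * Real.pi * Complex.I * c) τ) : D f τ = c := by
  rw [D, h.deriv, inv_mul_cancel_left₀ Complex.two_pi_I_ne_zero]

lemma hasDerivAt_D {f : ℂ → ℂ} {τ : ℂ} (h : DifferentiableAt ℂ f τ) :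
    HasDerivAt f (2 * Real.pi * Complex.I * D f τ) τ := by
  rw [← deriv_eq_D]; exact h.hasDerivAt

lemma eventually_im_pos {τ : ℂ} (hτ : 0 < τ.im) : ∀ᶠ σ in 𝓝 τ, 0 < σ.im :=
  (isOpen_lt continuous_const Complex.continuous_im).mem_nhds hτ

lemma D_congr {f g : ℂ → ℂ} (h : ∀ τ : ℂ, 0 < τ.im → f τ = g τ) {τ : ℂ} (hτ : 0 < τ.im) :
    D f τ = D g τ := by
  have : f =ᶠ[𝓝 τ] g := (eventually_im_pos hτ).mono h
  rw [D, D, this.deriv_eq]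

/-- `f` is, on the upper half-plane, the holomorphic function `φ` on the unit disc evaluated at
the nome. -/
structure OnDisc (f φ : ℂ → ℂ) : Prop where
  diff : DifferentiableOn ℂ φ (Metric.ball 0 1)
  eq : ∀ τ : ℂ, 0 < τ.im → f τ = φ (nome τ)

namespace OnDisc
variable {f g φ ψ : ℂ → ℂ}

lemma analyticAt (h : OnDisc f φ) {q : ℂ} (hq : q ∈ Metric.ball (0 : ℂ) 1) : AnalyticAt ℂ φ q :=
  h.diff.analyticAt (Metric.isOpen_ball.mem_nhds hq)

lemma const (c : ℂ) : OnDisc (fun _ => c) (fun _ => c) :=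
  ⟨differentiableOn_const c, fun _ _ => rfl⟩

lemma add (hf : OnDisc f φ) (hg : OnDisc g ψ) :
    OnDisc (fun τ => f τ + g τ) (fun q => φ q + ψ q) :=
  ⟨hf.diff.add hg.diff, fun τ hτ => by rw [hf.eq τ hτ, hg.eq τ hτ]⟩

lemma sub (hf : OnDisc f φ) (hg : OnDisc g ψ) :
    OnDisc (fun τ => f τ - g τ) (fun q => φ q - ψ q) :=
  ⟨hf.diff.sub hg.diff, fun τ hτ => by rw [hf.eq τ hτ, hg.eq τ hτ]⟩

lemma mul (hf : OnDisc f φ) (hg : OnDisc g ψ) :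
    OnDisc (fun τ => f τ * g τ) (fun q => φ q * ψ q) :=
  ⟨hf.diff.mul hg.diff, fun τ hτ => by rw [hf.eq τ hτ, hg.eq τ hτ]⟩

lemma pow (hf : OnDisc f φ) (n : ℕ) : OnDisc (fun τ => f τ ^ n) (fun q => φ q ^ n) :=
  ⟨hf.diff.fun_pow n, fun τ hτ => by rw [hf.eq τ hτ]⟩

lemma div (hf : OnDisc f φ) (hg : OnDisc g ψ) (h0 : ∀ q ∈ Metric.ball (0 : ℂ) 1, ψ q ≠ 0) :
    OnDisc (fun τ => f τ / g τ) (fun q => φ q / ψ q) :=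
  ⟨hf.diff.fun_div hg.diff h0, fun τ hτ => by rw [hf.eq τ hτ, hg.eq τ hτ]⟩

lemma hasDerivAt (hf : OnDisc f φ) {τ : ℂ} (hτ : 0 < τ.im) :
    HasDerivAt f (2 * Real.pi * Complex.I * (nome τ * deriv φ (nome τ))) τ := by
  have h1 := (hf.analyticAt (nome_mem_ball hτ)).differentiableAt.hasDerivAt
  have h2 := h1.comp τ (hasDerivAt_nome τ)
  have h3 : f =ᶠ[𝓝 τ] φ ∘ nome := (eventually_im_pos hτ).mono hf.eq
  refine (h2.congr_of_eventuallyEq h3).congr_deriv ?_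
  ring

lemma differentiableAt (hf : OnDisc f φ) {τ : ℂ} (hτ : 0 < τ.im) : DifferentiableAt ℂ f τ :=
  (hf.hasDerivAt hτ).differentiableAt

lemma D (hf : OnDisc f φ) : OnDisc (D f) (fun q => q * deriv φ q) := by
  refine ⟨fun q hq => ?_, fun τ hτ => D_eq_of_hasDerivAt (hf.hasDerivAt hτ)⟩
  have := (hf.analyticAt hq).deriv.differentiableAt
  exact (differentiableAt_id.mul this).differentiableWithinAt

lemma tendsto (hf : OnDisc f φ) : Tendsto f (comap Complex.im atTop) (𝓝 (φ 0)) := by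
  have h1 : Tendsto φ (𝓝 0) (𝓝 (φ 0)) :=
    (hf.analyticAt (Metric.mem_ball_self one_pos)).continuousAt
  refine (h1.comp tendsto_nome).congr' ?_
  filter_upwards [preimage_mem_comap (Ioi_mem_atTop (0 : ℝ))] with τ hτ
  exact (hf.eq τ hτ).symm

lemma analyticAt_comp (hf : OnDisc f φ) {τ : ℂ} (hτ : 0 < τ.im) : AnalyticAt ℂ f τ := by
  have : DifferentiableOn ℂ f {σ : ℂ | 0 < σ.im} :=
    fun σ hσ => (hf.differentiableAt hσ).differentiableWithinAt
  exact this.analyticAt ((isOpen_lt continuous_const Complex.continuous_im).mem_nhds hτ)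

lemma periodic (hf : OnDisc f φ) {τ : ℂ} (hτ : 0 < τ.im) : f (τ + 1) = f τ := by
  rw [hf.eq τ hτ, hf.eq (τ + 1) (by simpa using hτ), nome_add_one]

end OnDisc

/-- Extracts the factor q from a difference of two expressions that agree at the cusp. -/
lemma exists_eq_mul_of_zero {φ : ℂ → ℂ} (h : DifferentiableOn ℂ φ (Metric.ball 0 1))
    (h0 : φ 0 = 0) : ∃ ψ : ℂ → ℂ, DifferentiableOn ℂ ψ (Metric.ball 0 1) ∧
      (∀ q, φ q = q * ψ q) := by
  refine ⟨dslope φ 0, (Complex.differentiableOn_dslope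
    (Metric.isOpen_ball.mem_nhds (Metric.mem_ball_self one_pos))).2 h, fun q => ?_⟩
  have := sub_smul_dslope φ 0 q
  rw [h0, sub_zero, sub_zero, smul_eq_mul] at this
  exact this.symm

/-! ### A Liouville theorem for functions invariant under a translation and a Fricke involution -/

lemma im_neg_inv_mul {N : ℝ} (hN : 0 < N) {τ : ℂ} :
    (-1 / (N * τ)).im = τ.im / (N * Complex.normSq τ) := by
  have h : (-1 / (N * τ)) = ((-1 / N : ℝ) : ℂ) * τ⁻¹ := by
    push_cast
    rw [mul_comm (N : ℂ) τ, div_mul_eq_div_div_swap, div_eq_mul_inv _ τ]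
  rw [h, Complex.im_ofReal_mul, Complex.inv_im]
  have := hN.ne'
  by_cases h0 : Complex.normSq τ = 0
  · simp [h0]
  field_simp

lemma im_fricke_pos {N : ℝ} (hN : 0 < N) {τ : ℂ} (hτ : 0 < τ.im) : 0 < (-1 / (N * τ)).im := by
  rw [im_neg_inv_mul hN]
  have : 0 < Complex.normSq τ := Complex.normSq_pos.2 fun h => by simp [h] at hτ
  positivity

section Liouville
variable {N h : ℝ} {H φ : ℂ → ℂ}

lemma eq_of_add_int_mul (hT : ∀ τ : ℂ, 0 < τ.im → H (τ + h) = H τ) (n : ℤ) :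
    ∀ τ : ℂ, 0 < τ.im → H (τ + n * h) = H τ := by
  induction n with
  | zero => simp
  | succ n ih =>
    intro τ hτ
    have h1 := hT (τ + n * h) (by simpa using hτ)
    rw [← ih τ hτ]
    push_cast at h1 ⊢
    rw [← h1]; ring_nf
  | pred n ih =>
    intro τ hτ
    have h1 := hT (τ + (-n - 1) * h) (by simpa using hτ)
    rw [← ih τ hτ]
    push_cast at h1 ⊢
    rw [← h1]; ring_nf

/-- After a translation |Re τ| ≤ h/2, so (Im τ)² ≤ e gives N|τ|² ≤ N(h²/4 + e) = ρ < 1, and the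
involution then multiplies Im τ by at least 1/ρ. Finitely many rounds lift the point to Im ≥ √e. -/
lemma exists_im_ge (hN : 0 < N) (hh : 0 < h) (hNh : N * h ^ 2 < 4)
    (hT : ∀ τ : ℂ, 0 < τ.im → H (τ + h) = H τ)
    (hS : ∀ τ : ℂ, 0 < τ.im → H (-1 / (N * τ)) = H τ) :
    ∃ δ : ℝ, 0 < δ ∧ ∀ τ : ℂ, 0 < τ.im → ∃ σ : ℂ, δ ≤ σ.im ∧ H σ = H τ := by
  -- With this choice ρ is the midpoint of N h²/4 and 1.
  set e : ℝ := (4 - N * h ^ 2) / (8 * N) with he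
  have he0 : 0 < e := div_pos (by linarith) (by linarith)
  set ρ : ℝ := N * (h ^ 2 / 4 + e) with hρ
  have hρ1 : ρ < 1 := by
    rw [hρ, he]
    field_simp
    nlinarith
  have hρ0 : 0 < ρ := by positivity
  refine ⟨√e, Real.sqrt_pos.2 he0, ?_⟩
  have key : ∀ n : ℕ, ∀ τ : ℂ, 0 < τ.im → √e * ρ ^ n ≤ τ.im → ∃ σ : ℂ, √e ≤ σ.im ∧ H σ = H τ := by
    intro n
    induction n with
    | zero => intro τ _ h1; exact ⟨τ, by simpa using h1, rfl⟩
    | succ n ih =>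
      intro τ hτ h1
      by_cases hc : √e ≤ τ.im
      · exact ⟨τ, hc, rfl⟩
      push Not at hc
      set k : ℤ := round (τ.re / h)
      set τ' : ℂ := τ + (-k : ℤ) * h with hτ'
      have him : τ'.im = τ.im := by simp [hτ']
      have hre : τ'.re = τ.re - k * h := by simp [hτ']; ring
      have hre2 : |τ'.re| ≤ h / 2 := by
        have h3 := abs_sub_round (τ.re / h)
        have h4 : τ'.re = (τ.re / h - k) * h := by rw [hre]; field_simp
        rw [h4, abs_mul, abs_of_pos hh]
        nlinarith
      have hns : N * Complex.normSq τ' ≤ ρ := by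
        rw [hρ]
        refine mul_le_mul_of_nonneg_left ?_ hN.le
        rw [Complex.normSq_apply, him]
        have h5 : τ.im * τ.im ≤ e := by
          have := Real.mul_self_sqrt he0.le
          nlinarith
        have h6 := abs_le.1 hre2
        nlinarith
      have hτ'0 : 0 < τ'.im := by rw [him]; exact hτ
      have hn0 : 0 < Complex.normSq τ' :=
        Complex.normSq_pos.2 fun h0 => by rw [h0] at hτ'0; simp at hτ'0
      have him2 : √e * ρ ^ n ≤ (-1 / (N * τ')).im := by
        rw [im_neg_inv_mul hN, him, le_div_iff₀ (by positivity)]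
        refine le_trans ?_ h1
        rw [pow_succ, ← mul_assoc (√e)]
        exact mul_le_mul_of_nonneg_left hns (by positivity)
      obtain ⟨σ, hσ, hσ2⟩ := ih _ (im_fricke_pos hN hτ'0) him2
      exact ⟨σ, hσ, by rw [hσ2, hS _ hτ'0, hτ', eq_of_add_int_mul hT _ _ hτ]⟩
  intro τ hτ
  have hlim : Tendsto (fun n : ℕ => √e * ρ ^ n) atTop (𝓝 0) := by
    simpa using (tendsto_pow_atTop_nhds_zero_of_lt_one hρ0.le hρ1).const_mul (√e)
  obtain ⟨n, hn⟩ := (hlim.eventually (ge_mem_nhds hτ)).exists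
  exact key n τ hτ hn

/-- Every value of φ on the punctured disc is taken on the compact disc |q| ≤ r < 1, which also
contains the cusp q = 0. Hence |φ| attains its maximum over the open unit disc, and the maximum
modulus principle applies. -/
theorem OnDisc.eq_const_of_fricke (hφ : OnDisc H φ) (hN : 0 < N) (hh : 0 < h)
    (hNh : N * h ^ 2 < 4) (hT : ∀ τ : ℂ, 0 < τ.im → H (τ + h) = H τ)
    (hS : ∀ τ : ℂ, 0 < τ.im → H (-1 / (N * τ)) = H τ) {τ : ℂ} (hτ : 0 < τ.im) :
    H τ = φ 0 := by
  obtain ⟨δ, hδ, hσ⟩ := exists_im_ge hN hh hNh hT hS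
  set r : ℝ := Real.exp (-2 * Real.pi * δ) with hr
  have hr0 : 0 < r := Real.exp_pos _
  have hr1 : r < 1 := by
    rw [hr, Real.exp_lt_one_iff]
    nlinarith [Real.pi_pos]
  have hsub : Metric.closedBall (0 : ℂ) r ⊆ Metric.ball 0 1 :=
    Metric.closedBall_subset_ball hr1
  obtain ⟨q₀, hq₀, hmax⟩ := (isCompact_closedBall (0 : ℂ) r).exists_isMaxOn
    ⟨0, Metric.mem_closedBall_self hr0.le⟩ (hφ.diff.continuousOn.mono hsub).norm
  have hmax' : IsMaxOn (norm ∘ φ) (Metric.ball 0 1) q₀ := by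
    intro q hq
    by_cases h0 : q = 0
    · subst h0; exact hmax (Metric.mem_closedBall_self hr0.le)
    obtain ⟨τ, hτ, rfl⟩ := exists_nome_eq hq h0
    obtain ⟨σ, hσ1, hσ2⟩ := hσ τ hτ
    have h1 : φ (nome τ) = φ (nome σ) := by
      rw [← hφ.eq τ hτ, ← hφ.eq σ (hδ.trans_le hσ1), hσ2]
    have h2 : nome σ ∈ Metric.closedBall (0 : ℂ) r := by
      rw [mem_closedBall_zero_iff, norm_nome, hr, Real.exp_le_exp]
      nlinarith [Real.pi_pos]
    have h3 := hmax h2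
    simpa [h1] using h3
  have hconst := Complex.eqOn_of_isPreconnected_of_isMaxOn_norm
    (convex_ball (0 : ℂ) 1).isPreconnected Metric.isOpen_ball hφ.diff (hsub hq₀) hmax'
  rw [hφ.eq τ hτ, hconst (nome_mem_ball hτ), hconst (Metric.mem_ball_self one_pos)]
  rfl

end Liouville

/-! ### The Dedekind eta function in terms of the nome -/

/-- Euler's product `∏ (1 - q ^ n)`. -/
def eulerProd (q : ℂ) : ℂ := ∏' n : ℕ, (1 - q ^ (n + 1))

lemma differentiableOn_eulerProd : DifferentiableOn ℂ eulerProd (Metric.ball 0 1) :=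
  ModularForm.differentiableOn_tprod_one_sub_pow

lemma eulerProd_zero : eulerProd 0 = 1 := by simp [eulerProd]

lemma eulerProd_ne_zero {q : ℂ} (hq : q ∈ Metric.ball (0 : ℂ) 1) : eulerProd q ≠ 0 := by
  by_cases h0 : q = 0
  · rw [h0, eulerProd_zero]; exact one_ne_zero
  obtain ⟨τ, hτ, rfl⟩ := exists_nome_eq hq h0
  have h := ModularForm.eta_tprod_ne_zero (z := τ) hτ
  simpa [ModularForm.eta_q_eq_pow, eulerProd, nome] using h

/-- Locally uniform convergence allows differentiation of the partial products, and each finite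
product containing the factor 1 - q has derivative -1 at 0. -/
lemma deriv_eulerProd_zero : deriv eulerProd 0 = -1 := by
  have h1 := ModularForm.multipliableLocallyUniformlyOn_one_sub_pow.hasProdLocallyUniformlyOn
  have h2 : TendstoLocallyUniformlyOn (fun (s : Finset ℕ) (q : ℂ) => ∏ n ∈ s, (1 - q ^ (n + 1)))
      eulerProd atTop (Metric.ball 0 1) := h1
  have h3 := (h2.deriv (Eventually.of_forall fun s => by fun_prop)
    Metric.isOpen_ball).tendsto_at (Metric.mem_ball_self one_pos)
  refine tendsto_nhds_unique h3 ?_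
  refine tendsto_const_nhds.congr' ?_
  filter_upwards [eventually_ge_atTop ({0} : Finset ℕ)] with s hs
  have h0 : (0 : ℕ) ∈ s := hs (Finset.mem_singleton_self 0)
  have h4 : ∀ n ∈ s, HasDerivAt (fun q : ℂ => 1 - q ^ (n + 1)) (if n = 0 then -1 else 0) 0 := by
    intro n _
    have := (hasDerivAt_pow (n + 1) (0 : ℂ)).const_sub 1
    refine this.congr_deriv ?_
    rcases n with _ | n <;> simp
  have h5 := (HasDerivAt.fun_finsetProd h4).deriv
  simp only [Function.comp_apply] at h5 ⊢
  rw [h5]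
  simp [h0, Finset.sum_ite_eq']

/-- `exp (2 π i τ / 24)`. -/
def nome24 (τ : ℂ) : ℂ := nome (τ / 24)

lemma nome24_ne_zero (τ : ℂ) : nome24 τ ≠ 0 := nome_ne_zero _

lemma nome24_pow (τ : ℂ) : nome24 τ ^ 24 = nome τ := by
  rw [nome24, ← nome_natCast_mul]
  congr 1
  push_cast
  ring

lemma eta_eq (τ : ℂ) : ModularForm.eta τ = nome24 τ * eulerProd (nome τ) := by
  rw [ModularForm.eta, eulerProd]
  congr 1
  · rw [Function.Periodic.qParam, nome24, nome]
    congr 1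
    push_cast
    ring
  · simp [ModularForm.eta_q_eq_pow, nome]

lemma eta_natCast_mul_eq (N : ℕ) (τ : ℂ) :
    ModularForm.eta (N * τ) = nome24 τ ^ N * eulerProd (nome τ ^ N) := by
  rw [eta_eq, nome_natCast_mul, nome24, mul_div_assoc, nome_natCast_mul, nome24]

lemma im_natCast_mul_pos {N : ℕ} (hN : 0 < N) {τ : ℂ} (hτ : 0 < τ.im) : 0 < ((N : ℂ) * τ).im := by
  have : (0 : ℝ) < N := by exact_mod_cast hN
  have h2 : ((N : ℂ) * τ).im = N * τ.im := by simp
  rw [h2]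
  positivity

lemma eta_ne_zero {τ : ℂ} (hτ : 0 < τ.im) : ModularForm.eta τ ≠ 0 := ModularForm.eta_ne_zero hτ

lemma pow_mem_ball {N : ℕ} (hN : N ≠ 0) {q : ℂ} (hq : q ∈ Metric.ball (0 : ℂ) 1) :
    q ^ N ∈ Metric.ball (0 : ℂ) 1 := by
  rw [mem_ball_zero_iff] at hq ⊢
  rw [norm_pow]
  exact pow_lt_one₀ (norm_nonneg _) hq hN

lemma differentiableOn_comp_pow {φ : ℂ → ℂ} (h : DifferentiableOn ℂ φ (Metric.ball 0 1)) {N : ℕ}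
    (hN : N ≠ 0) : DifferentiableOn ℂ (fun q => φ (q ^ N)) (Metric.ball 0 1) :=
  h.comp (by fun_prop) fun _ hq => pow_mem_ball hN hq

/-- The automorphy factor of weight `1/2` of the involution `τ ↦ -1/τ`. -/
def sFactor (τ : ℂ) : ℂ := (Complex.sqrt Complex.I)⁻¹ * Complex.sqrt τ

lemma sqrt_sq (z : ℂ) : Complex.sqrt z ^ 2 = z := by
  rw [Complex.sqrt, show (2⁻¹ : ℂ) = ((2 : ℕ) : ℂ)⁻¹ by norm_num]
  exact Complex.cpow_nat_inv_pow z two_ne_zero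

lemma sFactor_sq (τ : ℂ) : sFactor τ ^ 2 = -Complex.I * τ := by
  rw [sFactor, mul_pow, inv_pow, sqrt_sq, sqrt_sq, Complex.inv_I]

lemma ofReal_mul_cpow {N : ℝ} (hN : 0 < N) {w : ℂ} (hw : w ≠ 0) (z : ℂ) :
    ((N : ℂ) * z) ^ w = (N : ℂ) ^ w * z ^ w := by
  have hN' : (N : ℂ) ≠ 0 := by exact_mod_cast hN.ne'
  by_cases hz : z = 0
  · simp [hz, hw]
  rw [Complex.cpow_def_of_ne_zero (mul_ne_zero hN' hz), Complex.cpow_def_of_ne_zero hN',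
    Complex.cpow_def_of_ne_zero hz, ← Complex.exp_add, Complex.log_ofReal_mul hN hz,
    Complex.ofReal_log hN.le, add_mul]

lemma sFactor_mul {N : ℝ} (hN : 0 < N) (τ : ℂ) : sFactor (N * τ) = (√N : ℝ) * sFactor τ := by
  have h : Complex.sqrt (N * τ) = (√N : ℝ) * Complex.sqrt τ := by
    rw [Complex.sqrt, ofReal_mul_cpow hN (by norm_num), Complex.sqrt, Real.sqrt_eq_rpow,
      Complex.ofReal_cpow hN.le]
    norm_num
  rw [sFactor, sFactor, h]
  ring

lemma sFactor_ne_zero {τ : ℂ} (hτ : 0 < τ.im) : sFactor τ ≠ 0 := by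
  intro h
  have := sFactor_sq τ
  rw [h] at this
  have h2 : τ = 0 := by simpa using this
  simp [h2] at hτ

lemma eta_neg_inv {τ : ℂ} (hτ : 0 < τ.im) :
    ModularForm.eta (-1 / τ) = sFactor τ * ModularForm.eta τ := by
  have := ModularForm.eta_comp_eq_csqrt_I_inv hτ
  simpa [sFactor, mul_assoc] using this

lemma eta_fricke {N : ℕ} (hN : 0 < N) {τ : ℂ} (hτ : 0 < τ.im) :
    ModularForm.eta (-1 / (N * τ)) = (√(N : ℝ) : ℝ) * sFactor τ * ModularForm.eta (N * τ) := by
  rw [eta_neg_inv (im_natCast_mul_pos hN hτ), ← Complex.ofReal_natCast, sFactor_mul (by positivity : (0 : ℝ) < N)]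

lemma eta_mul_fricke {N : ℕ} (hN : 0 < N) {τ : ℂ} (hτ : 0 < τ.im) :
    ModularForm.eta (N * (-1 / (N * τ))) = sFactor τ * ModularForm.eta τ := by
  have h : (N : ℂ) ≠ 0 := by exact_mod_cast hN.ne'
  rw [← eta_neg_inv hτ]
  congr 1
  have : τ ≠ 0 := fun h => by simp [h] at hτ
  field_simp

/-! ### Theta functions in terms of the nome -/

/-- `∑ q ^ (e n)` over the integers. -/
def latticeSum (e : ℤ → ℕ) (q : ℂ) : ℂ := ∑' n : ℤ, q ^ e n

lemma summable_pow_natAbs {r : ℝ} (h0 : 0 ≤ r) (h1 : r < 1) :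
    Summable fun n : ℤ => r ^ n.natAbs := by
  have := summable_geometric_of_lt_one h0 h1
  exact Summable.of_nat_of_neg (by simpa using this) (by simpa using this)

/-- The `+ 1` in the hypothesis accommodates `expB`, which vanishes at n = -1. -/
lemma pow_le_of_natAbs_le {e : ℤ → ℕ} (he : ∀ n, n.natAbs ≤ e n + 1) {r : ℝ} (h0 : 0 < r)
    (h1 : r < 1) (n : ℤ) : r ^ e n ≤ r⁻¹ * r ^ n.natAbs := by
  rw [← div_eq_inv_mul, le_div_iff₀ h0, ← pow_succ]
  exact pow_le_pow_of_le_one h0.le h1.le (he n)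

lemma summable_lattice {e : ℤ → ℕ} (he : ∀ n, n.natAbs ≤ e n + 1) {q : ℂ}
    (hq : q ∈ Metric.ball (0 : ℂ) 1) : Summable fun n : ℤ => ‖q ^ e n‖ := by
  rw [mem_ball_zero_iff] at hq
  obtain ⟨r, hr0, hr1⟩ := exists_between hq
  have h0 : 0 < r := (norm_nonneg _).trans_lt hr0
  refine Summable.of_nonneg_of_le (fun _ => norm_nonneg _) (fun n => ?_)
    ((summable_pow_natAbs h0.le hr1).mul_left r⁻¹)
  rw [norm_pow]
  exact (pow_le_pow_left₀ (norm_nonneg _) hr0.le _).trans (pow_le_of_natAbs_le he h0 hr1 n)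

lemma differentiableOn_latticeSum {e : ℤ → ℕ} (he : ∀ n, n.natAbs ≤ e n + 1) :
    DifferentiableOn ℂ (latticeSum e) (Metric.ball 0 1) := by
  intro q hq
  rw [mem_ball_zero_iff] at hq
  obtain ⟨r, hr0, hr1⟩ := exists_between hq
  have h0 : 0 < r := (norm_nonneg _).trans_lt hr0
  have h := Complex.differentiableOn_tsum_of_summable_norm (U := Metric.ball (0 : ℂ) r)
    (F := fun (n : ℤ) (q : ℂ) => q ^ e n) ((summable_pow_natAbs h0.le hr1).mul_left r⁻¹)
    (fun n => by fun_prop) Metric.isOpen_ball (fun n w hw => by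
      rw [mem_ball_zero_iff] at hw
      rw [norm_pow]
      exact (pow_le_pow_left₀ (norm_nonneg _) hw.le _).trans (pow_le_of_natAbs_le he h0 hr1 n))
  exact (h.differentiableAt (Metric.isOpen_ball.mem_nhds
    (mem_ball_zero_iff.2 hr0))).differentiableWithinAt

/-- The exponent `n ^ 2`. -/
def expA (n : ℤ) : ℕ := n.natAbs ^ 2

/-- The exponent `n ^ 2 + n`. -/
def expB (n : ℤ) : ℕ := (n ^ 2 + n).toNat

lemma expA_cast (n : ℤ) : (expA n : ℤ) = n ^ 2 := by simp [expA]

lemma expB_cast (n : ℤ) : (expB n : ℤ) = n ^ 2 + n := by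
  rw [expB, Int.toNat_of_nonneg]
  rcases le_or_gt 0 n with h | h <;> nlinarith

lemma natAbs_le_expA (n : ℤ) : n.natAbs ≤ expA n + 1 := by
  have : n.natAbs ≤ n.natAbs ^ 2 := Nat.le_self_pow two_ne_zero _
  rw [expA]; omega

lemma natAbs_le_expB (n : ℤ) : n.natAbs ≤ expB n + 1 := by
  zify
  rw [expB_cast]
  rcases abs_cases n with ⟨h, h'⟩ | ⟨h, h'⟩ <;> rw [h] <;> nlinarith

/-- `∑ q ^ (n ^ 2)`. -/
def thetaA : ℂ → ℂ := latticeSum expA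

/-- `∑ q ^ (n ^ 2 + n)`. -/
def thetaB : ℂ → ℂ := latticeSum expB

lemma differentiableOn_thetaA : DifferentiableOn ℂ thetaA (Metric.ball 0 1) :=
  differentiableOn_latticeSum natAbs_le_expA

lemma differentiableOn_thetaB : DifferentiableOn ℂ thetaB (Metric.ball 0 1) :=
  differentiableOn_latticeSum natAbs_le_expB

lemma thetaA_zero : thetaA 0 = 1 := by
  rw [thetaA, latticeSum, tsum_eq_single 0]
  · simp [expA]
  · intro n hn
    exact zero_pow (by simpa [expA] using hn)

lemma thetaB_zero : thetaB 0 = 2 := by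
  rw [thetaB, latticeSum, tsum_eq_sum (s := {0, -1})]
  · rw [Finset.sum_pair (by norm_num)]
    norm_num [expB]
  · intro n hn
    refine zero_pow fun h => ?_
    have h2 := expB_cast n
    rw [h] at h2
    have h3 : n * (n + 1) = 0 := by push_cast at h2; linarith
    rcases mul_eq_zero.1 h3 with h4 | h4
    · simp [h4] at hn
    · simp [show n = -1 by omega] at hn

lemma thetaB_neg (q : ℂ) : thetaB (-q) = thetaB q := by
  refine tsum_congr fun n => ?_
  have : Even (expB n) := by
    have h : Even (n ^ 2 + n) := by 
      have := Int.even_mul_succ_self n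
      rwa [mul_add, mul_one, ← sq] at this
    rw [← expB_cast] at h
    exact_mod_cast h
  exact this.neg_pow q

lemma qpow_natCast (n : ℕ) (τ : ℂ) : qpow n τ = nome τ ^ n := by
  rw [← nome_natCast_mul, qpow, nome]
  ring_nf

lemma qpow_add (r s τ : ℂ) : qpow (r + s) τ = qpow r τ * qpow s τ := by
  rw [qpow, qpow, qpow, ← Complex.exp_add]; ring_nf

lemma qpow_expA (n : ℤ) (τ : ℂ) : qpow ((n : ℂ) ^ 2) τ = nome τ ^ expA n := by
  rw [← qpow_natCast]
  congr 1
  exact_mod_cast (expA_cast n).symm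

lemma qpow_half_sq (n : ℤ) (τ : ℂ) :
    qpow (((n : ℂ) + 1 / 2) ^ 2) τ = nome (τ / 4) * nome τ ^ expB n := by
  have h1 : ((n : ℂ) + 1 / 2) ^ 2 = 1 / 4 + (expB n : ℂ) := by
    have : ((expB n : ℤ) : ℂ) = ((n ^ 2 + n : ℤ) : ℂ) := by rw [expB_cast]
    push_cast at this
    rw [this]; ring
  rw [h1, qpow_add, qpow_natCast, qpow, nome]
  congr 2
  ring

lemma theta₃_eq (τ : ℂ) : theta₃ τ = thetaA (nome τ) :=
  tsum_congr fun n => qpow_expA n τ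

lemma theta₂_eq (τ : ℂ) : theta₂ τ = nome (τ / 4) * thetaB (nome τ) := by
  rw [theta₂, thetaB, latticeSum, ← tsum_mul_left]
  exact tsum_congr fun n => qpow_half_sq n τ

lemma neg_one_zpow_eq (n : ℤ) : (-1 : ℂ) ^ n = (-1) ^ expA n := by
  rw [← zpow_natCast, expA_cast]
  rcases Int.even_or_odd n with h | h
  · rw [h.neg_one_zpow, (h.pow_of_ne_zero two_ne_zero).neg_one_zpow]
  · rw [h.neg_one_zpow, (h.pow).neg_one_zpow]

lemma theta₄_eq (τ : ℂ) : theta₄ τ = thetaA (-nome τ) := by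
  refine tsum_congr fun n => ?_
  rw [qpow_expA, neg_one_zpow_eq, ← mul_pow, neg_one_mul]

lemma theta₃_add_half (τ : ℂ) : theta₃ (τ + 1 / 2) = theta₄ τ := by
  rw [theta₃_eq, theta₄_eq, nome_add_half]

lemma theta₄_add_half (τ : ℂ) : theta₄ (τ + 1 / 2) = theta₃ τ := by
  rw [theta₃_eq, theta₄_eq, nome_add_half, neg_neg]

lemma theta₂_add_half (τ : ℂ) : theta₂ (τ + 1 / 2) = nome (1 / 8) * theta₂ τ := by
  rw [theta₂_eq, theta₂_eq, nome_add_half, thetaB_neg, add_div, nome_add]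
  norm_num
  ring

lemma nome_eighth_sq : nome (1 / 8) ^ 2 = Complex.I := by
  rw [← nome_natCast_mul, nome, show 2 * Real.pi * Complex.I * (((2 : ℕ) : ℂ) * (1 / 8)) =
    Real.pi / 2 * Complex.I by push_cast; ring, Complex.exp_pi_div_two_mul_I]

lemma theta₃_eq_jacobi (τ : ℂ) : theta₃ τ = jacobiTheta₂ 0 (2 * τ) := by
  refine tsum_congr fun n => ?_
  rw [qpow, jacobiTheta₂_term]
  ring_nf

lemma theta₄_eq_jacobi (τ : ℂ) : theta₄ τ = jacobiTheta₂ (1 / 2) (2 * τ) := by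
  refine tsum_congr fun n => ?_
  rw [qpow, jacobiTheta₂_term, Complex.exp_add, ← Complex.exp_pi_mul_I, ← Complex.exp_int_mul]
  ring_nf

lemma theta₂_eq_jacobi (τ : ℂ) :
    theta₂ τ = nome (τ / 4) * jacobiTheta₂ τ (2 * τ) := by
  rw [theta₂, jacobiTheta₂, ← tsum_mul_left]
  refine tsum_congr fun n => ?_
  rw [qpow, jacobiTheta₂_term, nome, ← Complex.exp_add]
  ring_nf

/-- The automorphy factor of weight `1/2` of the involution `τ ↦ -1/(4τ)`. -/
def thetaFactor (τ : ℂ) : ℂ := (-Complex.I * (2 * τ)) ^ (1 / 2 : ℂ)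

lemma thetaFactor_sq (τ : ℂ) : thetaFactor τ ^ 2 = -Complex.I * (2 * τ) := by
  rw [thetaFactor, show (1 / 2 : ℂ) = ((2 : ℕ) : ℂ)⁻¹ by norm_num]
  exact Complex.cpow_nat_inv_pow _ two_ne_zero

lemma thetaFactor_ne_zero {τ : ℂ} (hτ : 0 < τ.im) : thetaFactor τ ≠ 0 := by
  intro h
  have := thetaFactor_sq τ
  rw [h] at this
  have h2 : τ = 0 := by simpa using this
  simp [h2] at hτ

/-- The functional equation of `jacobiTheta₂` at 2τ leads to -1/(2τ) = 2 · (-1/(4τ)). Its first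
argument 0 gives this law; 1/2 and τ give the next two, which exchange θ₂ and θ₄. -/
lemma theta₃_fricke {τ : ℂ} (hτ : 0 < τ.im) : theta₃ (-1 / (4 * τ)) = thetaFactor τ * theta₃ τ := by
  have h := jacobiTheta₂_functional_equation 0 (2 * τ)
  have h0 := thetaFactor_ne_zero hτ
  have e : 2 * (-1 / (4 * τ)) = -1 / (2 * τ) := by
    have : τ ≠ 0 := fun h => by simp [h] at hτ
    field_simp; norm_num
  rw [theta₃_eq_jacobi, theta₃_eq_jacobi, h, e]
  rw [← thetaFactor]
  simp
  field_simp

lemma theta₂_fricke {τ : ℂ} (hτ : 0 < τ.im) : theta₂ (-1 / (4 * τ)) = thetaFactor τ * theta₄ τ := by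
  have h := jacobiTheta₂_functional_equation (1 / 2) (2 * τ)
  have h0 := thetaFactor_ne_zero hτ
  have ht : τ ≠ 0 := fun h => by simp [h] at hτ
  have e : 2 * (-1 / (4 * τ)) = -1 / (2 * τ) := by
    field_simp; norm_num
  have e2 : (1 / 2 : ℂ) / (2 * τ) = -(-1 / (4 * τ)) := by field_simp; norm_num
  have e3 : cexp (-Real.pi * Complex.I * (1 / 2) ^ 2 / (2 * τ)) = nome (-1 / (4 * τ) / 4) := by
    rw [nome]; congr 1; field_simp; norm_num
  rw [← thetaFactor, e2, e3, jacobiTheta₂_neg_left] at h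
  rw [theta₄_eq_jacobi, theta₂_eq_jacobi, e, h]
  field_simp

lemma theta₄_fricke {τ : ℂ} (hτ : 0 < τ.im) : theta₄ (-1 / (4 * τ)) = thetaFactor τ * theta₂ τ := by
  have h := jacobiTheta₂_functional_equation τ (2 * τ)
  have h0 := thetaFactor_ne_zero hτ
  have ht : τ ≠ 0 := fun h => by simp [h] at hτ
  have e : 2 * (-1 / (4 * τ)) = -1 / (2 * τ) := by
    field_simp; norm_num
  have e2 : τ / (2 * τ) = 1 / 2 := by field_simp
  have e3 : nome (τ / 4) * cexp (-Real.pi * Complex.I * τ ^ 2 / (2 * τ)) = 1 := by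
    rw [nome, ← Complex.exp_add, Complex.exp_eq_one_iff]
    exact ⟨0, by field_simp; norm_num⟩
  rw [← thetaFactor, e2] at h
  have h5 : thetaFactor τ * (1 / thetaFactor τ) = 1 := mul_one_div_cancel h0
  rw [theta₄_eq_jacobi, theta₂_eq_jacobi, e, h]
  generalize jacobiTheta₂ (1 / 2) (-1 / (2 * τ)) = J at *
  generalize cexp (-Real.pi * Complex.I * τ ^ 2 / (2 * τ)) = E at *
  linear_combination (-J) * e3 - nome (τ / 4) * E * J * h5

/-! ### Rules for the derivative and the second Rankin-Cohen bracket -/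

/-- `f` is holomorphic on the upper half-plane. -/
def Hol (f : ℂ → ℂ) : Prop := ∀ τ : ℂ, 0 < τ.im → DifferentiableAt ℂ f τ

lemma OnDisc.hol {f φ : ℂ → ℂ} (h : OnDisc f φ) : Hol f := fun _ hτ => h.differentiableAt hτ

lemma Hol.D {f : ℂ → ℂ} (h : Hol f) : Hol (D f) := by
  intro τ hτ
  have h1 : DifferentiableOn ℂ f {σ : ℂ | 0 < σ.im} :=
    fun σ hσ => (h σ hσ).differentiableWithinAt
  have h2 := h1.analyticAt ((isOpen_lt continuous_const Complex.continuous_im).mem_nhds hτ)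
  exact h2.deriv.differentiableAt.const_mul _

section rules
variable {f g : ℂ → ℂ} {τ : ℂ}

lemma D_mul (hf : DifferentiableAt ℂ f τ) (hg : DifferentiableAt ℂ g τ) :
    D (fun σ => f σ * g σ) τ = D f τ * g τ + f τ * D g τ := by
  rw [D, deriv_fun_mul hf hg, D, D]; ring

lemma D_add (hf : DifferentiableAt ℂ f τ) (hg : DifferentiableAt ℂ g τ) :
    D (fun σ => f σ + g σ) τ = D f τ + D g τ := by
  rw [D, deriv_fun_add hf hg, D, D]; ring

lemma D_sub (hf : DifferentiableAt ℂ f τ) (hg : DifferentiableAt ℂ g τ) :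
    D (fun σ => f σ - g σ) τ = D f τ - D g τ := by
  rw [D, deriv_fun_sub hf hg, D, D]; ring

lemma D_const_mul (c : ℂ) : D (fun σ => c * f σ) τ = c * D f τ := by
  rw [D, deriv_const_mul_field, D]; ring

lemma D_inv (hf : DifferentiableAt ℂ f τ) (h0 : f τ ≠ 0) :
    D (fun σ => (f σ)⁻¹) τ = -D f τ / f τ ^ 2 := by
  rw [D, deriv_fun_inv'' hf h0, D]; ring

lemma D_div (hf : DifferentiableAt ℂ f τ) (hg : DifferentiableAt ℂ g τ) (h0 : g τ ≠ 0) :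
    D (fun σ => f σ / g σ) τ = (D f τ * g τ - f τ * D g τ) / g τ ^ 2 := by
  rw [D, deriv_fun_div hf hg h0, D, D]; ring

lemma D_id_pow (n : ℕ) :
    D (fun σ => σ ^ n) τ = (2 * Real.pi * Complex.I)⁻¹ * (n * τ ^ (n - 1)) := by
  rw [D, deriv_pow_field]

lemma D_comp_add (h : ℂ) : D (fun σ => f (σ + h)) τ = D f (τ + h) := by
  rw [D, deriv_comp_add_const, D]

end rules

lemma ne_zero_of_im_pos {τ : ℂ} (hτ : 0 < τ.im) : τ ≠ 0 := fun h => by simp [h] at hτ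

lemma D_fricke {N : ℝ} (hN : 0 < N) {F m : ℂ → ℂ} (hF : Hol F)
    (h : ∀ τ : ℂ, 0 < τ.im → F (-1 / (N * τ)) = m τ) {τ : ℂ} (hτ : 0 < τ.im) :
    D F (-1 / (N * τ)) = N * τ ^ 2 * D m τ := by
  have hN' : (N : ℂ) ≠ 0 := by exact_mod_cast hN.ne'
  have h0 := ne_zero_of_im_pos hτ
  have h1 : HasDerivAt (fun σ : ℂ => -1 / (N * σ)) (1 / (N * τ ^ 2)) τ := by
    have := ((hasDerivAt_id τ).const_mul (N : ℂ)).fun_inv (mul_ne_zero hN' h0)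
    have h3 := this.const_mul (-1 : ℂ)
    simp only [id] at h3
    refine (h3.congr_of_eventuallyEq (Eventually.of_forall fun σ => ?_)).congr_deriv ?_
    · simp [div_eq_mul_inv]
    · field_simp
  have h2 := (hF _ (im_fricke_pos hN hτ)).hasDerivAt.comp τ h1
  have h3 : m =ᶠ[𝓝 τ] F ∘ fun σ : ℂ => -1 / (N * σ) :=
    (eventually_im_pos hτ).mono fun σ hσ => (h σ hσ).symm
  have h4 := (h2.congr_of_eventuallyEq h3).deriv
  rw [D, D, h4]
  field_simp

/-- The second Rankin-Cohen bracket (up to a factor) of a form of weight `2` with itself. -/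
def bracket (g : ℂ → ℂ) (τ : ℂ) : ℂ := 2 * g τ * D (D g) τ - 3 * D g τ ^ 2

lemma D_fricke_weight_two {N : ℝ} (hN : 0 < N) {g k : ℂ → ℂ} (hg : Hol g) (hk : Hol k)
    (h : ∀ τ : ℂ, 0 < τ.im → g (-1 / (N * τ)) = -N * τ ^ 2 * k τ) {τ : ℂ} (hτ : 0 < τ.im) :
    D g (-1 / (N * τ)) =
      -N ^ 2 * (τ ^ 4 * D k τ + 2 * (2 * Real.pi * Complex.I)⁻¹ * (τ ^ 3 * k τ)) := by
  rw [D_fricke hN hg h hτ]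
  have : D (fun τ => -N * τ ^ 2 * k τ) τ
      = -N * (D (fun τ => τ ^ 2) τ * k τ + τ ^ 2 * D k τ) := by
    rw [← D_mul (by fun_prop) (hk τ hτ), ← D_const_mul]
    simp only [mul_assoc]
  rw [this, D_id_pow]
  push_cast
  ring

lemma D_D_fricke_weight_two {N : ℝ} (hN : 0 < N) {g k : ℂ → ℂ} (hg : Hol g) (hk : Hol k)
    (h : ∀ τ : ℂ, 0 < τ.im → g (-1 / (N * τ)) = -N * τ ^ 2 * k τ) {τ : ℂ} (hτ : 0 < τ.im) :
    D (D g) (-1 / (N * τ)) =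
      -N ^ 3 * (τ ^ 6 * D (D k) τ + 6 * (2 * Real.pi * Complex.I)⁻¹ * (τ ^ 5 * D k τ)
        + 6 * (2 * Real.pi * Complex.I)⁻¹ ^ 2 * (τ ^ 4 * k τ)) := by
  rw [D_fricke hN hg.D (fun τ hτ => D_fricke_weight_two hN hg hk h hτ) hτ]
  have hk1 := hk τ hτ
  have hk2 := hk.D τ hτ
  rw [D_const_mul, D_add (by fun_prop) (by fun_prop), D_mul (by fun_prop) hk2, D_const_mul,
    D_mul (by fun_prop) hk1, D_id_pow, D_id_pow]
  push_cast
  ring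

/-- The terms containing (2πi)⁻¹, by which D g and D²g fail to be modular, cancel in 2g D²g -
3(Dg)²; what remains has weight 8. Two functions g and k are allowed because the involution
exchanges θ₂⁴ and θ₄⁴. -/
lemma bracket_fricke {N : ℝ} (hN : 0 < N) {g k : ℂ → ℂ} (hg : Hol g) (hk : Hol k)
    (h : ∀ τ : ℂ, 0 < τ.im → g (-1 / (N * τ)) = -N * τ ^ 2 * k τ) {τ : ℂ} (hτ : 0 < τ.im) :
    bracket g (-1 / (N * τ)) = N ^ 4 * τ ^ 8 * bracket k τ := by
  rw [bracket, bracket, h τ hτ, D_fricke_weight_two hN hg hk h hτ,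
    D_D_fricke_weight_two hN hg hk h hτ]
  ring

lemma OnDisc.congr {f φ ψ : ℂ → ℂ} (h : OnDisc f φ)
    (he : ∀ q ∈ Metric.ball (0 : ℂ) 1, φ q = ψ q) : OnDisc f ψ :=
  ⟨h.diff.congr fun q hq => (he q hq).symm, fun τ hτ => by rw [h.eq τ hτ, he _ (nome_mem_ball hτ)]⟩

lemma OnDisc.congr_left {f g φ : ℂ → ℂ} (h : OnDisc f φ)
    (he : ∀ τ : ℂ, 0 < τ.im → g τ = f τ) : OnDisc g φ :=
  ⟨h.diff, fun τ hτ => by rw [he τ hτ, h.eq τ hτ]⟩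

lemma zero_mem_ball : (0 : ℂ) ∈ Metric.ball (0 : ℂ) 1 := Metric.mem_ball_self one_pos

/-- As D = q d/dq, both terms contain q, and (Dg)² even q². Only 2g D²g contributes to the leading
coefficient `β 0`, which is compared with that of an eta product later. -/
lemma OnDisc.bracket {g γ : ℂ → ℂ} (h : OnDisc g γ) :
    ∃ β : ℂ → ℂ, OnDisc (bracket g) (fun q => q * β q) ∧
      DifferentiableOn ℂ β (Metric.ball 0 1) ∧ β 0 = 2 * γ 0 * deriv γ 0 := by
  have hγ : DifferentiableOn ℂ (deriv γ) (Metric.ball 0 1) := h.diff.deriv Metric.isOpen_ball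
  have hγ2 : DifferentiableOn ℂ (deriv (deriv γ)) (Metric.ball 0 1) :=
    hγ.deriv Metric.isOpen_ball
  have hγ0 := h.diff
  refine ⟨fun q => 2 * γ q * (deriv γ q + q * deriv (deriv γ) q) - 3 * q * deriv γ q ^ 2,
    ?_, by fun_prop, by simp⟩
  have h2 := (((OnDisc.const 2).mul h).mul h.D.D).sub ((OnDisc.const 3).mul (h.D.pow 2))
  refine OnDisc.congr h2 fun q hq => ?_
  have h3 : HasDerivAt (fun q => q * deriv γ q) (1 * deriv γ q + q * deriv (deriv γ) q) q :=
    (hasDerivAt_id q).mul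
      (hγ.differentiableAt (Metric.isOpen_ball.mem_nhds hq)).hasDerivAt
  rw [h3.deriv]
  ring

/-! ### The hypothesis common to the three cases -/

/-- `t` is a function and `g` a form of weight `2` on the upper half-plane such that the square
root of `g` satisfies, as a function of `t`, a hypergeometric differential equation. -/
structure Uniformizes (κ : ℂ) (t g : ℂ → ℂ) : Prop where
  exists_disc_t : ∃ T : ℂ → ℂ, DifferentiableOn ℂ T (Metric.ball 0 1) ∧ OnDisc t fun q => q * T q
  exists_disc_g : ∃ γ : ℂ → ℂ, OnDisc g γ ∧ γ 0 = 1
  ne_zero : ∀ τ : ℂ, 0 < τ.im → t τ ≠ 0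
  D_t : ∀ τ : ℂ, 0 < τ.im → D t τ = t τ * g τ
  -- With z = t/(t-1) one has D z = z(1-z) g, and the equation becomes z(1-z)u'' + (1-2z)u' = κu for
  -- u = √g.
  ode : ∀ τ : ℂ, 0 < τ.im →
    (1 - t τ) ^ 2 * bracket g τ = -4 * κ * t τ * g τ ^ 4

/-! ### Eta quotients -/

/-- The quotient `(η(Nτ)/η(τ)) ^ m`. -/
def etaQuot (N m : ℕ) (τ : ℂ) : ℂ := (ModularForm.eta (N * τ) / ModularForm.eta τ) ^ m

/-- The quotient `(∏ (1 - q ^ (N n)) / ∏ (1 - q ^ n)) ^ m`. -/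
def eulerQuot (N m : ℕ) (q : ℂ) : ℂ := (eulerProd (q ^ N) / eulerProd q) ^ m

section EtaQuot
variable {N m : ℕ}

lemma differentiableOn_eulerQuot (hN : N ≠ 0) :
    DifferentiableOn ℂ (eulerQuot N m) (Metric.ball 0 1) :=
  ((differentiableOn_comp_pow differentiableOn_eulerProd hN).fun_div differentiableOn_eulerProd
    fun _ hq => eulerProd_ne_zero hq).fun_pow m

lemma eulerQuot_ne_zero (hN : N ≠ 0) {q : ℂ} (hq : q ∈ Metric.ball (0 : ℂ) 1) :
    eulerQuot N m q ≠ 0 :=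
  pow_ne_zero _ (div_ne_zero (eulerProd_ne_zero (pow_mem_ball hN hq)) (eulerProd_ne_zero hq))

lemma eulerQuot_zero (hN : N ≠ 0) : eulerQuot N m 0 = 1 := by
  simp [eulerQuot, hN, eulerProd_zero]

lemma deriv_eulerQuot_zero (hN : 2 ≤ N) : deriv (eulerQuot N m) 0 = m := by
  have hN0 : N ≠ 0 := by omega
  have h1 : HasDerivAt eulerProd (-1) 0 := by
    rw [← deriv_eulerProd_zero]
    exact (differentiableOn_eulerProd.differentiableAt
      (Metric.isOpen_ball.mem_nhds zero_mem_ball)).hasDerivAt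
  have h2 : HasDerivAt (fun q : ℂ => eulerProd (q ^ N)) 0 0 := by
    have h3 := hasDerivAt_pow N (0 : ℂ)
    rw [zero_pow (by omega), mul_zero] at h3
    have h1' : HasDerivAt eulerProd (-1) ((0 : ℂ) ^ N) := by rwa [zero_pow hN0]
    exact (h1'.comp (0 : ℂ) h3).congr_deriv (mul_zero _)
  have h0 : eulerProd 0 ≠ 0 := by simp [eulerProd_zero]
  have h4 := ((h2.fun_div h1 h0).fun_pow m).deriv
  rw [show eulerQuot N m = fun q => (eulerProd (q ^ N) / eulerProd q) ^ m from rfl, h4]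
  simp [eulerProd_zero, hN0]

/-- The condition `hm` says that the order m(N-1)/24 of the quotient at the cusp is 1. -/
lemma onDisc_etaQuot (hN : N ≠ 0) (hm : m + 24 = N * m) :
    OnDisc (etaQuot N m) (fun q => q * eulerQuot N m q) := by
  refine ⟨differentiableOn_id.mul (differentiableOn_eulerQuot hN), fun τ hτ => ?_⟩
  rw [etaQuot, eta_natCast_mul_eq, eta_eq, eulerQuot, div_pow, div_pow, mul_pow, mul_pow, ← pow_mul,
    ← hm, pow_add, nome24_pow]
  have h1 := eulerProd_ne_zero (nome_mem_ball hτ)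
  have h2 := nome24_ne_zero τ
  field_simp

lemma etaQuot_ne_zero (hN : 0 < N) {τ : ℂ} (hτ : 0 < τ.im) : etaQuot N m τ ≠ 0 :=
  pow_ne_zero _ (div_ne_zero (eta_ne_zero (im_natCast_mul_pos hN hτ)) (eta_ne_zero hτ))

lemma etaQuot_fricke (hN : 0 < N) (hm : Even m) {τ : ℂ} (hτ : 0 < τ.im) :
    etaQuot N m (-1 / (N * τ)) = ((N : ℂ) ^ (m / 2) * etaQuot N m τ)⁻¹ := by
  rw [etaQuot, eta_mul_fricke hN hτ, eta_fricke hN hτ, etaQuot]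
  have h1 := sFactor_ne_zero hτ
  have h2 := eta_ne_zero hτ
  have h3 := eta_ne_zero (im_natCast_mul_pos hN hτ)
  have h4 : ((√(N : ℝ) : ℝ) : ℂ) ^ m = (N : ℂ) ^ (m / 2) := by
    obtain ⟨k, rfl⟩ := hm
    rw [← two_mul, pow_mul, ← Complex.ofReal_pow, Real.sq_sqrt (Nat.cast_nonneg N)]
    simp
  rw [← h4, ← mul_pow, ← inv_pow]
  congr 1
  field_simp

end EtaQuot

/-! ### Logarithmic derivatives of functions inverted by the Fricke involution. -/

section FrickeInverse

/-- The logarithmic derivative `D t / t`. -/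
def logD (t : ℂ → ℂ) (τ : ℂ) : ℂ := D t τ / t τ

variable {t T : ℂ → ℂ}

lemma OnDisc.logD (ht : OnDisc t fun q => q * T q) (hT : DifferentiableOn ℂ T (Metric.ball 0 1))
    (h0 : ∀ q ∈ Metric.ball (0 : ℂ) 1, T q ≠ 0) :
    OnDisc (logD t) (fun q => 1 + q * (deriv T q / T q)) := by
  have hT' : DifferentiableOn ℂ (deriv T) (Metric.ball 0 1) := hT.deriv Metric.isOpen_ball
  refine ⟨(differentiableOn_const 1).add (differentiableOn_id.mul (hT'.fun_div hT h0)),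
    fun τ hτ => ?_⟩
  have hq := nome_mem_ball hτ
  have h1 : HasDerivAt (fun q => q * T q) (1 * T (nome τ) + nome τ * deriv T (nome τ)) (nome τ) :=
    (hasDerivAt_id _).mul (hT.differentiableAt (Metric.isOpen_ball.mem_nhds hq)).hasDerivAt
  rw [Bimodular.logD, ht.D.eq τ hτ, ht.eq τ hτ, h1.deriv]
  have := nome_ne_zero τ
  have := h0 _ hq
  field_simp

lemma deriv_logD_disc (hT : DifferentiableOn ℂ T (Metric.ball 0 1)) (h0 : T 0 ≠ 0) :
    deriv (fun q => 1 + q * (deriv T q / T q)) 0 = deriv T 0 / T 0 := by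
  have hT' : DifferentiableOn ℂ (deriv T) (Metric.ball 0 1) := hT.deriv Metric.isOpen_ball
  have h1 := hT.differentiableAt (Metric.isOpen_ball.mem_nhds zero_mem_ball)
  have h2 := hT'.differentiableAt (Metric.isOpen_ball.mem_nhds zero_mem_ball)
  have h3 := (((hasDerivAt_id (0 : ℂ)).mul (h2.fun_div h1 h0).hasDerivAt).const_add 1).deriv
  refine Eq.trans ?_ (h3.trans ?_)
  · rfl
  · simp

/-- Inverting t changes the sign of D t / t, and the derivative of the involution contributes N τ².
-/
lemma logD_fricke {N : ℝ} (hN : 0 < N) (ht : Hol t) (h0 : ∀ τ : ℂ, 0 < τ.im → t τ ≠ 0)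
    (h : ∀ τ : ℂ, 0 < τ.im → t (-1 / (N * τ)) = (t τ)⁻¹) {τ : ℂ} (hτ : 0 < τ.im) :
    logD t (-1 / (N * τ)) = -N * τ ^ 2 * logD t τ := by
  have := h0 τ hτ
  rw [logD, logD, D_fricke hN ht h hτ, h τ hτ, D_inv (ht τ hτ) this]
  field_simp

end FrickeInverse

/-- The common factor q ^ k never vanishes on the half-plane, and cancelling it extends the quotient
holomorphically across q = 0, as the Liouville theorem requires. -/
lemma OnDisc.div_of_pow {f g φ ψ : ℂ → ℂ} (k : ℕ) (hf : OnDisc f fun q => q ^ k * φ q)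
    (hφ : DifferentiableOn ℂ φ (Metric.ball 0 1)) (hg : OnDisc g fun q => q ^ k * ψ q)
    (hψ : DifferentiableOn ℂ ψ (Metric.ball 0 1)) (h0 : ∀ q ∈ Metric.ball (0 : ℂ) 1, ψ q ≠ 0) :
    OnDisc (fun τ => f τ / g τ) (fun q => φ q / ψ q) :=
  ⟨hφ.fun_div hψ h0, fun τ hτ => by
    rw [hf.eq τ hτ, hg.eq τ hτ, mul_div_mul_left _ _ (pow_ne_zero _ (nome_ne_zero τ))]⟩

/-- The product `(η(τ) η(Nτ)) ^ m`. -/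
def etaProd (N m : ℕ) (τ : ℂ) : ℂ := (ModularForm.eta τ * ModularForm.eta (N * τ)) ^ m

/-- The product `(∏ (1 - q ^ n) (1 - q ^ (N n))) ^ m`. -/
def eulerProd₂ (N m : ℕ) (q : ℂ) : ℂ := (eulerProd q * eulerProd (q ^ N)) ^ m

section EtaProd
variable {N m : ℕ}

lemma differentiableOn_eulerProd₂ (hN : N ≠ 0) :
    DifferentiableOn ℂ (eulerProd₂ N m) (Metric.ball 0 1) :=
  (differentiableOn_eulerProd.mul (differentiableOn_comp_pow differentiableOn_eulerProd hN)).fun_pow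
    m

lemma eulerProd₂_ne_zero (hN : N ≠ 0) {q : ℂ} (hq : q ∈ Metric.ball (0 : ℂ) 1) :
    eulerProd₂ N m q ≠ 0 :=
  pow_ne_zero _ (mul_ne_zero (eulerProd_ne_zero hq) (eulerProd_ne_zero (pow_mem_ball hN hq)))

lemma eulerProd₂_zero (hN : N ≠ 0) : eulerProd₂ N m 0 = 1 := by
  simp [eulerProd₂, hN, eulerProd_zero]

lemma onDisc_etaProd (hN : N ≠ 0) (hm : (1 + N) * m = 24) :
    OnDisc (etaProd N m) (fun q => q * eulerProd₂ N m q) := by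
  refine ⟨differentiableOn_id.mul (differentiableOn_eulerProd₂ hN), fun τ hτ => ?_⟩
  have h : nome24 τ ^ ((1 + N) * m) = nome τ := by rw [hm, nome24_pow]
  rw [etaProd, eta_natCast_mul_eq, eta_eq, eulerProd₂, ← h, pow_mul, ← mul_pow]
  ring

lemma etaProd_ne_zero (hN : 0 < N) {τ : ℂ} (hτ : 0 < τ.im) : etaProd N m τ ≠ 0 :=
  pow_ne_zero _ (mul_ne_zero (eta_ne_zero hτ) (eta_ne_zero (im_natCast_mul_pos hN hτ)))

lemma etaProd_fricke (hN : 0 < N) {τ : ℂ} (hτ : 0 < τ.im) :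
    etaProd N m (-1 / (N * τ)) =
      ((√(N : ℝ) : ℝ) * (-Complex.I * τ)) ^ m * etaProd N m τ := by
  rw [etaProd, eta_mul_fricke hN hτ, eta_fricke hN hτ, etaProd, ← sFactor_sq]
  ring

end EtaProd

/-! ### The case of level two -/

lemma tQuarter_eq (τ : ℂ) : tQuarter τ = -64 * etaQuot 2 24 τ := by
  rw [tQuarter, etaQuot, div_pow, Nat.cast_ofNat]

lemma onDisc_tQuarter : OnDisc tQuarter fun q => q * (-64 * eulerQuot 2 24 q) := by
  refine OnDisc.congr_left (((OnDisc.const (-64)).mul (onDisc_etaQuot (N := 2) (m := 24)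
    two_ne_zero (by norm_num))).congr fun q _ => ?_) fun τ _ => tQuarter_eq τ
  ring

lemma tQuarter_ne_zero {τ : ℂ} (hτ : 0 < τ.im) : tQuarter τ ≠ 0 := by
  rw [tQuarter_eq]
  exact mul_ne_zero (by norm_num) (etaQuot_ne_zero two_pos hτ)

lemma tQuarter_fricke {τ : ℂ} (hτ : 0 < τ.im) : tQuarter (-1 / ((2 : ℕ) * τ)) = (tQuarter τ)⁻¹ := by
  rw [tQuarter_eq, tQuarter_eq, etaQuot_fricke two_pos (by decide) hτ]
  have := etaQuot_ne_zero (m := 24) two_pos hτ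
  field_simp
  norm_num

/-- The form of weight two `2 E₂(2τ) - E₂(τ)`. -/
def gQuarter (τ : ℂ) : ℂ := 2 * E₂ (2 * τ) - E₂ τ

lemma E₂_eq (τ : ℍ) : E₂ τ = EisensteinSeries.E2 τ := by
  have h := tsum_pow_div_one_sub_eq_tsum_sigma (norm_exp_two_pi_I_lt_one τ) 1
  rw [EisensteinSeries.E2_eq_tsum_cexp, E₂]
  congr 2
  refine Eq.trans ?_ (h.trans ?_)
  · refine tsum_congr fun n => ?_
    have : qpow n τ = cexp (2 * Real.pi * Complex.I * τ) ^ (n : ℕ) := by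
      rw [qpow, ← Complex.exp_nat_mul]; ring_nf
    rw [this, pow_one]
  · refine tsum_congr fun n => ?_
    simp

lemma D_eta {τ : ℂ} (hτ : 0 < τ.im) :
    D ModularForm.eta τ = ModularForm.eta τ * E₂ τ / 24 := by
  have h := ModularForm.logDeriv_eta_eq_E2 ⟨τ, hτ⟩
  have h2 := E₂_eq ⟨τ, hτ⟩
  rw [← h2, logDeriv_apply, UpperHalfPlane.coe_mk, div_eq_iff (eta_ne_zero hτ)] at h
  rw [D, h]
  have := Complex.two_pi_I_ne_zero
  have hpi : (Real.pi : ℂ) ≠ 0 := by exact_mod_cast Real.pi_ne_zero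
  have hI := Complex.I_ne_zero
  field_simp
  ring

lemma hol_eta : Hol ModularForm.eta := fun _ hτ =>
  ModularForm.differentiableAt_eta_of_mem_upperHalfPlaneSet hτ

lemma hol_eta_mul {N : ℕ} (hN : 0 < N) : Hol fun τ => ModularForm.eta (N * τ) := fun τ hτ =>
  (hol_eta _ (im_natCast_mul_pos hN hτ)).comp τ (by fun_prop)

lemma D_eta_mul {N : ℕ} (hN : 0 < N) {τ : ℂ} (hτ : 0 < τ.im) :
    D (fun τ => ModularForm.eta (N * τ)) τ = N * (ModularForm.eta (N * τ) * E₂ (N * τ) / 24) := by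
  rw [← D_eta (im_natCast_mul_pos hN hτ), D, deriv_comp_mul_left, D, smul_eq_mul]
  ring

lemma logD_etaQuot {N m : ℕ} (hN : 0 < N) {τ : ℂ} (hτ : 0 < τ.im) :
    logD (etaQuot N m) τ = m * (N * E₂ (N * τ) - E₂ τ) / 24 := by
  have h1 := hol_eta τ hτ
  have h2 := hol_eta_mul hN τ hτ
  have h3 := eta_ne_zero hτ
  have h4 := eta_ne_zero (im_natCast_mul_pos hN hτ)
  have h5 : D (etaQuot N m) τ = m * (ModularForm.eta (N * τ) / ModularForm.eta τ) ^ (m - 1) *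
      D (fun τ => ModularForm.eta (N * τ) / ModularForm.eta τ) τ := by
    have := ((h2.fun_div h1 h3).hasDerivAt.fun_pow m).deriv
    rw [D, show etaQuot N m = fun τ => (ModularForm.eta (N * τ) / ModularForm.eta τ) ^ m from rfl,
      this, D]
    ring
  rw [logD, h5, D_div h2 h1 h3, D_eta hτ, D_eta_mul hN hτ, etaQuot]
  rcases m with _ | m
  · simp
  rw [pow_succ (_ / _)]
  have h6 : (ModularForm.eta (N * τ) / ModularForm.eta τ) ^ m ≠ 0 := pow_ne_zero _ (div_ne_zero h4 h3)
  rw [Nat.add_sub_cancel, div_eq_iff (mul_ne_zero h6 (div_ne_zero h4 h3))]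
  field_simp

lemma logD_const_mul {c : ℂ} (hc : c ≠ 0) {f h : ℂ → ℂ} (he : ∀ τ, h τ = c * f τ) (τ : ℂ) :
    logD h τ = logD f τ := by
  rw [show h = fun τ => c * f τ from funext he, logD, logD, D_const_mul, mul_div_mul_left _ _ hc]

/-- Since E₂ = 24 Dη/η, the combination 2E₂(2τ) - E₂(τ) is the logarithmic derivative of
(η(2τ)/η(τ))²⁴. -/
lemma gQuarter_eq {τ : ℂ} (hτ : 0 < τ.im) : gQuarter τ = logD tQuarter τ := by
  rw [logD_const_mul (by norm_num) tQuarter_eq, logD_etaQuot two_pos hτ, gQuarter]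
  push_cast
  ring

lemma onDisc_gQuarter : ∃ γ : ℂ → ℂ, OnDisc gQuarter γ ∧ γ 0 = 1 ∧ deriv γ 0 = 24 := by
  have hT : DifferentiableOn ℂ (fun q => -64 * eulerQuot 2 24 q) (Metric.ball 0 1) :=
    (differentiableOn_eulerQuot two_ne_zero).const_mul _
  have hT0 : ∀ q ∈ Metric.ball (0 : ℂ) 1, -64 * eulerQuot 2 24 q ≠ 0 := fun q hq =>
    mul_ne_zero (by norm_num) (eulerQuot_ne_zero two_ne_zero hq)
  refine ⟨_, OnDisc.congr_left (onDisc_tQuarter.logD hT hT0) fun τ hτ => gQuarter_eq hτ, by simp, ?_⟩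
  rw [deriv_logD_disc hT (hT0 0 zero_mem_ball), deriv_const_mul_field, deriv_eulerQuot_zero le_rfl,
    eulerQuot_zero two_ne_zero]
  norm_num

lemma gQuarter_fricke {τ : ℂ} (hτ : 0 < τ.im) :
    gQuarter (-1 / ((2 : ℕ) * τ)) = -2 * τ ^ 2 * gQuarter τ := by
  have h := logD_fricke (N := 2) two_pos onDisc_tQuarter.hol (fun τ hτ => tQuarter_ne_zero hτ)
    (fun τ hτ => by simpa using tQuarter_fricke hτ) hτ
  have h2 := im_fricke_pos (N := 2) two_pos hτ
  push_cast at h h2 ⊢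
  rw [gQuarter_eq hτ, gQuarter_eq h2, h]

lemma sqrt_natCast_sq (N : ℕ) : ((√(N : ℝ) : ℝ) : ℂ) ^ 2 = N := by
  rw [← Complex.ofReal_pow, Real.sq_sqrt (Nat.cast_nonneg N), Complex.ofReal_natCast]

lemma etaProd_two_fricke {τ : ℂ} (hτ : 0 < τ.im) :
    etaProd 2 8 (-1 / ((2 : ℕ) * τ)) = 16 * τ ^ 8 * etaProd 2 8 τ := by
  have h1 := sqrt_natCast_sq 2
  have h2 := Complex.I_sq
  rw [etaProd_fricke two_pos hτ]
  generalize ((√((2 : ℕ) : ℝ) : ℝ) : ℂ) = r at h1 ⊢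
  push_cast at h1
  have h3 : (r * (-Complex.I * τ)) ^ 8 = (r ^ 2) ^ 4 * (Complex.I ^ 2) ^ 4 * τ ^ 8 := by ring
  rw [h3, h1, h2]
  ring

/-- The difference X of the two sides has weight 4 and vanishes at the cusp. So X² has weight 8 and
order at least 2, against weight 8 and order 1 for η(τ)⁸η(2τ)⁸, and the quotient is the constant 0.
The right side is (1-t) η(τ)¹⁶/η(2τ)⁸, which is how 1 - t enters the differential equation. -/
lemma gQuarter_sq {τ : ℂ} (hτ : 0 < τ.im) : gQuarter τ ^ 2 =
    ModularForm.eta τ ^ 16 / ModularForm.eta ((2 : ℕ) * τ) ^ 8 +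
      64 * (ModularForm.eta ((2 : ℕ) * τ) ^ 16 / ModularForm.eta τ ^ 8) := by
  obtain ⟨γ, hγ, hγ0, -⟩ := onDisc_gQuarter
  have hP := differentiableOn_eulerProd
  have hP2 : DifferentiableOn ℂ (fun q => eulerProd (q ^ 2)) (Metric.ball 0 1) :=
    differentiableOn_comp_pow hP two_ne_zero
  have hb : OnDisc (fun τ => ModularForm.eta τ ^ 16 / ModularForm.eta ((2 : ℕ) * τ) ^ 8)
      (fun q => eulerProd q ^ 16 / eulerProd (q ^ 2) ^ 8) := by
    refine ⟨(hP.fun_pow 16).fun_div (hP2.fun_pow 8) fun q hq =>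
      pow_ne_zero _ (eulerProd_ne_zero (pow_mem_ball two_ne_zero hq)), fun τ hτ => ?_⟩
    rw [eta_natCast_mul_eq, eta_eq]
    have := nome24_ne_zero τ
    field_simp
  have hc : OnDisc (fun τ => ModularForm.eta ((2 : ℕ) * τ) ^ 16 / ModularForm.eta τ ^ 8)
      (fun q => q * (eulerProd (q ^ 2) ^ 16 / eulerProd q ^ 8)) := by
    refine ⟨differentiableOn_id.mul ((hP2.fun_pow 16).fun_div (hP.fun_pow 8) fun q hq =>
      pow_ne_zero _ (eulerProd_ne_zero hq)), fun τ hτ => ?_⟩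
    rw [eta_natCast_mul_eq, eta_eq, ← nome24_pow]
    have := nome24_ne_zero τ
    have := eulerProd_ne_zero (nome_mem_ball hτ)
    field_simp
  set X : ℂ → ℂ := fun τ => gQuarter τ ^ 2 -
    (ModularForm.eta τ ^ 16 / ModularForm.eta ((2 : ℕ) * τ) ^ 8 +
      64 * (ModularForm.eta ((2 : ℕ) * τ) ^ 16 / ModularForm.eta τ ^ 8)) with hX
  have hXd := (hγ.pow 2).sub (hb.add ((OnDisc.const 64).mul hc))
  obtain ⟨ξ, hξ, hξe⟩ := exists_eq_mul_of_zero hXd.diff (by simp [hγ0, eulerProd_zero])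
  have hH : OnDisc (fun τ => X τ ^ 2 / etaProd 2 8 τ)
      (fun q => (q * ξ q ^ 2) / eulerProd₂ 2 8 q) := by
    refine OnDisc.div_of_pow 1 ((hXd.pow 2).congr fun q _ => ?_) (by fun_prop)
      ((onDisc_etaProd two_ne_zero (by norm_num)).congr fun q _ => ?_)
      (differentiableOn_eulerProd₂ two_ne_zero) fun q hq => eulerProd₂_ne_zero two_ne_zero hq
    · rw [hξe]; ring
    · rw [pow_one]
  have hXF : ∀ τ : ℂ, 0 < τ.im → X (-1 / ((2 : ℕ) * τ)) = 4 * τ ^ 4 * X τ := by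
    intro τ hτ
    simp only [hX]
    rw [gQuarter_fricke hτ, eta_mul_fricke two_pos hτ, eta_fricke two_pos hτ]
    have h1 := sFactor_sq τ
    have h2 := sqrt_natCast_sq 2
    have h3 := eta_ne_zero hτ
    have h4 := eta_ne_zero (im_natCast_mul_pos two_pos hτ)
    have h5 := sFactor_ne_zero hτ
    generalize ((√((2 : ℕ) : ℝ) : ℝ) : ℂ) = r at h2 ⊢
    have hr : r ≠ 0 := by rintro rfl; norm_num at h2
    have h6 : sFactor τ ^ 8 = τ ^ 4 := by
      rw [show 8 = 2 * 4 by norm_num, pow_mul, h1, mul_pow, neg_pow, Complex.I_pow_four]; norm_num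
    have h7 : r ^ 8 = 16 := by
      rw [show 8 = 2 * 4 by norm_num, pow_mul, h2]; norm_num
    have e1 : ∀ a b : ℂ, (r * sFactor τ * a) ^ 16 / (sFactor τ * b) ^ 8 =
        256 * τ ^ 4 * (a ^ 16 / b ^ 8) := by
      intro a b
      rw [mul_pow, mul_pow, mul_pow, h6, show (16 : ℕ) = 8 * 2 by norm_num, pow_mul r,
        pow_mul (sFactor τ), h6, h7]
      have := ne_zero_of_im_pos hτ
      field_simp
      ring
    have e2 : ∀ a b : ℂ, (sFactor τ * a) ^ 16 / (r * sFactor τ * b) ^ 8 =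
        τ ^ 4 / 16 * (a ^ 16 / b ^ 8) := by
      intro a b
      rw [mul_pow, mul_pow, mul_pow, h6, show (16 : ℕ) = 8 * 2 by norm_num,
        pow_mul (sFactor τ), h6, h7]
      have := ne_zero_of_im_pos hτ
      field_simp
    rw [e1, e2]
    ring
  have hL := hH.eq_const_of_fricke (N := 2) (h := 1) two_pos one_pos (by norm_num)
    (fun τ hτ => by rw [Complex.ofReal_one]; exact hH.periodic hτ)
    (fun τ hτ => by
      have h1 := hXF τ hτ
      have h2 := etaProd_two_fricke hτ
      push_cast at h1 h2 ⊢
      rw [h1, h2]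
      have := ne_zero_of_im_pos hτ
      have := etaProd_ne_zero (m := 8) two_pos hτ
      field_simp
      ring) hτ
  simp only [zero_mul, zero_div] at hL
  rw [div_eq_zero_iff, or_iff_left (etaProd_ne_zero two_pos hτ)] at hL
  exact sub_eq_zero.1 (pow_eq_zero_iff two_ne_zero |>.1 hL)

/-- Both sides have weight 8 and a simple zero at the cusp, so their ratio is the constant
2γ(0)γ'(0) = 2 · 1 · 24. -/
lemma bracket_gQuarter {τ : ℂ} (hτ : 0 < τ.im) : bracket gQuarter τ = 48 * etaProd 2 8 τ := by
  obtain ⟨γ, hγ, hγ0, hγ1⟩ := onDisc_gQuarter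
  obtain ⟨β, hβ, hβd, hβ0⟩ := hγ.bracket
  have hH : OnDisc (fun τ => bracket gQuarter τ / etaProd 2 8 τ)
      (fun q => β q / eulerProd₂ 2 8 q) := by
    refine OnDisc.div_of_pow 1 (hβ.congr fun q _ => by rw [pow_one]) hβd
      ((onDisc_etaProd two_ne_zero (by norm_num)).congr fun q _ => by rw [pow_one])
      (differentiableOn_eulerProd₂ two_ne_zero) fun q hq => eulerProd₂_ne_zero two_ne_zero hq
  have hL := hH.eq_const_of_fricke (N := 2) (h := 1) two_pos one_pos (by norm_num)
    (fun τ hτ => by rw [Complex.ofReal_one]; exact hH.periodic hτ)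
    (fun τ hτ => by
      have h1 := bracket_fricke (N := 2) two_pos hγ.hol hγ.hol
        (fun τ hτ => by simpa using gQuarter_fricke hτ) hτ
      have h2 := etaProd_two_fricke hτ
      push_cast at h1 h2 ⊢
      rw [h1, h2]
      have := ne_zero_of_im_pos hτ
      have := etaProd_ne_zero (m := 8) two_pos hτ
      field_simp
      ring) hτ
  rw [hβ0, hγ0, hγ1, eulerProd₂_zero two_ne_zero, div_eq_iff (etaProd_ne_zero two_pos hτ)] at hL
  rw [hL]
  norm_num

theorem uniformizes_quarter : Uniformizes (1 / 4 * (1 - 1 / 4)) tQuarter gQuarter where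
  exists_disc_t := ⟨_, (differentiableOn_eulerQuot two_ne_zero).const_mul _, onDisc_tQuarter⟩
  exists_disc_g := by
    obtain ⟨γ, hγ, hγ0, -⟩ := onDisc_gQuarter
    exact ⟨γ, hγ, hγ0⟩
  ne_zero := fun τ hτ => tQuarter_ne_zero hτ
  D_t := fun τ hτ => by
    rw [gQuarter_eq hτ, logD, mul_div_cancel₀ _ (tQuarter_ne_zero hτ)]
  ode := fun τ hτ => by
    -- All terms become powers of η(τ) and η(2τ); the constants agree because 4 · (3/16) · 64 = 48.
    have h1 := gQuarter_sq hτ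
    have h3 := eta_ne_zero hτ
    have h4 := eta_ne_zero (im_natCast_mul_pos two_pos hτ)
    rw [bracket_gQuarter hτ, show gQuarter τ ^ 4 = (gQuarter τ ^ 2) ^ 2 by ring, h1, tQuarter_eq,
      etaQuot, etaProd]
    field_simp
    ring

/-! ### The cubic theta function -/

lemma hasSum_theta₃ {τ : ℂ} (hτ : 0 < τ.im) : HasSum (fun n : ℤ => qpow ((n : ℂ) ^ 2) τ) (theta₃ τ) := by
  have h : Summable fun n : ℤ => qpow ((n : ℂ) ^ 2) τ := by
    simp only [qpow_expA]
    exact (summable_lattice natAbs_le_expA (nome_mem_ball hτ)).of_norm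
  exact h.hasSum

lemma hasSum_theta₂ {τ : ℂ} (hτ : 0 < τ.im) :
    HasSum (fun n : ℤ => qpow (((n : ℂ) + 1 / 2) ^ 2) τ) (theta₂ τ) := by
  have h : Summable fun n : ℤ => qpow (((n : ℂ) + 1 / 2) ^ 2) τ := by
    simp only [qpow_half_sq]
    exact (summable_lattice natAbs_le_expB (nome_mem_ball hτ)).of_norm.mul_left _
  exact h.hasSum

lemma summable_norm_theta₃ {τ : ℂ} (hτ : 0 < τ.im) :
    Summable fun n : ℤ => ‖qpow ((n : ℂ) ^ 2) τ‖ := (hasSum_theta₃ hτ).summable.norm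

lemma summable_norm_theta₂ {τ : ℂ} (hτ : 0 < τ.im) :
    Summable fun n : ℤ => ‖qpow (((n : ℂ) + 1 / 2) ^ 2) τ‖ := (hasSum_theta₂ hτ).summable.norm

/-- The decomposition of the integers into even and odd ones. -/
def evenOdd : ℤ ⊕ ℤ → ℤ := Sum.elim (fun k => 2 * k) (fun k => 2 * k + 1)

lemma evenOdd_bijective : Function.Bijective evenOdd := by
  constructor
  · rintro (a | a) (b | b) h <;> simp only [evenOdd, Sum.elim_inl, Sum.elim_inr] at h <;>
      first | omega | (congr 1; omega)
  · intro n
    rcases Int.even_or_odd' n with ⟨k, h | h⟩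
    · exact ⟨Sum.inl k, h.symm⟩
    · exact ⟨Sum.inr k, h.symm⟩

/-- The decomposition of the lattice of pairs of integers according to the parity of the second
one. -/
def latticeSplit : (ℤ × ℤ) ⊕ (ℤ × ℤ) → ℤ × ℤ :=
  Sum.elim (fun p => (p.1 - p.2, 2 * p.2)) (fun p => (p.1 - p.2, 2 * p.2 + 1))

lemma latticeSplit_bijective : Function.Bijective latticeSplit := by
  constructor
  · rintro (⟨a, a'⟩ | ⟨a, a'⟩) (⟨b, b'⟩ | ⟨b, b'⟩) h <;>
      simp only [latticeSplit, Sum.elim_inl, Sum.elim_inr, Prod.mk.injEq] at h <;>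
      first | omega | (congr 2 <;> omega)
  · rintro ⟨m, n⟩
    rcases Int.even_or_odd' n with ⟨k, h | h⟩
    · exact ⟨Sum.inl (m + k, k), by simp [latticeSplit, h]⟩
    · exact ⟨Sum.inr (m + k, k), by simp [latticeSplit, h]⟩

/-- Even and odd indices give (2k)²/4 = k² and (2k+1)²/4 = (k + 1/2)². -/
lemma theta₃_div_four {τ : ℂ} (hτ : 0 < τ.im) : theta₃ (τ / 4) = theta₃ τ + theta₂ τ := by
  have h : HasSum ((fun n : ℤ => qpow ((n : ℂ) ^ 2) (τ / 4)) ∘ evenOdd) (theta₃ τ + theta₂ τ) := by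
    refine HasSum.sum ?_ ?_
    · refine (hasSum_theta₃ hτ).congr_fun fun n => ?_
      simp only [Function.comp_apply, evenOdd, Sum.elim_inl, qpow]
      push_cast
      ring_nf
    · refine (hasSum_theta₂ hτ).congr_fun fun n => ?_
      simp only [Function.comp_apply, evenOdd, Sum.elim_inr, qpow]
      push_cast
      ring_nf
  exact ((Equiv.ofBijective _ evenOdd_bijective).hasSum_iff.1 h).tsum_eq

lemma theta₄_div_four {τ : ℂ} (hτ : 0 < τ.im) : theta₄ (τ / 4) = theta₃ τ - theta₂ τ := by
  have h : HasSum ((fun n : ℤ => (-1 : ℂ) ^ n * qpow ((n : ℂ) ^ 2) (τ / 4)) ∘ evenOdd)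
      (theta₃ τ + -theta₂ τ) := by
    refine HasSum.sum ?_ ?_
    · refine (hasSum_theta₃ hτ).congr_fun fun n => ?_
      simp only [Function.comp_apply, evenOdd, Sum.elim_inl, qpow, (even_two_mul n).neg_one_zpow]
      push_cast
      ring_nf
    · refine (hasSum_theta₂ hτ).neg.congr_fun fun n => ?_
      simp only [Function.comp_apply, evenOdd, Sum.elim_inr, qpow, (odd_two_mul_add_one n).neg_one_zpow]
      push_cast
      ring_nf
  rw [sub_eq_add_neg]
  exact ((Equiv.ofBijective _ evenOdd_bijective).hasSum_iff.1 h).tsum_eq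

lemma im_three_mul_pos {τ : ℂ} (hτ : 0 < τ.im) : 0 < (3 * τ).im := by
  simpa using im_natCast_mul_pos (N := 3) (by norm_num) hτ

/-- Complete the square: m² + mn + n² = (m + n/2)² + 3(n/2)², where n/2 and m + n/2 are both
integers or both half-integers according to the parity of n. -/
lemma fThird_eq {τ : ℂ} (hτ : 0 < τ.im) :
    fThird τ = theta₃ τ * theta₃ (3 * τ) + theta₂ τ * theta₂ (3 * τ) := by
  have h3 := im_three_mul_pos hτ
  have h : HasSum ((fun p : ℤ × ℤ =>
      qpow ((p.1 : ℂ) ^ 2 + (p.1 : ℂ) * (p.2 : ℂ) + (p.2 : ℂ) ^ 2) τ) ∘ latticeSplit)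
      (theta₃ τ * theta₃ (3 * τ) + theta₂ τ * theta₂ (3 * τ)) := by
    refine HasSum.sum ?_ ?_
    · rw [theta₃, theta₃, tsum_mul_tsum_of_summable_norm (summable_norm_theta₃ hτ)
        (summable_norm_theta₃ h3)]
      refine (summable_mul_of_summable_norm (summable_norm_theta₃ hτ)
        (summable_norm_theta₃ h3)).hasSum.congr_fun fun p => ?_
      simp only [Function.comp_apply, latticeSplit, Sum.elim_inl, qpow]
      rw [← Complex.exp_add]
      push_cast
      ring_nf
    · rw [theta₂, theta₂, tsum_mul_tsum_of_summable_norm (summable_norm_theta₂ hτ)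
        (summable_norm_theta₂ h3)]
      refine (summable_mul_of_summable_norm (summable_norm_theta₂ hτ)
        (summable_norm_theta₂ h3)).hasSum.congr_fun fun p => ?_
      simp only [Function.comp_apply, latticeSplit, Sum.elim_inr, qpow]
      rw [← Complex.exp_add]
      push_cast
      ring_nf
  exact ((Equiv.ofBijective _ latticeSplit_bijective).hasSum_iff.1 h).tsum_eq

/-- The cubic theta function as a function of the nome. -/
def cubicA (q : ℂ) : ℂ := thetaA q * thetaA (q ^ 3) + q * (thetaB q * thetaB (q ^ 3))

lemma cubicA_zero : cubicA 0 = 1 := by simp [cubicA, thetaA_zero]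

lemma onDisc_fThird : OnDisc fThird cubicA := by
  have h1 := differentiableOn_thetaA
  have h2 := differentiableOn_thetaB
  have h3 := differentiableOn_comp_pow h1 three_ne_zero
  have h4 := differentiableOn_comp_pow h2 three_ne_zero
  refine ⟨(h1.mul h3).add (differentiableOn_id.mul (h2.mul h4)), fun τ hτ => ?_⟩
  have e : nome (3 * τ) = nome τ ^ 3 := by simpa using nome_natCast_mul 3 τ
  have e2 : nome (τ / 4) * nome (3 * τ / 4) = nome τ := by rw [← nome_add]; ring_nf
  rw [fThird_eq hτ, theta₃_eq, theta₃_eq, theta₂_eq, theta₂_eq, e, cubicA]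
  linear_combination (thetaB (nome τ) * thetaB (nome τ ^ 3)) * e2

/-- The two arguments become -1/(4 · 3τ/4) and -1/(4 · τ/4), so the theta laws produce quarter
arguments. With primes denoting values at 3τ, these recombine by (θ₃+θ₂)(θ₃'+θ₂') + (θ₃-θ₂)(θ₃'-θ₂')
= 2(θ₃θ₃' + θ₂θ₂'). -/
lemma fThird_fricke {τ : ℂ} (hτ : 0 < τ.im) :
    fThird (-1 / ((3 : ℕ) * τ)) = (√((3 : ℕ) : ℝ) : ℝ) * (-Complex.I * τ) * fThird τ := by
  have h0 := ne_zero_of_im_pos hτ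
  have h1 : 0 < (τ / 4).im := by
    have : (τ / 4).im = τ.im / 4 := by simp
    rw [this]; positivity
  have h3 := im_three_mul_pos hτ
  have h2 : 0 < (3 * τ / 4).im := by
    have : (3 * τ / 4).im = (3 * τ).im / 4 := by simp
    rw [this]; positivity
  have hw := im_fricke_pos (N := 3) (by norm_num) hτ
  have e1 : (-1 / ((3 : ℕ) * τ) : ℂ) = -1 / (4 * (3 * τ / 4)) := by push_cast; field_simp
  have e2 : 3 * (-1 / ((3 : ℕ) * τ) : ℂ) = -1 / (4 * (τ / 4)) := by push_cast; field_simp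
  have e3 : thetaFactor (3 * τ / 4) = (√((3 : ℕ) : ℝ) : ℝ) * thetaFactor (τ / 4) := by
    rw [thetaFactor, thetaFactor, show -Complex.I * (2 * (3 * τ / 4)) =
      ((3 : ℝ) : ℂ) * (-Complex.I * (2 * (τ / 4))) by push_cast; ring,
      ofReal_mul_cpow (by norm_num) (by norm_num), Real.sqrt_eq_rpow,
      Complex.ofReal_cpow (by norm_num)]
    norm_num
  have e4 := thetaFactor_sq (τ / 4)
  rw [fThird_eq (by push_cast at hw ⊢; exact hw), e2, e1, theta₃_fricke h2, theta₃_fricke h1,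
    theta₂_fricke h2, theta₂_fricke h1, theta₃_div_four h3, theta₃_div_four hτ, theta₄_div_four h3,
    theta₄_div_four hτ, e3, fThird_eq hτ]
  generalize ((√((3 : ℕ) : ℝ) : ℝ) : ℂ) = r
  linear_combination (2 * r * (theta₃ τ * theta₃ (3 * τ) + theta₂ τ * theta₂ (3 * τ))) * e4

/-! ### The case of level three -/

lemma tThird_eq (τ : ℂ) : tThird τ = -27 * etaQuot 3 12 τ := by
  rw [tThird, etaQuot, div_pow, Nat.cast_ofNat]

lemma onDisc_tThird : OnDisc tThird fun q => q * (-27 * eulerQuot 3 12 q) := by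
  refine OnDisc.congr_left (((OnDisc.const (-27)).mul (onDisc_etaQuot (N := 3) (m := 12)
    three_ne_zero (by norm_num))).congr fun q _ => ?_) fun τ _ => tThird_eq τ
  ring

lemma tThird_ne_zero {τ : ℂ} (hτ : 0 < τ.im) : tThird τ ≠ 0 := by
  rw [tThird_eq]
  exact mul_ne_zero (by norm_num) (etaQuot_ne_zero three_pos hτ)

lemma tThird_fricke {τ : ℂ} (hτ : 0 < τ.im) : tThird (-1 / ((3 : ℕ) * τ)) = (tThird τ)⁻¹ := by
  rw [tThird_eq, tThird_eq, etaQuot_fricke three_pos (by decide) hτ]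
  have := etaQuot_ne_zero (m := 12) three_pos hτ
  field_simp
  norm_num

lemma onDisc_logD_tThird : ∃ γ : ℂ → ℂ, OnDisc (logD tThird) γ ∧ γ 0 = 1 ∧ deriv γ 0 = 12 := by
  have hT : DifferentiableOn ℂ (fun q => -27 * eulerQuot 3 12 q) (Metric.ball 0 1) :=
    (differentiableOn_eulerQuot three_ne_zero).const_mul _
  have hT0 : ∀ q ∈ Metric.ball (0 : ℂ) 1, -27 * eulerQuot 3 12 q ≠ 0 := fun q hq =>
    mul_ne_zero (by norm_num) (eulerQuot_ne_zero three_ne_zero hq)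
  refine ⟨_, onDisc_tThird.logD hT hT0, by simp, ?_⟩
  rw [deriv_logD_disc hT (hT0 0 zero_mem_ball), deriv_const_mul_field,
    deriv_eulerQuot_zero (by norm_num), eulerQuot_zero three_ne_zero]
  norm_num

lemma etaProd_three_fricke {τ : ℂ} (hτ : 0 < τ.im) :
    etaProd 3 6 (-1 / ((3 : ℕ) * τ)) = -27 * τ ^ 6 * etaProd 3 6 τ := by
  have h1 := sqrt_natCast_sq 3
  have h2 := Complex.I_sq
  rw [etaProd_fricke three_pos hτ]
  generalize ((√((3 : ℕ) : ℝ) : ℝ) : ℂ) = r at h1 ⊢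
  push_cast at h1
  have h3 : (r * (-Complex.I * τ)) ^ 6 = (r ^ 2) ^ 3 * (Complex.I ^ 2) ^ 3 * τ ^ 6 := by ring
  rw [h3, h1, h2]
  ring

lemma fThird_sq_fricke {τ : ℂ} (hτ : 0 < τ.im) :
    fThird (-1 / ((3 : ℕ) * τ)) ^ 2 = -3 * τ ^ 2 * fThird τ ^ 2 := by
  have h1 := sqrt_natCast_sq 3
  have h2 := Complex.I_sq
  rw [fThird_fricke hτ]
  generalize ((√((3 : ℕ) : ℝ) : ℝ) : ℂ) = r at h1 ⊢
  push_cast at h1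
  linear_combination (Complex.I ^ 2 * τ ^ 2 * fThird τ ^ 2) * h1 + 3 * τ ^ 2 * fThird τ ^ 2 * h2

/-- The difference has weight 2 and vanishes at the cusp. Its cube has the weight 6 and the sign of
(η(τ)η(3τ))⁶, and order at least 3 against 1. -/
lemma fThird_sq {τ : ℂ} (hτ : 0 < τ.im) : fThird τ ^ 2 = logD tThird τ := by
  obtain ⟨γ, hγ, hγ0, -⟩ := onDisc_logD_tThird
  have hX := (onDisc_fThird.pow 2).sub hγ
  obtain ⟨ξ, hξ, hξe⟩ := exists_eq_mul_of_zero hX.diff (by simp [hγ0, cubicA_zero])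
  have hH : OnDisc (fun τ => (fThird τ ^ 2 - logD tThird τ) ^ 3 / etaProd 3 6 τ)
      (fun q => (q ^ 2 * ξ q ^ 3) / eulerProd₂ 3 6 q) := by
    refine OnDisc.div_of_pow 1 ((hX.pow 3).congr fun q _ => ?_) (by fun_prop)
      ((onDisc_etaProd three_ne_zero (by norm_num)).congr fun q _ => ?_)
      (differentiableOn_eulerProd₂ three_ne_zero) fun q hq => eulerProd₂_ne_zero three_ne_zero hq
    · rw [hξe]; ring
    · rw [pow_one]
  have hL := hH.eq_const_of_fricke (N := 3) (h := 1) three_pos one_pos (by norm_num)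
    (fun τ hτ => by rw [Complex.ofReal_one]; exact hH.periodic hτ)
    (fun τ hτ => by
      have h1 := fThird_sq_fricke hτ
      have h3 := logD_fricke (N := 3) three_pos onDisc_tThird.hol (fun τ hτ => tThird_ne_zero hτ)
        (fun τ hτ => by simpa using tThird_fricke hτ) hτ
      have h2 := etaProd_three_fricke hτ
      push_cast at h1 h2 h3 ⊢
      rw [h1, h2, h3]
      have := ne_zero_of_im_pos hτ
      have := etaProd_ne_zero (m := 6) three_pos hτ
      field_simp
      ring) hτ
  rw [zero_pow two_ne_zero, zero_mul, zero_div, div_eq_zero_iff,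
    or_iff_left (etaProd_ne_zero three_pos hτ)] at hL
  exact sub_eq_zero.1 (pow_eq_zero_iff three_ne_zero |>.1 hL)

/-- The difference has weight 3; its square is compared with (η(τ)η(3τ))⁶, of weight 6 and order 1.
The right side is (1-t) η(τ)⁹/η(3τ)³, the form needed in the differential equation. -/
lemma fThird_cube {τ : ℂ} (hτ : 0 < τ.im) : fThird τ ^ 3 =
    ModularForm.eta τ ^ 9 / ModularForm.eta ((3 : ℕ) * τ) ^ 3 +
      27 * (ModularForm.eta ((3 : ℕ) * τ) ^ 9 / ModularForm.eta τ ^ 3) := by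
  have hP := differentiableOn_eulerProd
  have hP2 : DifferentiableOn ℂ (fun q => eulerProd (q ^ 3)) (Metric.ball 0 1) :=
    differentiableOn_comp_pow hP three_ne_zero
  have hb : OnDisc (fun τ => ModularForm.eta τ ^ 9 / ModularForm.eta ((3 : ℕ) * τ) ^ 3)
      (fun q => eulerProd q ^ 9 / eulerProd (q ^ 3) ^ 3) := by
    refine ⟨(hP.fun_pow 9).fun_div (hP2.fun_pow 3) fun q hq =>
      pow_ne_zero _ (eulerProd_ne_zero (pow_mem_ball three_ne_zero hq)), fun τ hτ => ?_⟩
    rw [eta_natCast_mul_eq, eta_eq]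
    have := nome24_ne_zero τ
    field_simp
  have hc : OnDisc (fun τ => ModularForm.eta ((3 : ℕ) * τ) ^ 9 / ModularForm.eta τ ^ 3)
      (fun q => q * (eulerProd (q ^ 3) ^ 9 / eulerProd q ^ 3)) := by
    refine ⟨differentiableOn_id.mul ((hP2.fun_pow 9).fun_div (hP.fun_pow 3) fun q hq =>
      pow_ne_zero _ (eulerProd_ne_zero hq)), fun τ hτ => ?_⟩
    rw [eta_natCast_mul_eq, eta_eq, ← nome24_pow]
    have := nome24_ne_zero τ
    have := eulerProd_ne_zero (nome_mem_ball hτ)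
    field_simp
  set X : ℂ → ℂ := fun τ => fThird τ ^ 3 -
    (ModularForm.eta τ ^ 9 / ModularForm.eta ((3 : ℕ) * τ) ^ 3 +
      27 * (ModularForm.eta ((3 : ℕ) * τ) ^ 9 / ModularForm.eta τ ^ 3)) with hX
  have hXd := (onDisc_fThird.pow 3).sub (hb.add ((OnDisc.const 27).mul hc))
  obtain ⟨ξ, hξ, hξe⟩ := exists_eq_mul_of_zero hXd.diff (by simp [cubicA_zero, eulerProd_zero])
  have hH : OnDisc (fun τ => X τ ^ 2 / etaProd 3 6 τ)
      (fun q => (q * ξ q ^ 2) / eulerProd₂ 3 6 q) := by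
    refine OnDisc.div_of_pow 1 ((hXd.pow 2).congr fun q _ => ?_) (by fun_prop)
      ((onDisc_etaProd three_ne_zero (by norm_num)).congr fun q _ => ?_)
      (differentiableOn_eulerProd₂ three_ne_zero) fun q hq => eulerProd₂_ne_zero three_ne_zero hq
    · rw [hξe]; ring
    · rw [pow_one]
  have hXF : ∀ τ : ℂ, 0 < τ.im → X (-1 / ((3 : ℕ) * τ)) ^ 2 = -27 * τ ^ 6 * X τ ^ 2 := by
    intro τ hτ
    have h1 := sFactor_sq τ
    have h2 := sqrt_natCast_sq 3
    have h3 := eta_ne_zero hτ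
    have h4 := eta_ne_zero (im_natCast_mul_pos three_pos hτ)
    have h5 := sFactor_ne_zero hτ
    have h8 : X (-1 / ((3 : ℕ) * τ)) = ((√((3 : ℕ) : ℝ) : ℝ) * sFactor τ ^ 2) ^ 3 * X τ := by
      simp only [hX]
      rw [fThird_fricke hτ, eta_mul_fricke three_pos hτ, eta_fricke three_pos hτ, ← h1]
      generalize ((√((3 : ℕ) : ℝ) : ℝ) : ℂ) = r at h2 ⊢
      have hr : r ≠ 0 := by rintro rfl; norm_num at h2
      have e1 : ∀ a b : ℂ, (r * sFactor τ * a) ^ 9 / (sFactor τ * b) ^ 3 =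
          27 * (r * sFactor τ ^ 2) ^ 3 * (a ^ 9 / b ^ 3) := by
        intro a b
        have : (27 : ℂ) = (r ^ 2) ^ 3 := by rw [h2]; norm_num
        rw [this]
        field_simp
      have e2 : ∀ a b : ℂ, (sFactor τ * a) ^ 9 / (r * sFactor τ * b) ^ 3 =
          (r * sFactor τ ^ 2) ^ 3 / 27 * (a ^ 9 / b ^ 3) := by
        intro a b
        have : (27 : ℂ) = (r ^ 2) ^ 3 := by rw [h2]; norm_num
        rw [this]
        field_simp
      rw [e1, e2]
      ring
    rw [h8, h1]
    generalize ((√((3 : ℕ) : ℝ) : ℝ) : ℂ) = r at h2 ⊢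
    have h9 : ((r * (-Complex.I * τ)) ^ 3 * X τ) ^ 2 =
      (r ^ 2) ^ 3 * (Complex.I ^ 2) ^ 3 * τ ^ 6 * X τ ^ 2 := by ring
    rw [h9, h2, Complex.I_sq]
    push_cast
    ring
  have hL := hH.eq_const_of_fricke (N := 3) (h := 1) three_pos one_pos (by norm_num)
    (fun τ hτ => by rw [Complex.ofReal_one]; exact hH.periodic hτ)
    (fun τ hτ => by
      have h1 := hXF τ hτ
      have h2 := etaProd_three_fricke hτ
      push_cast at h1 h2 ⊢
      rw [h1, h2]
      have := ne_zero_of_im_pos hτ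
      have := etaProd_ne_zero (m := 6) three_pos hτ
      field_simp) hτ
  simp only [zero_mul, zero_div] at hL
  rw [div_eq_zero_iff, or_iff_left (etaProd_ne_zero three_pos hτ)] at hL
  exact sub_eq_zero.1 (pow_eq_zero_iff two_ne_zero |>.1 hL)

/-- Both sides have weight 8 and the same leading coefficient 2 · 1 · 12 = 24, so the difference is
O(q²). Its cube has weight 24 and order at least 6, against weight 24 and order 4 for the fourth
power of `etaProd 3 6`. -/
lemma bracket_fThird_sq {τ : ℂ} (hτ : 0 < τ.im) :
    bracket (fun τ => fThird τ ^ 2) τ = 24 * (etaProd 3 6 τ * fThird τ ^ 2) := by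
  obtain ⟨γ, hγ, hγ0, hγ1⟩ := onDisc_logD_tThird
  have hγ' : OnDisc (fun τ => fThird τ ^ 2) γ := hγ.congr_left fun τ hτ => fThird_sq hτ
  obtain ⟨β, hβ, hβd, hβ0⟩ := hγ'.bracket
  have hE := onDisc_etaProd (N := 3) (m := 6) three_ne_zero (by norm_num)
  have hEd := differentiableOn_eulerProd₂ (N := 3) (m := 6) three_ne_zero
  have hA := onDisc_fThird.diff
  obtain ⟨ρ, hρ, hρe⟩ := exists_eq_mul_of_zero
    (φ := fun q => β q - 24 * (eulerProd₂ 3 6 q * cubicA q ^ 2)) (by fun_prop)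
    (by rw [hβ0, hγ0, hγ1, eulerProd₂_zero three_ne_zero, cubicA_zero]; norm_num)
  have hH : OnDisc (fun τ => (bracket (fun τ => fThird τ ^ 2) τ -
      24 * (etaProd 3 6 τ * fThird τ ^ 2)) ^ 3 / etaProd 3 6 τ ^ 4)
      (fun q => (q ^ 2 * ρ q ^ 3) / eulerProd₂ 3 6 q ^ 4) := by
    refine OnDisc.div_of_pow 4 (OnDisc.congr ((hβ.sub ((OnDisc.const 24).mul
      (hE.mul (onDisc_fThird.pow 2)))).pow 3) fun q _ => ?_) (by fun_prop)
      ((hE.pow 4).congr fun q _ => ?_)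
      (by fun_prop) fun q hq => pow_ne_zero _ (eulerProd₂_ne_zero three_ne_zero hq)
    · have := hρe q
      calc _ = q ^ 3 * (β q - 24 * (eulerProd₂ 3 6 q * cubicA q ^ 2)) ^ 3 := by ring
        _ = _ := by rw [this]; ring
    · rw [mul_pow]
  have hL := hH.eq_const_of_fricke (N := 3) (h := 1) three_pos one_pos (by norm_num)
    (fun τ hτ => by rw [Complex.ofReal_one]; exact hH.periodic hτ)
    (fun τ hτ => by
      have h1 := bracket_fricke (N := 3) three_pos hγ'.hol hγ'.hol
        (fun τ hτ => by simpa using fThird_sq_fricke hτ) hτ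
      have h2 := etaProd_three_fricke hτ
      have h3 := fThird_sq_fricke hτ
      push_cast at h1 h2 h3 ⊢
      rw [h1, h2, h3]
      have := ne_zero_of_im_pos hτ
      have := etaProd_ne_zero (m := 6) three_pos hτ
      rw [div_eq_div_iff (pow_ne_zero _ (mul_ne_zero (mul_ne_zero (by norm_num)
        (pow_ne_zero _ ‹τ ≠ 0›)) ‹_›)) (pow_ne_zero _ ‹_›)]
      ring) hτ
  rw [zero_pow two_ne_zero, zero_mul, zero_div, div_eq_zero_iff,
    or_iff_left (pow_ne_zero _ (etaProd_ne_zero three_pos hτ))] at hL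
  exact sub_eq_zero.1 (pow_eq_zero_iff three_ne_zero |>.1 hL)

theorem uniformizes_third :
    Uniformizes (1 / 3 * (1 - 1 / 3)) tThird (fun τ => fThird τ ^ 2) where
  exists_disc_t := ⟨_, (differentiableOn_eulerQuot three_ne_zero).const_mul _, onDisc_tThird⟩
  exists_disc_g := ⟨_, onDisc_fThird.pow 2, by simp [cubicA_zero]⟩
  ne_zero := fun τ hτ => tThird_ne_zero hτ
  D_t := fun τ hτ => by
    rw [fThird_sq hτ, logD, mul_div_cancel₀ _ (tThird_ne_zero hτ)]
  ode := fun τ hτ => by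
    have h1 := fThird_cube hτ
    have h3 := eta_ne_zero hτ
    have h4 := eta_ne_zero (im_natCast_mul_pos three_pos hτ)
    rw [bracket_fThird_sq hτ, show (fThird τ ^ 2) ^ 4 = (fThird τ ^ 3) ^ 2 * fThird τ ^ 2 by ring,
      h1, tThird_eq, etaQuot, etaProd]
    field_simp
    ring

/-! ### The case of level four -/

/-- The discriminant at `2τ`. -/
def etaD (τ : ℂ) : ℂ := ModularForm.eta ((2 : ℕ) * τ) ^ 24

lemma onDisc_etaD : OnDisc etaD (fun q => q ^ 2 * eulerProd (q ^ 2) ^ 24) := by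
  have hP2 : DifferentiableOn ℂ (fun q => eulerProd (q ^ 2)) (Metric.ball 0 1) :=
    differentiableOn_comp_pow differentiableOn_eulerProd two_ne_zero
  refine ⟨by fun_prop, fun τ hτ => ?_⟩
  rw [etaD, eta_natCast_mul_eq, mul_pow, ← pow_mul, mul_comm 2 24, pow_mul, nome24_pow]

lemma etaD_ne_zero {τ : ℂ} (hτ : 0 < τ.im) : etaD τ ≠ 0 :=
  pow_ne_zero _ (eta_ne_zero (im_natCast_mul_pos two_pos hτ))

lemma im_add_half_pos {τ : ℂ} (hτ : 0 < τ.im) : 0 < (τ + 1 / 2).im := by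
  have : (τ + 1 / 2).im = τ.im := by simp
  rw [this]; exact hτ

lemma im_four_pos {τ : ℂ} (hτ : 0 < τ.im) : 0 < (-1 / (4 * τ)).im := by
  simpa using im_fricke_pos (N := 4) (by norm_num) hτ

lemma etaD_add_half {τ : ℂ} (hτ : 0 < τ.im) : etaD (τ + 1 / 2) = etaD τ := by
  rw [onDisc_etaD.eq τ hτ, onDisc_etaD.eq _ (im_add_half_pos hτ), nome_add_half, neg_sq]

lemma etaD_fricke {τ : ℂ} (hτ : 0 < τ.im) : etaD (-1 / (4 * τ)) = 4096 * τ ^ 12 * etaD τ := by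
  have h0 := ne_zero_of_im_pos hτ
  have e : ((2 : ℕ) : ℂ) * (-1 / (4 * τ)) = -1 / ((2 : ℕ) * τ) := by
    push_cast
    field_simp
    norm_num
  have h1 := sqrt_natCast_sq 2
  rw [etaD, e, eta_fricke two_pos hτ, etaD]
  generalize ((√((2 : ℕ) : ℝ) : ℝ) : ℂ) = r at h1 ⊢
  have h3 : ∀ b : ℂ, (r * sFactor τ * b) ^ 24 = (r ^ 2) ^ 12 * (sFactor τ ^ 2) ^ 12 * b ^ 24 := by
    intro b; ring
  rw [h3, h1, sFactor_sq, mul_pow, neg_pow, show 12 = 4 * 3 by norm_num, pow_mul Complex.I,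
    Complex.I_pow_four]
  norm_num

/-- In the variable 2τ the two maps are the standard generators of the modular group. They permute
θ₂⁴, θ₃⁴, θ₄⁴ up to sign and automorphy factor. -/
lemma OnDisc.eq_const_of_half {H φ : ℂ → ℂ} (hφ : OnDisc H φ)
    (hT : ∀ τ : ℂ, 0 < τ.im → H (τ + 1 / 2) = H τ)
    (hS : ∀ τ : ℂ, 0 < τ.im → H (-1 / (4 * τ)) = H τ) {τ : ℂ} (hτ : 0 < τ.im) : H τ = φ 0 :=
  hφ.eq_const_of_fricke (N := 4) (h := 1 / 2) (by norm_num) (by norm_num) (by norm_num)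
    (fun τ hτ => by push_cast; exact hT τ hτ) (fun τ hτ => by push_cast; exact hS τ hτ) hτ

/-- Fourth powers of the theta functions. -/
def g₂ (τ : ℂ) : ℂ := theta₂ τ ^ 4

def g₃ (τ : ℂ) : ℂ := theta₃ τ ^ 4

def g₄ (τ : ℂ) : ℂ := theta₄ τ ^ 4

lemma differentiableOn_thetaA_neg :
    DifferentiableOn ℂ (fun q => thetaA (-q)) (Metric.ball 0 1) :=
  differentiableOn_thetaA.comp (by fun_prop) fun q hq => by simpa using hq

lemma onDisc_theta₃ : OnDisc theta₃ thetaA := ⟨differentiableOn_thetaA, fun τ _ => theta₃_eq τ⟩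

lemma onDisc_theta₄ : OnDisc theta₄ (fun q => thetaA (-q)) :=
  ⟨differentiableOn_thetaA_neg, fun τ _ => theta₄_eq τ⟩

lemma onDisc_g₃ : OnDisc g₃ (fun q => thetaA q ^ 4) := onDisc_theta₃.pow 4

lemma onDisc_g₄ : OnDisc g₄ (fun q => thetaA (-q) ^ 4) := onDisc_theta₄.pow 4

lemma onDisc_g₂ : OnDisc g₂ (fun q => q * thetaB q ^ 4) := by
  have h := differentiableOn_thetaB
  refine ⟨by fun_prop, fun τ _ => ?_⟩
  rw [g₂, theta₂_eq, mul_pow, ← nome_natCast_mul]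
  congr 2
  push_cast
  ring

lemma g₂_add_half (τ : ℂ) : g₂ (τ + 1 / 2) = -1 * g₂ τ := by
  rw [g₂, theta₂_add_half, mul_pow, show 4 = 2 * 2 by norm_num, pow_mul, nome_eighth_sq,
    Complex.I_sq, g₂]

lemma g₃_add_half (τ : ℂ) : g₃ (τ + 1 / 2) = g₄ τ := by rw [g₃, g₄, theta₃_add_half]

lemma g₄_add_half (τ : ℂ) : g₄ (τ + 1 / 2) = g₃ τ := by rw [g₃, g₄, theta₄_add_half]

lemma thetaFactor_pow_four (τ : ℂ) : thetaFactor τ ^ 4 = -4 * τ ^ 2 := by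
  rw [show 4 = 2 * 2 by norm_num, pow_mul, thetaFactor_sq, mul_pow, neg_sq, Complex.I_sq]
  ring

lemma g₂_fricke {τ : ℂ} (hτ : 0 < τ.im) : g₂ (-1 / (4 * τ)) = -4 * τ ^ 2 * g₄ τ := by
  rw [g₂, theta₂_fricke hτ, mul_pow, thetaFactor_pow_four, g₄]

lemma g₃_fricke {τ : ℂ} (hτ : 0 < τ.im) : g₃ (-1 / (4 * τ)) = -4 * τ ^ 2 * g₃ τ := by
  rw [g₃, theta₃_fricke hτ, mul_pow, thetaFactor_pow_four, g₃]

lemma g₄_fricke {τ : ℂ} (hτ : 0 < τ.im) : g₄ (-1 / (4 * τ)) = -4 * τ ^ 2 * g₂ τ := by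
  rw [g₄, theta₄_fricke hτ, mul_pow, thetaFactor_pow_four, g₂]

lemma eulerProd_sq_ne_zero {q : ℂ} (hq : q ∈ Metric.ball (0 : ℂ) 1) : eulerProd (q ^ 2) ^ 24 ≠ 0 :=
  pow_ne_zero _ (eulerProd_ne_zero (pow_mem_ball two_ne_zero hq))

lemma OnDisc.div_etaD {f φ : ℂ → ℂ} (hf : OnDisc f fun q => q ^ 2 * φ q)
    (hφ : DifferentiableOn ℂ φ (Metric.ball 0 1)) :
    OnDisc (fun τ => f τ / etaD τ) (fun q => φ q / eulerProd (q ^ 2) ^ 24) :=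
  OnDisc.div_of_pow 2 hf hφ onDisc_etaD
    ((differentiableOn_comp_pow differentiableOn_eulerProd two_ne_zero).fun_pow 24)
    fun _ hq => eulerProd_sq_ne_zero hq

/-- Both sides have weight 12 and order 2 at the cusp; the constant is `thetaB 0 ^ 8` = 2⁸. The
nonvanishing of the theta functions is deduced from this. -/
lemma theta_prod {τ : ℂ} (hτ : 0 < τ.im) : (g₂ τ * g₃ τ * g₄ τ) ^ 2 = 256 * etaD τ := by
  have hA := differentiableOn_thetaA
  have hA' := differentiableOn_thetaA_neg
  have hB := differentiableOn_thetaB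
  have hH := OnDisc.div_etaD (f := fun τ => (g₂ τ * g₃ τ * g₄ τ) ^ 2)
    (φ := fun q => (thetaB q ^ 4 * thetaA q ^ 4 * thetaA (-q) ^ 4) ^ 2)
    ((((onDisc_g₂.mul onDisc_g₃).mul onDisc_g₄).pow 2).congr fun q _ => by ring) (by fun_prop)
  have hL := hH.eq_const_of_half
    (fun τ hτ => by
      rw [g₂_add_half, g₃_add_half, g₄_add_half, etaD_add_half hτ]
      ring)
    (fun τ hτ => by
      rw [g₂_fricke hτ, g₃_fricke hτ, g₄_fricke hτ, etaD_fricke hτ]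
      have := ne_zero_of_im_pos hτ
      have := etaD_ne_zero hτ
      field_simp
      ring) hτ
  rw [div_eq_iff (etaD_ne_zero hτ)] at hL
  rw [hL]
  norm_num [eulerProd_zero, thetaA_zero, thetaB_zero]

lemma theta_prod_ne_zero {τ : ℂ} (hτ : 0 < τ.im) : g₂ τ * g₃ τ * g₄ τ ≠ 0 := by
  intro h
  have := theta_prod hτ
  rw [h] at this
  exact etaD_ne_zero hτ (by simpa using this.symm)

lemma g₂_ne_zero {τ : ℂ} (hτ : 0 < τ.im) : g₂ τ ≠ 0 := by
  have := theta_prod_ne_zero hτ; simp_all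

lemma g₃_ne_zero {τ : ℂ} (hτ : 0 < τ.im) : g₃ τ ≠ 0 := by
  have := theta_prod_ne_zero hτ; simp_all

lemma g₄_ne_zero {τ : ℂ} (hτ : 0 < τ.im) : g₄ τ ≠ 0 := by
  have := theta_prod_ne_zero hτ; simp_all

lemma thetaA_ne_zero {q : ℂ} (hq : q ∈ Metric.ball (0 : ℂ) 1) : thetaA q ≠ 0 := by
  by_cases h0 : q = 0
  · rw [h0, thetaA_zero]; exact one_ne_zero
  obtain ⟨τ, hτ, rfl⟩ := exists_nome_eq hq h0
  intro h
  apply g₃_ne_zero hτ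
  rw [g₃, theta₃_eq, h]
  simp

/-- Jacobi's identity. -/
lemma jacobi_identity {τ : ℂ} (hτ : 0 < τ.im) : g₃ τ = g₂ τ + g₄ τ := by
  have hX := onDisc_g₃.sub (onDisc_g₂.add onDisc_g₄)
  obtain ⟨ξ, hξ, hξe⟩ := exists_eq_mul_of_zero hX.diff (by simp [thetaA_zero])
  -- The sixth power has the weight 12 of `etaD`, absorbs the sign under τ ↦ τ + 1/2, and has order
  -- at least 6 against 2.
  have hH := OnDisc.div_etaD (f := fun τ => (g₃ τ - (g₂ τ + g₄ τ)) ^ 6)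
    (φ := fun q => q ^ 4 * ξ q ^ 6) ((hX.pow 6).congr fun q _ => by rw [hξe]; ring) (by fun_prop)
  have hL := hH.eq_const_of_half
    (fun τ hτ => by
      rw [g₂_add_half, g₃_add_half, g₄_add_half, etaD_add_half hτ]
      ring)
    (fun τ hτ => by
      rw [g₂_fricke hτ, g₃_fricke hτ, g₄_fricke hτ, etaD_fricke hτ]
      have := ne_zero_of_im_pos hτ
      have := etaD_ne_zero hτ
      field_simp
      ring) hτ
  rw [zero_pow (by norm_num), zero_mul, zero_div, div_eq_zero_iff,
    or_iff_left (etaD_ne_zero hτ)] at hL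
  exact sub_eq_zero.1 (pow_eq_zero_iff (by norm_num) |>.1 hL)

/-! ### Wronskians and brackets of the fourth powers of theta functions. -/

lemma D_g₂_add_half (τ : ℂ) : D g₂ (τ + 1 / 2) = -1 * D g₂ τ := by
  rw [← D_comp_add, funext g₂_add_half, D_const_mul]

lemma D_g₃_add_half (τ : ℂ) : D g₃ (τ + 1 / 2) = D g₄ τ := by
  rw [← D_comp_add, funext g₃_add_half]

lemma D_g₄_add_half (τ : ℂ) : D g₄ (τ + 1 / 2) = D g₃ τ := by
  rw [← D_comp_add, funext g₄_add_half]

lemma D_D_g₄_add_half (τ : ℂ) : D (D g₄) (τ + 1 / 2) = D (D g₃) τ := by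
  rw [← D_comp_add, funext D_g₄_add_half]

lemma bracket_g₄_add_half (τ : ℂ) : bracket g₄ (τ + 1 / 2) = bracket g₃ τ := by
  rw [bracket, bracket, g₄_add_half, D_g₄_add_half, D_D_g₄_add_half]

lemma D_g₄_eq {τ : ℂ} (hτ : 0 < τ.im) : D g₄ τ = D g₃ τ - D g₂ τ := by
  rw [← D_sub (onDisc_g₃.hol τ hτ) (onDisc_g₂.hol τ hτ)]
  exact D_congr (fun σ hσ => by rw [jacobi_identity hσ]; ring) hτ

/-- By Jacobi's identity each generator multiplies both sides by the same weight 6 factor. The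
difference is O(q²), so its square has weight 12 and order at least 4, against 2 for `etaD`. -/
lemma wronskian_g₂_g₃ {τ : ℂ} (hτ : 0 < τ.im) :
    D g₂ τ * g₃ τ - g₂ τ * D g₃ τ = g₂ τ * g₃ τ * g₄ τ := by
  have hA := differentiableOn_thetaA
  have hA' := differentiableOn_thetaA_neg
  have hB := differentiableOn_thetaB
  have hB' : DifferentiableOn ℂ (deriv thetaB) (Metric.ball 0 1) := hB.deriv Metric.isOpen_ball
  have hA3 : DifferentiableOn ℂ (deriv fun q => thetaA q ^ 4) (Metric.ball 0 1) :=
    (hA.fun_pow 4).deriv Metric.isOpen_ball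
  -- This φ is the difference divided by q. It vanishes at 0, since both remaining terms equal
  -- `thetaB 0 ^ 4` there, and so yields a second factor q.
  obtain ⟨ξ, hξ, hξe⟩ := exists_eq_mul_of_zero
    (φ := fun q => (thetaB q ^ 4 + q * (4 * thetaB q ^ 3 * deriv thetaB q)) * thetaA q ^ 4 -
      q * thetaB q ^ 4 * deriv (fun q => thetaA q ^ 4) q -
      thetaB q ^ 4 * thetaA q ^ 4 * thetaA (-q) ^ 4)
    (by fun_prop) (by simp [thetaA_zero])
  have hX := ((onDisc_g₂.D.mul onDisc_g₃).sub (onDisc_g₂.mul onDisc_g₃.D)).sub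
    ((onDisc_g₂.mul onDisc_g₃).mul onDisc_g₄)
  have hX' := hX.congr (ψ := fun q => q ^ 2 * ξ q) fun q hq => by
    have h1 : HasDerivAt (fun q => q * thetaB q ^ 4)
        (1 * thetaB q ^ 4 + q * (4 * thetaB q ^ 3 * deriv thetaB q)) q := by
      have h2 := (hB.differentiableAt (Metric.isOpen_ball.mem_nhds hq)).hasDerivAt
      exact (hasDerivAt_id q).mul (h2.fun_pow 4)
    rw [h1.deriv]
    have := hξe q
    linear_combination q * this
  have hH := OnDisc.div_etaD
    (f := fun τ => (D g₂ τ * g₃ τ - g₂ τ * D g₃ τ - g₂ τ * g₃ τ * g₄ τ) ^ 2)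
    (φ := fun q => q ^ 2 * ξ q ^ 2) ((hX'.pow 2).congr fun q _ => by ring) (by fun_prop)
  have hL := hH.eq_const_of_half
    (fun τ hτ => by
      rw [g₂_add_half, g₃_add_half, g₄_add_half, etaD_add_half hτ, D_g₂_add_half, D_g₃_add_half,
        D_g₄_eq hτ, jacobi_identity hτ]
      ring)
    (fun τ hτ => by
      have h2 := D_fricke_weight_two (N := 4) (by norm_num) onDisc_g₂.hol onDisc_g₄.hol
        (fun τ hτ => by push_cast; exact g₂_fricke hτ) hτ
      have h3 := D_fricke_weight_two (N := 4) (by norm_num) onDisc_g₃.hol onDisc_g₃.hol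
        (fun τ hτ => by push_cast; exact g₃_fricke hτ) hτ
      push_cast at h2 h3
      rw [g₂_fricke hτ, g₃_fricke hτ, g₄_fricke hτ, etaD_fricke hτ, h2, h3, D_g₄_eq hτ,
        jacobi_identity hτ]
      have h0 := ne_zero_of_im_pos hτ
      have h1 := etaD_ne_zero hτ
      rw [div_eq_div_iff (mul_ne_zero (mul_ne_zero (by norm_num) (pow_ne_zero _ h0)) h1) h1]
      ring) hτ
  rw [zero_pow two_ne_zero, zero_mul, zero_div, div_eq_zero_iff,
    or_iff_left (etaD_ne_zero hτ)] at hL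
  exact sub_eq_zero.1 (pow_eq_zero_iff two_ne_zero |>.1 hL)

lemma wronskian_g₂_g₄ {τ : ℂ} (hτ : 0 < τ.im) :
    D g₂ τ * g₄ τ - g₂ τ * D g₄ τ = g₂ τ * g₃ τ * g₄ τ := by
  have h := wronskian_g₂_g₃ (im_add_half_pos hτ)
  rw [g₂_add_half, g₃_add_half, g₄_add_half, D_g₂_add_half, D_g₃_add_half] at h
  linear_combination -h

lemma D_wronskian {f g p : ℂ → ℂ} (hf : Hol f) (hg : Hol g)
    (h : ∀ τ : ℂ, 0 < τ.im → D f τ * g τ - f τ * D g τ = p τ) {τ : ℂ} (hτ : 0 < τ.im) :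
    D (D f) τ * g τ - f τ * D (D g) τ = D p τ := by
  have h1 := hf τ hτ
  have h2 := hg τ hτ
  have h3 := hf.D τ hτ
  have h4 := hg.D τ hτ
  rw [← D_congr h hτ, D_sub (by fun_prop) (by fun_prop), D_mul h3 h2, D_mul h1 h4]
  ring

/-- Here a, b, c stand for θ₂⁴, θ₃⁴, θ₄⁴, and the subscripts count applications of D. The Wronskian
relations express all derivatives through a₁ and a₂; after that only b = a + c is needed. -/
lemma bracket_relations {a b c a₁ b₁ c₁ a₂ b₂ c₂ p : ℂ} (ha : a ≠ 0) (hb : b ≠ 0) (hc : c ≠ 0)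
    (hbe : b = a + c) (h1 : a₁ * b - a * b₁ = a * b * c) (h2 : a₁ * c - a * c₁ = a * b * c)
    (hp : p = a₁ * b * c + a * b₁ * c + a * b * c₁)
    (h3 : a₂ * b - a * b₂ = p) (h4 : a₂ * c - a * c₂ = p) :
    (2 * c * c₂ - 3 * c₁ ^ 2) / c ^ 2 + a * b = (2 * b * b₂ - 3 * b₁ ^ 2) / b ^ 2 - a * c ∧
    (2 * c * c₂ - 3 * c₁ ^ 2) / c ^ 2 + a * b = (2 * a * a₂ - 3 * a₁ ^ 2) / a ^ 2 + b * c := by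
  have e1 : b₁ = (a₁ * b - a * b * c) / a := by rw [eq_div_iff ha]; linear_combination -h1
  have e2 : c₁ = (a₁ * c - a * b * c) / a := by rw [eq_div_iff ha]; linear_combination -h2
  have e3 : b₂ = (a₂ * b - p) / a := by rw [eq_div_iff ha]; linear_combination -h3
  have e4 : c₂ = (a₂ * c - p) / a := by rw [eq_div_iff ha]; linear_combination -h4
  have e5 : p = 3 * a₁ * b * c - a * b * c * (b + c) := by
    rw [hp, e1, e2]; field_simp; ring
  rw [e3, e4, e1, e2, e5]
  constructor
  · field_simp
    subst hbe
    ring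
  · field_simp
    subst hbe
    ring

lemma D_mul₃ {f g h : ℂ → ℂ} {τ : ℂ} (hf : DifferentiableAt ℂ f τ) (hg : DifferentiableAt ℂ g τ)
    (hh : DifferentiableAt ℂ h τ) : D (fun σ => f σ * g σ * h σ) τ =
      D f τ * g τ * h τ + f τ * D g τ * h τ + f τ * g τ * D h τ := by
  rw [D_mul (by fun_prop) hh, D_mul hf hg]
  ring

lemma bracket_theta_relations {τ : ℂ} (hτ : 0 < τ.im) :
    bracket g₄ τ / g₄ τ ^ 2 + g₂ τ * g₃ τ = bracket g₃ τ / g₃ τ ^ 2 - g₂ τ * g₄ τ ∧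
    bracket g₄ τ / g₄ τ ^ 2 + g₂ τ * g₃ τ = bracket g₂ τ / g₂ τ ^ 2 + g₃ τ * g₄ τ :=
  bracket_relations (g₂_ne_zero hτ) (g₃_ne_zero hτ) (g₄_ne_zero hτ) (jacobi_identity hτ)
    (wronskian_g₂_g₃ hτ) (wronskian_g₂_g₄ hτ)
    (D_mul₃ (onDisc_g₂.hol τ hτ) (onDisc_g₃.hol τ hτ) (onDisc_g₄.hol τ hτ))
    (D_wronskian onDisc_g₂.hol onDisc_g₃.hol (fun _ h => wronskian_g₂_g₃ h) hτ)
    (D_wronskian onDisc_g₂.hol onDisc_g₄.hol (fun _ h => wronskian_g₂_g₄ h) hτ)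

/-- Translation carries this weight 4 expression to the analogous one for θ₃⁴ and the involution to
the one for θ₂⁴; by `bracket_theta_relations` all three coincide. Its cube has weight 12 and order
at least 3, against 2 for `etaD`. -/
lemma bracket_g₄ {τ : ℂ} (hτ : 0 < τ.im) : bracket g₄ τ / g₄ τ ^ 2 + g₂ τ * g₃ τ = 0 := by
  have hA := differentiableOn_thetaA
  have hA' := differentiableOn_thetaA_neg
  have hB := differentiableOn_thetaB
  obtain ⟨β, hβ, hβd, -⟩ := onDisc_g₄.bracket
  have hne : ∀ q ∈ Metric.ball (0 : ℂ) 1, (thetaA (-q) ^ 4) ^ 2 ≠ 0 := fun q hq =>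
    pow_ne_zero _ (pow_ne_zero _ (thetaA_ne_zero (by simpa using hq)))
  have hR := (hβ.div (onDisc_g₄.pow 2) hne).add (onDisc_g₂.mul onDisc_g₃)
  have hρ : DifferentiableOn ℂ
      (fun q => β q / (thetaA (-q) ^ 4) ^ 2 + thetaB q ^ 4 * thetaA q ^ 4) (Metric.ball 0 1) :=
    (hβd.fun_div (by fun_prop) hne).fun_add (by fun_prop)
  have hH := OnDisc.div_etaD (f := fun τ => (bracket g₄ τ / g₄ τ ^ 2 + g₂ τ * g₃ τ) ^ 3)
    (φ := fun q => q * (β q / (thetaA (-q) ^ 4) ^ 2 + thetaB q ^ 4 * thetaA q ^ 4) ^ 3)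
    ((hR.pow 3).congr fun q _ => by ring) (by fun_prop)
  have hL := hH.eq_const_of_half
    (fun τ hτ => by
      rw [bracket_g₄_add_half, g₄_add_half, g₂_add_half, g₃_add_half, etaD_add_half hτ,
        (bracket_theta_relations hτ).1]
      ring)
    (fun τ hτ => by
      have h1 := bracket_fricke (N := 4) (by norm_num) onDisc_g₄.hol onDisc_g₂.hol
        (fun τ hτ => by push_cast; exact g₄_fricke hτ) hτ
      have h0 := ne_zero_of_im_pos hτ
      have h2 := etaD_ne_zero hτ
      have h3 := g₂_ne_zero hτ
      push_cast at h1
      rw [(bracket_theta_relations hτ).2, h1, g₄_fricke hτ, g₂_fricke hτ, g₃_fricke hτ,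
        etaD_fricke hτ]
      field_simp
      ring) hτ
  rw [zero_mul, zero_div, div_eq_zero_iff, or_iff_left (etaD_ne_zero hτ)] at hL
  exact pow_eq_zero_iff three_ne_zero |>.1 hL

lemma tHalf_eq (τ : ℂ) : tHalf τ = g₂ τ / g₃ τ := rfl

lemma fHalf_sq (τ : ℂ) : fHalf τ ^ 2 = g₄ τ := by rw [fHalf, g₄]; ring

lemma onDisc_fHalf : OnDisc fHalf (fun q => thetaA (-q) ^ 2) := onDisc_theta₄.pow 2

theorem uniformizes_half :
    Uniformizes (1 / 2 * (1 - 1 / 2)) tHalf (fun τ => fHalf τ ^ 2) where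
  exists_disc_t := by
    refine ⟨fun q => thetaB q ^ 4 / thetaA q ^ 4,
      (differentiableOn_thetaB.fun_pow 4).fun_div (differentiableOn_thetaA.fun_pow 4)
        fun q hq => pow_ne_zero _ (thetaA_ne_zero hq),
      (onDisc_g₂.div onDisc_g₃ fun q hq => pow_ne_zero _ (thetaA_ne_zero hq)).congr
        fun q _ => by rw [mul_div_assoc]⟩
  exists_disc_g := ⟨_, onDisc_fHalf.pow 2, by simp [thetaA_zero]⟩
  ne_zero := fun τ hτ => div_ne_zero (g₂_ne_zero hτ) (g₃_ne_zero hτ)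
  D_t := fun τ hτ => by
    have h3 := g₃_ne_zero hτ
    rw [fHalf_sq, show tHalf = fun τ => g₂ τ / g₃ τ from rfl,
      D_div (onDisc_g₂.hol τ hτ) (onDisc_g₃.hol τ hτ) h3, wronskian_g₂_g₃ hτ]
    field_simp
  ode := fun τ hτ => by
    have h := bracket_g₄ hτ
    have h2 := g₂_ne_zero hτ
    have h3 := g₃_ne_zero hτ
    have h4 := g₄_ne_zero hτ
    have hj := jacobi_identity hτ
    rw [show (fun τ => fHalf τ ^ 2) = g₄ from funext fHalf_sq, fHalf_sq, tHalf_eq]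
    have e1 : bracket g₄ τ = -(g₂ τ * g₃ τ) * g₄ τ ^ 2 := by
      field_simp at h
      linear_combination h
    have e2 : 1 - g₂ τ / g₃ τ = g₄ τ / g₃ τ := by
      rw [eq_div_iff h3, sub_mul, div_mul_cancel₀ _ h3, hj]
      ring
    rw [e1, e2]
    field_simp
    ring

/-! ### The polynomials `∑ C(n, 2m) C(2m, m) x ^ (n - 2m) w ^ m` -/

/-- The coefficient `C(n, 2m) C(2m, m)`. -/
def legC (n m : ℕ) : ℂ := (n.choose (2 * m) : ℂ) * ((2 * m).choose m : ℂ)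

lemma legC_eq_zero {n m : ℕ} (h : n < 2 * m) : legC n m = 0 := by
  simp [legC, Nat.choose_eq_zero_of_lt h]

/-- The polynomial `∑ C(n, 2m) C(2m, m) x ^ (n - 2m) w ^ m`. -/
def legQ (n : ℕ) (x w : ℂ) : ℂ := ∑ m ∈ Finset.range (n + 1), legC n m * x ^ (n - 2 * m) * w ^ m

/-- The derivative of `legQ` in its second variable. -/
def legV (n : ℕ) (x w : ℂ) : ℂ :=
  ∑ m ∈ Finset.range (n + 1), legC n m * x ^ (n - 2 * m) * (m * w ^ (m - 1))

/-- The second derivative of `legQ` in its second variable. -/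
def legU (n : ℕ) (x w : ℂ) : ℂ :=
  ∑ m ∈ Finset.range (n + 1), legC n m * x ^ (n - 2 * m) * (m * ((m - 1 : ℕ) * w ^ (m - 1 - 1)))

lemma sum_legC_range {n M : ℕ} (hM : n / 2 + 1 ≤ M) (hM' : M ≤ n + 1) (F : ℕ → ℂ) :
    ∑ m ∈ Finset.range (n + 1), legC n m * F m = ∑ m ∈ Finset.range M, legC n m * F m := by
  refine (Finset.sum_subset (Finset.range_mono hM') fun m _ hm => ?_).symm
  rw [Finset.mem_range] at hm
  rw [legC_eq_zero (by omega), zero_mul]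

/-- This is (n-2m) C(n, 2m) = n C(n-1, 2m) with powers of x attached; it yields ∂Qₙ/∂x = n Qₙ₋₁. -/
lemma legC_mul_sub (n m : ℕ) (x : ℂ) :
    legC n m * ((n - 2 * m : ℕ) * x ^ (n - 2 * m - 1)) =
      n * (legC (n - 1) m * x ^ (n - 1 - 2 * m)) := by
  rcases n with _ | n
  · simp
  rcases lt_or_ge n (2 * m) with h | h
  · rw [Nat.add_sub_cancel, legC_eq_zero h, show n + 1 - 2 * m = 0 by omega]
    simp
  have h1 : (n.choose (2 * m) : ℂ) * (n + 1) = ((n + 1).choose (2 * m) : ℂ) * (n + 1 - 2 * m : ℕ) := by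
    exact_mod_cast Nat.choose_mul_succ_eq n (2 * m)
  rw [Nat.add_sub_cancel, show n + 1 - 2 * m - 1 = n - 2 * m by omega, legC, legC]
  push_cast at h1 ⊢
  linear_combination (-((2 * m).choose m : ℂ) * x ^ (n - 2 * m)) * h1

section derivatives
variable {X W : ℂ → ℂ} {x₁ w₁ z : ℂ}

lemma sum_legC_pred (n : ℕ) (x : ℂ) (F : ℕ → ℂ) :
    ∑ m ∈ Finset.range (n + 1), legC n m * ((n - 2 * m : ℕ) * x ^ (n - 2 * m - 1)) * F m =
      n * ∑ m ∈ Finset.range (n - 1 + 1), legC (n - 1) m * x ^ (n - 1 - 2 * m) * F m := by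
  rcases n with _ | n
  · simp
  rw [Finset.sum_range_succ, Nat.add_sub_cancel, Finset.mul_sum, legC_eq_zero (by omega : n + 1 < 2 * (n + 1))]
  rw [zero_mul, zero_mul, add_zero]
  refine Finset.sum_congr rfl fun m _ => ?_
  rw [legC_mul_sub, Nat.add_sub_cancel]
  ring

lemma hasDerivAt_legQ (n : ℕ) (hX : HasDerivAt X x₁ z) (hW : HasDerivAt W w₁ z) :
    HasDerivAt (fun z => legQ n (X z) (W z))
      (n * legQ (n - 1) (X z) (W z) * x₁ + legV n (X z) (W z) * w₁) z := by
  have h : ∀ m ∈ Finset.range (n + 1), HasDerivAt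
      (fun z => legC n m * X z ^ (n - 2 * m) * W z ^ m)
      (legC n m * ((n - 2 * m : ℕ) * X z ^ (n - 2 * m - 1)) * W z ^ m * x₁ +
        legC n m * X z ^ (n - 2 * m) * (m * W z ^ (m - 1)) * w₁) z := by
    intro m _
    refine (((hX.fun_pow (n - 2 * m)).const_mul (legC n m)).mul (hW.fun_pow m)).congr_deriv ?_
    ring
  refine (HasDerivAt.fun_sum h).congr_deriv ?_
  rw [Finset.sum_add_distrib, ← Finset.sum_mul, ← Finset.sum_mul, sum_legC_pred]
  rfl

lemma hasDerivAt_legV (n : ℕ) (hX : HasDerivAt X x₁ z) (hW : HasDerivAt W w₁ z) :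
    HasDerivAt (fun z => legV n (X z) (W z))
      (n * legV (n - 1) (X z) (W z) * x₁ + legU n (X z) (W z) * w₁) z := by
  have h : ∀ m ∈ Finset.range (n + 1), HasDerivAt
      (fun z => legC n m * X z ^ (n - 2 * m) * (m * W z ^ (m - 1)))
      (legC n m * ((n - 2 * m : ℕ) * X z ^ (n - 2 * m - 1)) * (m * W z ^ (m - 1)) * x₁ +
        legC n m * X z ^ (n - 2 * m) * (m * ((m - 1 : ℕ) * W z ^ (m - 1 - 1))) * w₁) z := by
    intro m _
    refine (((hX.fun_pow (n - 2 * m)).const_mul (legC n m)).mul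
      ((hW.fun_pow (m - 1)).const_mul (m : ℂ))).congr_deriv ?_
    ring
  refine (HasDerivAt.fun_sum h).congr_deriv ?_
  rw [Finset.sum_add_distrib, ← Finset.sum_mul, ← Finset.sum_mul, sum_legC_pred]
  rfl

end derivatives

/-! ### Homogeneity of Qₙ and its second-order equation. -/

lemma legC_mul_eq_zero_or (n m : ℕ) : legC n m = 0 ∨ ((n - 2 * m : ℕ) : ℂ) = n - 2 * m := by
  rcases lt_or_ge n (2 * m) with h | h
  · exact Or.inl (legC_eq_zero h)
  · right; push_cast [h]; ring

lemma natCast_mul_pow_pred (k : ℕ) (x : ℂ) : (k : ℂ) * x ^ (k - 1) * x = k * x ^ k := by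
  rcases k with _ | k
  · simp
  · rw [Nat.add_sub_cancel, pow_succ]; ring

/-- Qₙ is homogeneous of degree n when x has degree 1 and w degree 2; this is Euler's identity, with
n Qₙ₋₁ for ∂Qₙ/∂x. -/
lemma legQ_euler (n : ℕ) (x w : ℂ) :
    n * x * legQ (n - 1) x w + 2 * w * legV n x w = n * legQ n x w := by
  have h1 := sum_legC_pred n x (fun m => w ^ m)
  have h2 : n * x * legQ (n - 1) x w = x * (n * legQ (n - 1) x w) := by ring
  rw [h2, legQ, ← h1, legV, legQ, Finset.mul_sum, Finset.mul_sum, Finset.mul_sum,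
    ← Finset.sum_add_distrib]
  refine Finset.sum_congr rfl fun m _ => ?_
  rcases legC_mul_eq_zero_or n m with h | h
  · simp [h]
  · have h3 := natCast_mul_pow_pred (n - 2 * m) x
    have h4 := natCast_mul_pow_pred m w
    rw [h] at h3 ⊢
    linear_combination (legC n m * w ^ m) * h3 + 2 * (legC n m * x ^ (n - 2 * m)) * h4

/-- Euler's identity for ∂Qₙ/∂w, which is homogeneous of degree n - 2. -/
lemma legV_euler (n : ℕ) (x w : ℂ) :
    n * x * legV (n - 1) x w + 2 * w * legU n x w + 2 * legV n x w = n * legV n x w := by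
  have h1 := sum_legC_pred n x (fun m => m * w ^ (m - 1))
  have h2 : n * x * legV (n - 1) x w = x * (n * legV (n - 1) x w) := by ring
  rw [h2]
  rw [legV, ← h1, legV, legU, Finset.mul_sum, Finset.mul_sum, Finset.mul_sum, Finset.mul_sum,
    ← Finset.sum_add_distrib, ← Finset.sum_add_distrib]
  refine Finset.sum_congr rfl fun m _ => ?_
  rcases legC_mul_eq_zero_or n m with h | h
  · simp [h]
  · have h3 := natCast_mul_pow_pred (n - 2 * m) x
    have h4 := natCast_mul_pow_pred (m - 1) w
    have h5 : (m : ℂ) * ((m - 1 : ℕ) : ℂ) = m * (m - 1) := by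
      rcases m with _ | m <;> simp
    rw [h] at h3 ⊢
    linear_combination (legC n m * m * w ^ (m - 1)) * h3 + 2 * (legC n m * m * x ^ (n - 2 * m)) * h4
      + 2 * (legC n m * x ^ (n - 2 * m) * w ^ (m - 1)) * h5

/-- Clear from C(n, 2m) C(2m, m) = n! / ((n-2m)! m!²). -/
lemma sq_mul_legC_succ (n m : ℕ) :
    ((m + 1 : ℕ) : ℂ) ^ 2 * legC n (m + 1) = n * (n - 1) * legC (n - 2) m := by
  rcases n with _ | _ | n
  · rw [legC_eq_zero (by omega)]; simp
  · rw [legC_eq_zero (by omega)]; simp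
  have h1 : ((n : ℂ) + 1) * (n.choose (2 * m) : ℂ) = ((n + 1).choose (2 * m + 1) : ℂ) * (2 * m + 1) := by
    exact_mod_cast Nat.add_one_mul_choose_eq n (2 * m)
  have h2 : ((n : ℂ) + 1 + 1) * ((n + 1).choose (2 * m + 1) : ℂ) =
      ((n + 2).choose (2 * m + 2) : ℂ) * (2 * m + 1 + 1) := by
    exact_mod_cast Nat.add_one_mul_choose_eq (n + 1) (2 * m + 1)
  have h3 : ((m : ℂ) + 1) * ((2 * (m + 1)).choose (m + 1) : ℂ) =
      2 * (2 * m + 1) * ((2 * m).choose m : ℂ) := by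
    exact_mod_cast Nat.succ_mul_centralBinom_succ m
  rw [legC, legC, show n + 1 + 1 - 2 = n by omega, show 2 * (m + 1) = 2 * m + 2 by ring] at *
  push_cast
  linear_combination (((n + 2).choose (2 * m + 2) : ℂ) * (m + 1)) * h3
    - ((n : ℂ) + 2) * ((2 * m).choose m : ℂ) * h1 - (2 * m + 1) * ((2 * m).choose m : ℂ) * h2

/-- In other words ∂_w(w ∂_w Qₙ) = ∂_x² Qₙ, coefficientwise the identity `sq_mul_legC_succ`. -/
lemma legQ_heat (n : ℕ) (x w : ℂ) :
    w * legU n x w + legV n x w = n * (n - 1) * legQ (n - 2) x w := by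
  have h0 : w * legU n x w + legV n x w = ∑ m ∈ Finset.range (n + 1),
      legC n m * (x ^ (n - 2 * m) * (m ^ 2 * w ^ (m - 1))) := by
    rw [legU, legV, Finset.mul_sum, ← Finset.sum_add_distrib]
    refine Finset.sum_congr rfl fun m _ => ?_
    have h4 := natCast_mul_pow_pred (m - 1) w
    have h5 : (m : ℂ) * ((m - 1 : ℕ) : ℂ) = m * (m - 1) := by
      rcases m with _ | m <;> simp
    linear_combination (legC n m * m * x ^ (n - 2 * m)) * h4 +
      (legC n m * x ^ (n - 2 * m) * w ^ (m - 1)) * h5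
  rw [h0, Finset.sum_range_succ', legQ]
  simp only [Nat.cast_zero, ne_eq, OfNat.ofNat_ne_zero, not_false_eq_true, zero_pow, zero_mul,
    mul_zero, add_zero, Nat.add_sub_cancel]
  rw [Finset.mul_sum]
  have h6 : ∀ m, legC n (m + 1) * (x ^ (n - 2 * (m + 1)) * (((m + 1 : ℕ) : ℂ) ^ 2 * w ^ m)) =
      n * (n - 1) * (legC (n - 2) m * x ^ (n - 2 - 2 * m) * w ^ m) := by
    intro m
    rw [show n - 2 * (m + 1) = n - 2 - 2 * m by omega]
    linear_combination (x ^ (n - 2 - 2 * m) * w ^ m) * sq_mul_legC_succ n m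
  rw [Finset.sum_congr rfl fun m _ => h6 m]
  rcases n with _ | _ | n
  · simp
  · simp
  · refine (Finset.sum_subset (Finset.range_mono (by omega)) fun m _ hm => ?_).symm
    rw [Finset.mem_range] at hm
    rw [legC_eq_zero (by omega)]
    ring

/-! ### Uniform bounds -/

/-- Bound C(2m, m) by 2^(2m); the sum is then the even part of the binomial expansion of (1 + 2)ⁿ.
-/
lemma norm_legC_sum_le (n : ℕ) :
    ∑ m ∈ Finset.range (n / 2 + 1), ‖legC n m‖ ≤ 3 ^ n := by
  have h1 : ∀ m ∈ Finset.range (n / 2 + 1), ‖legC n m‖ ≤ (n.choose (2 * m) * 2 ^ (2 * m) : ℝ) := by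
    intro m _
    rw [legC, norm_mul, Complex.norm_natCast, Complex.norm_natCast]
    refine mul_le_mul_of_nonneg_left ?_ (by positivity)
    exact_mod_cast Nat.choose_le_two_pow (2 * m) m
  refine (Finset.sum_le_sum h1).trans ?_
  have h2 : ∑ m ∈ Finset.range (n / 2 + 1), (n.choose (2 * m) * 2 ^ (2 * m) : ℝ) =
      ∑ k ∈ (Finset.range (n / 2 + 1)).image (fun m => 2 * m), (n.choose k * 2 ^ k : ℝ) := by
    rw [Finset.sum_image]
    intro a _ b _ h
    simpa using h
  rw [h2]
  have h3 : ∑ k ∈ Finset.range (n + 1), (n.choose k * 2 ^ k : ℝ) = 3 ^ n := by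
    have := add_pow (2 : ℝ) 1 n
    norm_num at this
    rw [this]
    exact Finset.sum_congr rfl fun k _ => by ring
  rw [← h3]
  refine Finset.sum_le_sum_of_subset_of_nonneg ?_ fun _ _ _ => by positivity
  intro k hk
  simp only [Finset.mem_image, Finset.mem_range] at hk ⊢
  obtain ⟨m, hm, rfl⟩ := hk
  omega

lemma norm_legQ_sum_le {ε : ℝ} {x w : ℂ} (hx : ‖x‖ ≤ ε) (hw : ‖w‖ ≤ ε ^ 2) (n : ℕ) :
    ∑ m ∈ Finset.range (n / 2 + 1), ‖legC n m * x ^ (n - 2 * m) * w ^ m‖ ≤ (3 * ε) ^ n := by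
  have hε : 0 ≤ ε := (norm_nonneg _).trans hx
  rw [mul_pow]
  refine le_trans ?_ (mul_le_mul_of_nonneg_right (norm_legC_sum_le n) (pow_nonneg hε n))
  rw [Finset.sum_mul]
  refine Finset.sum_le_sum fun m hm => ?_
  rw [Finset.mem_range] at hm
  rw [norm_mul, norm_mul, norm_pow, norm_pow, mul_assoc]
  refine mul_le_mul_of_nonneg_left ?_ (norm_nonneg _)
  calc ‖x‖ ^ (n - 2 * m) * ‖w‖ ^ m ≤ ε ^ (n - 2 * m) * (ε ^ 2) ^ m := by gcongr
    _ = ε ^ n := by rw [← pow_mul, ← pow_add]; congr 1; omega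

lemma legQ_eq (n : ℕ) (x w : ℂ) :
    legQ n x w = ∑ m ∈ Finset.range (n / 2 + 1), legC n m * x ^ (n - 2 * m) * w ^ m := by
  have := sum_legC_range (n := n) (M := n / 2 + 1) le_rfl (by omega)
    (fun m => x ^ (n - 2 * m) * w ^ m)
  simp only [← mul_assoc] at this
  exact this

lemma norm_legQ_le {ε : ℝ} {x w : ℂ} (hx : ‖x‖ ≤ ε) (hw : ‖w‖ ≤ ε ^ 2) (n : ℕ) :
    ‖legQ n x w‖ ≤ (3 * ε) ^ n := by
  rw [legQ_eq]
  exact (norm_sum_le _ _).trans (norm_legQ_sum_le hx hw n)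

/-! ### The hypergeometric coefficients -/

/-- The coefficient `(a)_n (1-a)_n / (n!)²`. -/
def hypA (a : ℂ) (n : ℕ) : ℂ :=
  (ascPochhammer ℂ n).eval a * (ascPochhammer ℂ n).eval (1 - a) / (n.factorial : ℂ) ^ 2

lemma hypA_zero (a : ℂ) : hypA a 0 = 1 := by simp [hypA]

lemma hypA_succ (a : ℂ) (n : ℕ) :
    hypA a (n + 1) * ((n : ℂ) + 1) ^ 2 = hypA a n * ((n * (n + 1) : ℂ) + a * (1 - a)) := by
  have h1 : ((n.factorial : ℕ) : ℂ) ≠ 0 := by exact_mod_cast n.factorial_ne_zero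
  have h2 : (n : ℂ) + 1 ≠ 0 := by exact_mod_cast n.succ_ne_zero
  rw [hypA, hypA, ascPochhammer_succ_eval, ascPochhammer_succ_eval, Nat.factorial_succ]
  push_cast
  field_simp
  ring

/-- The ratio of consecutive coefficients is (n(n+1) + a(1-a))/(n+1)², which lies in [0, 1]. -/
lemma norm_hypA_le {a : ℝ} (h0 : 0 ≤ a) (h1 : a ≤ 1) (n : ℕ) : ‖hypA a n‖ ≤ 1 := by
  induction n with
  | zero => simp [hypA_zero]
  | succ n ih =>
    have h := congrArg norm (hypA_succ a n)
    have h2 : ((n * (n + 1) : ℂ) + a * (1 - a)) = ((n * (n + 1) + a * (1 - a) : ℝ) : ℂ) := by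
      push_cast; ring
    have h3 : ‖((n : ℂ) + 1) ^ 2‖ = ((n : ℝ) + 1) ^ 2 := by
      rw [norm_pow]; congr 1; exact_mod_cast Complex.norm_natCast (n + 1)
    have hn : (0 : ℝ) ≤ n := n.cast_nonneg
    have h5 : (0 : ℝ) ≤ n * (n + 1) + a * (1 - a) := by
      have := mul_nonneg h0 (sub_nonneg.2 h1)
      positivity
    rw [norm_mul, norm_mul, h2, h3, Complex.norm_real, Real.norm_of_nonneg h5] at h
    have h6 : (n : ℝ) * (n + 1) + a * (1 - a) ≤ (n + 1) ^ 2 := by nlinarith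
    by_contra hc
    push Not at hc
    have h7 : (0 : ℝ) < ((n : ℝ) + 1) ^ 2 := by positivity
    nlinarith [norm_nonneg (hypA a n)]

/-! ### The two-variable hypergeometric series -/

/-- The first coordinate `z₁ + z₂ - 2 z₁ z₂`. -/
def xCoord (z₁ z₂ : ℂ) : ℂ := z₁ + z₂ - 2 * z₁ * z₂

/-- The second coordinate `z₁ (1 - z₁) z₂ (1 - z₂)`. -/
def wCoord (z₁ z₂ : ℂ) : ℂ := z₁ * (1 - z₁) * (z₂ * (1 - z₂))

/-- The series `∑ (a)_n (1-a)_n / (n!)² Q_n`. -/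
def hypG (a z₂ z₁ : ℂ) : ℂ := ∑' n : ℕ, hypA a n * legQ n (xCoord z₁ z₂) (wCoord z₁ z₂)

lemma hasDerivAt_xCoord (z₁ z₂ : ℂ) : HasDerivAt (fun z => xCoord z z₂) (1 - 2 * z₂) z₁ := by
  have := ((hasDerivAt_id z₁).add_const z₂).sub (((hasDerivAt_id z₁).const_mul 2).mul_const z₂)
  exact this.congr_deriv (by ring)

lemma hasDerivAt_wCoord (z₁ z₂ : ℂ) :
    HasDerivAt (fun z => wCoord z z₂) ((1 - 2 * z₁) * (z₂ * (1 - z₂))) z₁ := by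
  have := ((hasDerivAt_id z₁).mul ((hasDerivAt_id z₁).const_sub 1)).mul_const (z₂ * (1 - z₂))
  refine this.congr_deriv ?_
  simp only [id]
  ring

/-- The polynomial `Q_n` as a function of `z₁`, and its derivative. -/
def legZ (n : ℕ) (z₂ z₁ : ℂ) : ℂ := legQ n (xCoord z₁ z₂) (wCoord z₁ z₂)

def legZ' (n : ℕ) (z₂ z₁ : ℂ) : ℂ :=
  n * legQ (n - 1) (xCoord z₁ z₂) (wCoord z₁ z₂) * (1 - 2 * z₂) +
    legV n (xCoord z₁ z₂) (wCoord z₁ z₂) * ((1 - 2 * z₁) * (z₂ * (1 - z₂)))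

lemma hasDerivAt_legZ (n : ℕ) (z₂ z₁ : ℂ) : HasDerivAt (legZ n z₂) (legZ' n z₂ z₁) z₁ :=
  hasDerivAt_legQ n (hasDerivAt_xCoord z₁ z₂) (hasDerivAt_wCoord z₁ z₂)

/-- The chain rule expresses the left side through the derivatives of Qₙ in x and w; the two Euler
identities and `legQ_heat` eliminate them. Only Qₙ₋₁ and Qₙ survive, with coefficients adapted to
the recursion `hypA_succ`. -/
lemma legZ_ode (n : ℕ) (z₂ z₁ : ℂ) :
    z₁ * (1 - z₁) * deriv (legZ' n z₂) z₁ + (1 - 2 * z₁) * legZ' n z₂ z₁ =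
      n ^ 2 * legZ (n - 1) z₂ z₁ - n * (n + 1) * legZ n z₂ z₁ := by
  have hx := hasDerivAt_xCoord z₁ z₂
  have hw := hasDerivAt_wCoord z₁ z₂
  have h1 : HasDerivAt (fun z : ℂ => (1 - 2 * z) * (z₂ * (1 - z₂))) (-2 * (z₂ * (1 - z₂))) z₁ := by
    have := (((hasDerivAt_id z₁).const_mul 2).const_sub 1).mul_const (z₂ * (1 - z₂))
    exact this.congr_deriv (by ring)
  have h2 := ((((hasDerivAt_legQ (n - 1) hx hw).const_mul (n : ℂ)).mul_const (1 - 2 * z₂)).add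
    ((hasDerivAt_legV n hx hw).mul h1)).deriv
  rw [show deriv (legZ' n z₂) z₁ = _ from h2, legZ', legZ, legZ]
  have e := legQ_euler n (xCoord z₁ z₂) (wCoord z₁ z₂)
  have e' := legV_euler n (xCoord z₁ z₂) (wCoord z₁ z₂)
  have p := legQ_heat n (xCoord z₁ z₂) (wCoord z₁ z₂)
  -- The subtraction in the index truncates at n = 0; the extra factor n makes this and `c1` valid
  -- there too.
  have e1 : (n : ℂ) * ((n - 1) * xCoord z₁ z₂ * legQ (n - 2) (xCoord z₁ z₂) (wCoord z₁ z₂) +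
      2 * wCoord z₁ z₂ * legV (n - 1) (xCoord z₁ z₂) (wCoord z₁ z₂)) =
      n * ((n - 1) * legQ (n - 1) (xCoord z₁ z₂) (wCoord z₁ z₂)) := by
    rcases n with _ | n
    · simp
    have := legQ_euler n (xCoord z₁ z₂) (wCoord z₁ z₂)
    rw [show n + 1 - 2 = n - 1 by omega, Nat.add_sub_cancel]
    push_cast
    linear_combination ((n : ℂ) + 1) * this
  have c1 : (n : ℂ) * (((n - 1 : ℕ) : ℂ) * legQ (n - 1 - 1) (xCoord z₁ z₂) (wCoord z₁ z₂)) =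
      n * ((n - 1) * legQ (n - 2) (xCoord z₁ z₂) (wCoord z₁ z₂)) := by
    rcases n with _ | n
    · simp
    rw [show n + 1 - 1 - 1 = n + 1 - 2 by omega, Nat.add_sub_cancel]
    push_cast
    ring
  generalize legQ n (xCoord z₁ z₂) (wCoord z₁ z₂) = Q0 at *
  generalize legQ (n - 1) (xCoord z₁ z₂) (wCoord z₁ z₂) = Q1 at *
  generalize legQ (n - 1 - 1) (xCoord z₁ z₂) (wCoord z₁ z₂) = Q2' at *
  generalize legQ (n - 2) (xCoord z₁ z₂) (wCoord z₁ z₂) = Q2 at *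
  generalize legV n (xCoord z₁ z₂) (wCoord z₁ z₂) = V0 at *
  generalize legV (n - 1) (xCoord z₁ z₂) (wCoord z₁ z₂) = V1 at *
  generalize legU n (xCoord z₁ z₂) (wCoord z₁ z₂) = U0 at *
  rw [xCoord, wCoord] at *
  linear_combination (z₂ * (1 - z₂)) * p + (1 - (z₁ + z₂ - 2 * z₁ * z₂)) * e1
    - 2 * (z₁ * (1 - z₁) * (z₂ * (1 - z₂))) * e' - (n + 1) * e
    + z₁ * (1 - z₁) * (1 - 2 * z₂) ^ 2 * c1

/-! ### Convergence and the differential equation of the series -/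

/-- The radius 1/30 ensures |x| ≤ 1/6 and |w| ≤ 1/36, hence |Qₙ| ≤ (3/6)ⁿ and a geometric majorant
of ratio 1/2. -/
lemma norm_xCoord_le {z₁ z₂ : ℂ} (h₁ : ‖z₁‖ ≤ 1 / 30) (h₂ : ‖z₂‖ ≤ 1 / 30) :
    ‖xCoord z₁ z₂‖ ≤ 1 / 6 := by
  have h3 : ‖2 * z₁ * z₂‖ ≤ 2 * (1 / 30) * (1 / 30) := by
    rw [norm_mul, norm_mul, Complex.norm_ofNat]
    gcongr
  calc ‖xCoord z₁ z₂‖ ≤ ‖z₁ + z₂‖ + ‖2 * z₁ * z₂‖ := norm_sub_le _ _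
    _ ≤ (1 / 30 + 1 / 30) + 2 * (1 / 30) * (1 / 30) :=
      add_le_add ((norm_add_le _ _).trans (add_le_add h₁ h₂)) h3
    _ ≤ 1 / 6 := by norm_num

lemma norm_wCoord_le {z₁ z₂ : ℂ} (h₁ : ‖z₁‖ ≤ 1 / 30) (h₂ : ‖z₂‖ ≤ 1 / 30) :
    ‖wCoord z₁ z₂‖ ≤ (1 / 6) ^ 2 := by
  have h : ∀ z : ℂ, ‖z‖ ≤ 1 / 30 → ‖z * (1 - z)‖ ≤ 1 / 30 * (1 + 1 / 30) := by
    intro z hz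
    rw [norm_mul]
    have : ‖1 - z‖ ≤ 1 + 1 / 30 := (norm_sub_le _ _).trans (by rw [norm_one]; gcongr)
    gcongr
  calc ‖wCoord z₁ z₂‖ = ‖z₁ * (1 - z₁)‖ * ‖z₂ * (1 - z₂)‖ := norm_mul _ _
    _ ≤ (1 / 30 * (1 + 1 / 30)) * (1 / 30 * (1 + 1 / 30)) := by gcongr <;> solve_by_elim
    _ ≤ (1 / 6) ^ 2 := by norm_num

lemma norm_legZ_le {z₁ z₂ : ℂ} (h₁ : ‖z₁‖ ≤ 1 / 30) (h₂ : ‖z₂‖ ≤ 1 / 30) (n : ℕ) :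
    ‖legZ n z₂ z₁‖ ≤ (1 / 2) ^ n := by
  have := norm_legQ_le (norm_xCoord_le h₁ h₂) (norm_wCoord_le h₁ h₂) n
  norm_num at this ⊢
  exact this

lemma hypG_comm (a z₁ z₂ : ℂ) : hypG a z₂ z₁ = hypG a z₁ z₂ := by
  have h1 : xCoord z₁ z₂ = xCoord z₂ z₁ := by rw [xCoord, xCoord]; ring
  have h2 : wCoord z₁ z₂ = wCoord z₂ z₁ := by rw [wCoord, wCoord]; ring
  rw [hypG, hypG, h1, h2]

lemma hypG_zero (a : ℂ) : hypG a 0 0 = 1 := by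
  rw [hypG, tsum_eq_single 0]
  · simp [hypA_zero, legQ, legC]
  · intro n hn
    rw [legQ, Finset.sum_eq_zero, mul_zero]
    intro m _
    rcases lt_or_ge n (2 * m) with h | h
    · rw [legC_eq_zero h]; ring
    rcases Nat.eq_zero_or_pos m with rfl | hm
    · simp [xCoord, hn]
    · simp [wCoord, hm.ne']

/-- The partial sums of `hypG`. -/
def hypS (a z₂ : ℂ) (N : ℕ) (z₁ : ℂ) : ℂ := ∑ n ∈ Finset.range N, hypA a n * legZ n z₂ z₁

lemma deriv_hypS (a z₂ : ℂ) (N : ℕ) :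
    deriv (hypS a z₂ N) = fun z => ∑ n ∈ Finset.range N, hypA a n * legZ' n z₂ z :=
  funext fun z => (HasDerivAt.fun_sum fun n _ =>
    (hasDerivAt_legZ n z₂ z).const_mul (hypA a n)).deriv

lemma differentiable_legZ (n : ℕ) (z₂ : ℂ) : Differentiable ℂ (legZ n z₂) :=
  fun z => (hasDerivAt_legZ n z₂ z).differentiableAt

lemma differentiable_legZ' (n : ℕ) (z₂ : ℂ) : Differentiable ℂ (legZ' n z₂) := by
  have : legZ' n z₂ = deriv (legZ n z₂) := funext fun z => (hasDerivAt_legZ n z₂ z).deriv.symm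
  rw [this]
  exact (differentiable_legZ n z₂).deriv

lemma deriv_deriv_hypS (a z₂ : ℂ) (N : ℕ) :
    deriv (deriv (hypS a z₂ N)) =
      fun z => ∑ n ∈ Finset.range N, hypA a n * deriv (legZ' n z₂) z := by
  rw [deriv_hypS]
  exact funext fun z => (HasDerivAt.fun_sum fun n _ =>
    (differentiable_legZ' n z₂ z).hasDerivAt.const_mul (hypA a n)).deriv

lemma differentiable_hypS (a z₂ : ℂ) (N : ℕ) : Differentiable ℂ (hypS a z₂ N) :=
  fun z => (HasDerivAt.fun_sum fun n _ =>
    (hasDerivAt_legZ n z₂ z).const_mul (hypA a n)).differentiableAt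

/-- Telescoping: by `hypA_succ` the multiple of Qₙ produced by the term of index n + 1 cancels the
one produced by index n, and only the last is left. -/
lemma hypS_ode (a z₂ z : ℂ) (N : ℕ) :
    z * (1 - z) * deriv (deriv (hypS a z₂ (N + 1))) z + (1 - 2 * z) * deriv (hypS a z₂ (N + 1)) z
      - a * (1 - a) * hypS a z₂ (N + 1) z =
      -((N * (N + 1) + a * (1 - a)) * (hypA a N * legZ N z₂ z)) := by
  rw [deriv_deriv_hypS, deriv_hypS]
  simp only [hypS]
  induction N with
  | zero =>
    have h := legZ_ode 0 z₂ z
    simp only [zero_add, Finset.sum_range_one, Nat.cast_zero] at h ⊢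
    linear_combination (hypA a 0) * h
  | succ N ih =>
    have h := legZ_ode (N + 1) z₂ z
    have h2 := hypA_succ a N
    rw [Nat.add_sub_cancel] at h
    rw [Finset.sum_range_succ _ (N + 1), Finset.sum_range_succ (fun n => hypA a n * legZ' n z₂ z) (N + 1),
      Finset.sum_range_succ (fun n => hypA a n * legZ n z₂ z) (N + 1)]
    push_cast at h ⊢
    linear_combination ih + (hypA a (N + 1)) * h + legZ N z₂ z * h2

section hypG
variable {a : ℝ} (h0 : 0 ≤ a) (h1 : a ≤ 1) {z₂ : ℂ} (h₂ : ‖z₂‖ ≤ 1 / 30)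
include h0 h1 h₂

lemma norm_hypA_mul_legZ_le (n : ℕ) {z : ℂ} (hz : ‖z‖ ≤ 1 / 30) :
    ‖hypA a n * legZ n z₂ z‖ ≤ (1 / 2) ^ n := by
  rw [norm_mul]
  calc _ ≤ 1 * (1 / 2 : ℝ) ^ n := by
        gcongr
        · exact norm_hypA_le h0 h1 n
        · exact norm_legZ_le hz h₂ n
    _ = _ := one_mul _

lemma tendsto_hypS : TendstoLocallyUniformlyOn (hypS a z₂) (hypG a z₂) atTop
    (Metric.ball 0 (1 / 30)) := by
  have hs : Summable fun n : ℕ => (1 / 2 : ℝ) ^ n := summable_geometric_two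
  exact (tendstoUniformlyOn_tsum_nat hs fun n z hz =>
    norm_hypA_mul_legZ_le h0 h1 h₂ n (mem_ball_zero_iff.1 hz).le).tendstoLocallyUniformlyOn

lemma differentiableOn_hypG : DifferentiableOn ℂ (hypG a z₂) (Metric.ball 0 (1 / 30)) :=
  (tendsto_hypS h0 h1 h₂).differentiableOn
    (Eventually.of_forall fun N => (differentiable_hypS a z₂ N).differentiableOn) Metric.isOpen_ball

/-- Locally uniform convergence of the partial sums passes to both derivatives, and the boundary
term of `hypS_ode` is O(N² 2⁻ᴺ). -/
lemma hypG_ode {z : ℂ} (hz : z ∈ Metric.ball (0 : ℂ) (1 / 30)) :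
    z * (1 - z) * deriv (deriv (hypG a z₂)) z + (1 - 2 * z) * deriv (hypG a z₂) z =
      a * (1 - a) * hypG a z₂ z := by
  have t0 := tendsto_hypS h0 h1 h₂
  have t1 := t0.deriv (Eventually.of_forall fun N => (differentiable_hypS a z₂ N).differentiableOn)
    Metric.isOpen_ball
  have t2 := t1.deriv (Eventually.of_forall fun N =>
    (differentiable_hypS a z₂ N).deriv.differentiableOn) Metric.isOpen_ball
  have l := (((t2.tendsto_at hz).const_mul (z * (1 - z))).add
    ((t1.tendsto_at hz).const_mul (1 - 2 * z))).sub ((t0.tendsto_at hz).const_mul (a * (1 - a) : ℂ))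
  have l' := l.comp (tendsto_add_atTop_nat 1)
  have r : Tendsto (fun N : ℕ => -((N * (N + 1) + a * (1 - a)) * (hypA a N * legZ N z₂ z)))
      atTop (𝓝 0) := by
    rw [← neg_zero]
    refine Tendsto.neg (squeeze_zero_norm (a := fun N : ℕ =>
      ((N : ℝ) ^ 2 * (1 / 2) ^ N + (N : ℝ) * (1 / 2) ^ N) + ‖(a * (1 - a) : ℂ)‖ * (1 / 2) ^ N)
      (fun N => ?_) ?_)
    · rw [norm_mul]
      have := norm_hypA_mul_legZ_le h0 h1 h₂ N (mem_ball_zero_iff.1 hz).le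
      have h3 : ‖(N * (N + 1) + a * (1 - a) : ℂ)‖ ≤ (N : ℝ) ^ 2 + N + ‖(a * (1 - a) : ℂ)‖ := by
        refine (norm_add_le _ _).trans (add_le_add ?_ le_rfl)
        have : (N * (N + 1) : ℂ) = ((N * (N + 1) : ℕ) : ℂ) := by push_cast; ring
        rw [this, Complex.norm_natCast]
        push_cast
        exact le_of_eq (by ring)
      calc _ ≤ ((N : ℝ) ^ 2 + N + ‖(a * (1 - a) : ℂ)‖) * (1 / 2) ^ N := by gcongr
        _ = _ := by ring
    · have e1 := tendsto_pow_const_mul_const_pow_of_abs_lt_one 2 (r := (1 / 2 : ℝ))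
        (by rw [abs_of_pos] <;> norm_num)
      have e2 := tendsto_pow_const_mul_const_pow_of_abs_lt_one 1 (r := (1 / 2 : ℝ))
        (by rw [abs_of_pos] <;> norm_num)
      have e3 := tendsto_pow_const_mul_const_pow_of_abs_lt_one 0 (r := (1 / 2 : ℝ))
        (by rw [abs_of_pos] <;> norm_num)
      have := (e1.add e2).add (e3.const_mul ‖(a * (1 - a) : ℂ)‖)
      simpa using this
  have := tendsto_nhds_unique (l'.congr fun N => hypS_ode a z₂ z N) r
  linear_combination this

end hypG

/-! ### Comparison with the modular form -/

lemma eq_of_deriv_eq_zero_of_tendsto {h : ℂ → ℂ} {C : ℝ} {c : ℂ}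
    (hd : ∀ τ : ℂ, C < τ.im → HasDerivAt h 0 τ)
    (hl : Tendsto h (comap Complex.im atTop) (𝓝 c)) {τ : ℂ} (hτ : C < τ.im) : h τ = c := by
  have ho : IsOpen {τ : ℂ | C < τ.im} := isOpen_lt continuous_const Complex.continuous_im
  have hc : Convex ℝ {τ : ℂ | C < τ.im} := convex_halfSpace_im_gt C
  have key : ∀ σ ∈ {τ : ℂ | C < τ.im}, h σ = h τ := fun σ hσ =>
    ho.is_const_of_deriv_eq_zero hc.isPreconnected
      (fun x hx => (hd x hx).differentiableAt.differentiableWithinAt)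
      (fun x hx => (hd x hx).deriv) hσ hτ
  have he : ∀ᶠ σ in comap Complex.im atTop, h σ = h τ := by
    filter_upwards [preimage_mem_comap (Ioi_mem_atTop C)] with σ hσ using key σ hσ
  have : (comap Complex.im atTop).NeBot := by
    refine comap_neBot fun s hs => ?_
    obtain ⟨b, hb⟩ := (mem_atTop_sets.1 hs)
    exact ⟨⟨0, b⟩, hb b le_rfl⟩
  exact tendsto_nhds_unique (tendsto_const_nhds.congr' (he.mono fun _ h => h.symm)) hl

/-- A square root of `g` near `i∞` that tends to `1`. -/
structure IsRootNearCusp (f g : ℂ → ℂ) : Prop where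
  exists_bound : ∃ C : ℝ, ∀ τ : ℂ, C < τ.im → DifferentiableAt ℂ f τ ∧ f τ ^ 2 = g τ
  tendsto : Tendsto f (comap Complex.im atTop) (𝓝 1)

/-- The coordinate `t / (t - 1)`. -/
def zCoord (t : ℂ → ℂ) (τ : ℂ) : ℂ := t τ / (t τ - 1)

lemma eventually_comap_im {p : ℂ → Prop} :
    (∀ᶠ τ in comap Complex.im atTop, p τ) ↔ ∃ C : ℝ, ∀ τ : ℂ, C < τ.im → p τ := by
  rw [eventually_comap]
  refine ⟨fun h => ?_, fun ⟨C, h⟩ => ?_⟩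
  · obtain ⟨C, hC⟩ := eventually_atTop.1 h
    exact ⟨C, fun τ hτ => hC _ hτ.le τ rfl⟩
  · filter_upwards [eventually_gt_atTop C] with b hb τ hτ using h τ (hτ ▸ hb)

section
variable {κ : ℂ} {t g f : ℂ → ℂ}

lemma Uniformizes.tendsto_t (U : Uniformizes κ t g) :
    Tendsto t (comap Complex.im atTop) (𝓝 0) := by
  obtain ⟨T, -, h⟩ := U.exists_disc_t
  simpa using h.tendsto

lemma Uniformizes.tendsto_g (U : Uniformizes κ t g) :
    Tendsto g (comap Complex.im atTop) (𝓝 1) := by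
  obtain ⟨γ, h, h1⟩ := U.exists_disc_g
  simpa [h1] using h.tendsto

lemma Uniformizes.hol_t (U : Uniformizes κ t g) : Hol t := by
  obtain ⟨T, -, h⟩ := U.exists_disc_t
  exact h.hol

lemma Uniformizes.hol_g (U : Uniformizes κ t g) : Hol g := by
  obtain ⟨γ, h, -⟩ := U.exists_disc_g
  exact h.hol

lemma Uniformizes.tendsto_D_g (U : Uniformizes κ t g) :
    Tendsto (D g) (comap Complex.im atTop) (𝓝 0) := by
  obtain ⟨γ, h, -⟩ := U.exists_disc_g
  simpa using h.D.tendsto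

lemma Uniformizes.tendsto_zCoord (U : Uniformizes κ t g) :
    Tendsto (zCoord t) (comap Complex.im atTop) (𝓝 0) := by
  have := U.tendsto_t.div (U.tendsto_t.sub_const 1) (by norm_num)
  rw [zero_div] at this
  exact this

lemma Uniformizes.hasDerivAt_zCoord (U : Uniformizes κ t g) {τ : ℂ} (hτ : 0 < τ.im)
    (h1 : t τ ≠ 1) : HasDerivAt (zCoord t)
      (2 * Real.pi * Complex.I * (zCoord t τ * (1 - zCoord t τ) * g τ)) τ := by
  have h := hasDerivAt_D (U.hol_t τ hτ)
  have h2 : t τ - 1 ≠ 0 := sub_ne_zero.2 h1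
  refine (h.div (h.sub_const 1) h2).congr_deriv ?_
  rw [U.D_t τ hτ, zCoord]
  field_simp

/-- The function `z (1 - z) f G'(z) - G(z) Dg / (2 f³)`: it is the Wronskian of `f` and `G(z)`,
divided by `g`. -/
def wronskian (t g f G : ℂ → ℂ) (τ : ℂ) : ℂ :=
  f τ * (zCoord t τ * (1 - zCoord t τ) * deriv G (zCoord t τ)) -
    G (zCoord t τ) * D g τ / (2 * f τ ^ 3)

variable {G : ℂ → ℂ} {τ : ℂ}

lemma hasDerivAt_root (hτ : 0 < τ.im) (hg : Hol g) (hf : DifferentiableAt ℂ f τ)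
    (hfg : ∀ᶠ σ in 𝓝 τ, f σ ^ 2 = g σ) (h0 : f τ ≠ 0) :
    HasDerivAt f (2 * Real.pi * Complex.I * (D g τ / (2 * f τ))) τ := by
  refine hf.hasDerivAt.congr_deriv ?_
  have h1 : HasDerivAt g (2 * f τ * deriv f τ) τ := by
    have := (hf.hasDerivAt.fun_pow 2).congr_of_eventuallyEq (hfg.mono fun _ h => h.symm)
    exact this.congr_deriv (by simp)
  have h2 := h1.unique (hasDerivAt_D (hg τ hτ))
  field_simp
  linear_combination h2 / 2

/-- In the variable z both f and G solve (z(1-z)u')' = κu, so z(1-z)(f G' - f' G) is constant. For f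
this equation is the bracket equation, rewritten by means of z(1-z)(1-t)² = -t. -/
lemma hasDerivAt_wronskian (U : Uniformizes κ t g) (hτ : 0 < τ.im) (h1 : t τ ≠ 1)
    (hf : DifferentiableAt ℂ f τ) (hfg : ∀ᶠ σ in 𝓝 τ, f σ ^ 2 = g σ) (h0 : f τ ≠ 0)
    (hG : DifferentiableAt ℂ G (zCoord t τ)) (hG' : DifferentiableAt ℂ (deriv G) (zCoord t τ))
    (ode : zCoord t τ * (1 - zCoord t τ) * deriv (deriv G) (zCoord t τ) +
      (1 - 2 * zCoord t τ) * deriv G (zCoord t τ) = κ * G (zCoord t τ)) :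
    HasDerivAt (wronskian t g f G) 0 τ := by
  have hz := U.hasDerivAt_zCoord hτ h1
  have hd := hasDerivAt_root hτ U.hol_g hf hfg h0
  have hDg := hasDerivAt_D (U.hol_g.D τ hτ)
  have hA := hG.hasDerivAt.comp τ hz
  have hB := hG'.hasDerivAt.comp τ hz
  have hC := (hz.mul (hz.const_sub 1)).mul hB
  have hE := (hd.mul hC).sub ((hA.mul hDg).div ((hd.fun_pow 3).const_mul 2)
    (mul_ne_zero two_ne_zero (pow_ne_zero 3 h0)))
  refine hE.congr_deriv ?_
  have hb := U.ode τ hτ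
  have hs : zCoord t τ * (1 - zCoord t τ) * (1 - t τ) ^ 2 = -t τ := by
    have : t τ - 1 ≠ 0 := sub_ne_zero.2 h1
    rw [zCoord]; field_simp; ring
  have h2 : (1 - t τ) ^ 2 ≠ 0 := pow_ne_zero 2 (sub_ne_zero.2 (Ne.symm h1))
  have hb' : bracket g τ = 4 * κ * (zCoord t τ * (1 - zCoord t τ)) * g τ ^ 4 := by
    refine mul_left_cancel₀ h2 ?_
    linear_combination hb - 4 * κ * g τ ^ 4 * hs
  rw [bracket, ← hfg.self_of_nhds] at hb'
  simp only [Function.comp_apply, Pi.mul_apply]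
  rw [← hfg.self_of_nhds]
  generalize zCoord t τ = s at *
  generalize D (D g) τ = g2 at *
  generalize D g τ = g1 at *
  generalize deriv (deriv G) s = G2 at *
  generalize deriv G s = G1 at *
  generalize G s = G0 at *
  generalize f τ = f0 at *
  field_simp
  push_cast
  linear_combination (Real.pi * Complex.I * f0 ^ 2) *
    ((4 * f0 ^ 8 * s * (1 - s)) * ode - G0 * hb')

end

/-! ### Identification of the series with the product of two modular forms. -/

section
variable {a : ℝ} {t g f : ℂ → ℂ}

/-- The constant Wronskian tends to 0 at i∞ because z and D g do, so it vanishes. Thus G(z)/f is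
constant and equals its limit at the cusp. -/
theorem Uniformizes.hypG_eq_mul (U : Uniformizes (a * (1 - a)) t g) (hf : IsRootNearCusp f g)
    (h0 : 0 ≤ a) (h1 : a ≤ 1) :
    ∃ C : ℝ, ∀ τ : ℂ, C < τ.im → t τ ≠ 1 ∧ ‖zCoord t τ‖ < 1 / 30 ∧
      ∀ z₂ : ℂ, ‖z₂‖ ≤ 1 / 30 → hypG a z₂ (zCoord t τ) = hypG a z₂ 0 * f τ := by
  obtain ⟨C₀, hC₀⟩ := hf.exists_bound
  obtain ⟨C₁, hC₁⟩ := eventually_comap_im.1 <|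
    (U.tendsto_t.eventually_ne zero_ne_one).and <| (hf.tendsto.eventually_ne one_ne_zero).and <|
      U.tendsto_zCoord (Metric.ball_mem_nhds 0 (by norm_num : (0 : ℝ) < 1 / 30))
  refine ⟨max 0 (max C₀ C₁), fun τ hτ => ?_⟩
  have key : ∀ σ : ℂ, max 0 (max C₀ C₁) < σ.im → 0 < σ.im ∧ C₀ < σ.im ∧ C₁ < σ.im := by
    intro σ hσ
    simpa [max_lt_iff] using hσ
  refine ⟨(hC₁ τ (key τ hτ).2.2).1, mem_ball_zero_iff.1 (hC₁ τ (key τ hτ).2.2).2.2,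
    fun z₂ h₂ => ?_⟩
  have hG := differentiableOn_hypG h0 h1 h₂
  have hG' := hG.deriv Metric.isOpen_ball
  have hev : ∀ σ : ℂ, max 0 (max C₀ C₁) < σ.im → ∀ᶠ σ' in 𝓝 σ, f σ' ^ 2 = g σ' := by
    intro σ hσ
    filter_upwards [(isOpen_lt continuous_const Complex.continuous_im).mem_nhds
      (key σ hσ).2.1] with σ' h using (hC₀ σ' h).2
  have hmem : (0 : ℂ) ∈ Metric.ball (0 : ℂ) (1 / 30) := Metric.mem_ball_self (by norm_num)
  have c0 : Tendsto (fun σ => hypG a z₂ (zCoord t σ)) (comap Complex.im atTop)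
      (𝓝 (hypG a z₂ 0)) :=
    (hG.continuousOn.continuousAt (Metric.isOpen_ball.mem_nhds hmem)).tendsto.comp
      U.tendsto_zCoord
  have c1 : Tendsto (fun σ => deriv (hypG a z₂) (zCoord t σ)) (comap Complex.im atTop)
      (𝓝 (deriv (hypG a z₂) 0)) :=
    (hG'.continuousOn.continuousAt (Metric.isOpen_ball.mem_nhds hmem)).tendsto.comp
      U.tendsto_zCoord
  have hWl : Tendsto (wronskian t g f (hypG a z₂)) (comap Complex.im atTop) (𝓝 0) := by
    have := (hf.tendsto.mul ((U.tendsto_zCoord.mul (U.tendsto_zCoord.const_sub 1)).mul c1)).sub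
      ((c0.mul U.tendsto_D_g).div ((hf.tendsto.pow 3).const_mul 2) (by norm_num))
    rw [show (1 : ℂ) * (0 * (1 - 0) * deriv (hypG a z₂) 0) - hypG a z₂ 0 * 0 / (2 * 1 ^ 3) = 0 by
      ring] at this
    exact this
  have hW : ∀ σ : ℂ, max 0 (max C₀ C₁) < σ.im → wronskian t g f (hypG a z₂) σ = 0 := by
    intro σ hσ
    refine eq_of_deriv_eq_zero_of_tendsto (fun σ hσ => ?_) hWl hσ
    have hb := (hC₁ σ (key σ hσ).2.2).2.2
    exact hasDerivAt_wronskian U (key σ hσ).1 (hC₁ σ (key σ hσ).2.2).1 (hC₀ σ (key σ hσ).2.1).1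
      (hev σ hσ) (hC₁ σ (key σ hσ).2.2).2.1 (hG.differentiableAt (Metric.isOpen_ball.mem_nhds hb))
      (hG'.differentiableAt (Metric.isOpen_ball.mem_nhds hb)) (hypG_ode h0 h1 h₂ hb)
  have hR := eq_of_deriv_eq_zero_of_tendsto (h := fun σ => hypG a z₂ (zCoord t σ) / f σ)
    (c := hypG a z₂ 0 / 1) (fun σ hσ => ?_) (c0.div hf.tendsto one_ne_zero) hτ
  · rw [div_one, div_eq_iff (hC₁ τ (key τ hτ).2.2).2.1] at hR
    exact hR
  · obtain ⟨ht1, hf0, hb⟩ := hC₁ σ (key σ hσ).2.2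
    have hd := hasDerivAt_root (key σ hσ).1 U.hol_g (hC₀ σ (key σ hσ).2.1).1 (hev σ hσ) hf0
    have hA := (hG.differentiableAt (Metric.isOpen_ball.mem_nhds hb)).hasDerivAt.comp σ
      (U.hasDerivAt_zCoord (key σ hσ).1 ht1)
    refine (hA.div hd hf0).congr_deriv ?_
    have hw := hW σ hσ
    rw [wronskian] at hw
    simp only [Function.comp_apply]
    rw [← (hC₀ σ (key σ hσ).2.1).2]
    field_simp at hw ⊢
    linear_combination (Real.pi * Complex.I) * hw

/-- Apply `hypG_eq_mul` in the first variable, exchange the variables, and apply it again with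
second coordinate 0. -/
theorem Uniformizes.hypG_eq (U : Uniformizes (a * (1 - a)) t g) (hf : IsRootNearCusp f g)
    (h0 : 0 ≤ a) (h1 : a ≤ 1) :
    ∃ C : ℝ, (∀ τ : ℂ, C < τ.im → t τ ≠ 1 ∧ ‖zCoord t τ‖ < 1 / 30) ∧
      ∀ τ₁ τ₂ : ℂ, C < τ₁.im → C < τ₂.im →
        hypG a (zCoord t τ₂) (zCoord t τ₁) = f τ₁ * f τ₂ := by
  obtain ⟨C, hC⟩ := U.hypG_eq_mul hf h0 h1
  refine ⟨C, fun τ hτ => ⟨(hC τ hτ).1, (hC τ hτ).2.1⟩, fun τ₁ τ₂ hτ₁ hτ₂ => ?_⟩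
  rw [(hC τ₁ hτ₁).2.2 _ (hC τ₂ hτ₂).2.1.le, hypG_comm, (hC τ₂ hτ₂).2.2 0 (by norm_num),
    hypG_zero]
  ring

/-! ### The double series -/

lemma xFun_eq_xCoord {τ₁ τ₂ : ℂ} (h1 : t τ₁ ≠ 1) (h2 : t τ₂ ≠ 1) :
    xFun t τ₁ τ₂ = xCoord (zCoord t τ₁) (zCoord t τ₂) := by
  have e1 : t τ₁ - 1 ≠ 0 := sub_ne_zero.2 h1
  have e2 : t τ₂ - 1 ≠ 0 := sub_ne_zero.2 h2
  have e1' : 1 - t τ₁ ≠ 0 := sub_ne_zero.2 h1.symm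
  have e2' : 1 - t τ₂ ≠ 0 := sub_ne_zero.2 h2.symm
  rw [xFun, xCoord, zCoord, zCoord]
  field_simp
  ring

lemma xFun_sq_mul_yFun {τ₁ τ₂ : ℂ} (h1 : t τ₁ ≠ 1) (h2 : t τ₂ ≠ 1) (h3 : t τ₁ + t τ₂ ≠ 0) :
    xFun t τ₁ τ₂ ^ 2 * yFun t τ₁ τ₂ = wCoord (zCoord t τ₁) (zCoord t τ₂) := by
  have e1 : t τ₁ - 1 ≠ 0 := sub_ne_zero.2 h1
  have e2 : t τ₂ - 1 ≠ 0 := sub_ne_zero.2 h2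
  have e1' : 1 - t τ₁ ≠ 0 := sub_ne_zero.2 h1.symm
  have e2' : 1 - t τ₂ ≠ 0 := sub_ne_zero.2 h2.symm
  rw [xFun, yFun, wCoord, zCoord, zCoord]
  field_simp
  ring

/-- Regrouping by w = x²y is what gives absolute convergence: y is unbounded near t₁ + t₂ = 0, while
w stays small. -/
lemma seriesTerm_eq (a x y : ℂ) {n m : ℕ} (h : m ∈ Finset.range (n / 2 + 1)) :
    seriesTerm a x y n m = hypA a n * (legC n m * x ^ (n - 2 * m) * (x ^ 2 * y) ^ m) := by
  rw [Finset.mem_range] at h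
  have : x ^ n = x ^ (n - 2 * m) * (x ^ 2) ^ m := by
    rw [← pow_mul, ← pow_add]; congr 1; omega
  rw [seriesTerm, hypA, legC, this, mul_pow]
  ring

theorem Uniformizes.hasHypergeometricExpansion (U : Uniformizes (a * (1 - a)) t g)
    (hf : IsRootNearCusp f g) (h0 : 0 ≤ a) (h1 : a ≤ 1) : HasHypergeometricExpansion a t f := by
  obtain ⟨C, hC, hG⟩ := U.hypG_eq hf h0 h1
  refine ⟨C, fun τ₁ τ₂ hτ₁ hτ₂ hne => ?_⟩
  obtain ⟨t1, b1⟩ := hC τ₁ hτ₁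
  obtain ⟨t2, b2⟩ := hC τ₂ hτ₂
  have hx := norm_xCoord_le b1.le b2.le
  have hw := norm_wCoord_le b1.le b2.le
  have hs : Summable fun n : ℕ => (1 / 2 : ℝ) ^ n := summable_geometric_two
  rw [xFun_eq_xCoord t1 t2]
  have hwe := xFun_sq_mul_yFun t1 t2 hne
  rw [xFun_eq_xCoord t1 t2] at hwe
  constructor
  · refine Summable.of_nonneg_of_le (fun n => Finset.sum_nonneg fun _ _ => norm_nonneg _)
      (fun n => ?_) hs
    have hb := norm_legQ_sum_le hx hw n
    norm_num at hb
    rw [one_div, inv_pow, ← one_div]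
    refine le_trans ?_ (hb.trans (le_of_eq (by simp)))
    refine Finset.sum_le_sum fun m hm => ?_
    rw [seriesTerm_eq _ _ _ hm, hwe, norm_mul, norm_mul, norm_mul, norm_pow, norm_pow]
    exact mul_le_of_le_one_left (by positivity) (norm_hypA_le h0 h1 n)
  · have e : (fun n : ℕ => ∑ m ∈ Finset.range (n / 2 + 1),
        seriesTerm a (xCoord (zCoord t τ₁) (zCoord t τ₂)) (yFun t τ₁ τ₂) n m) =
        fun n => hypA a n * legQ n (xCoord (zCoord t τ₁) (zCoord t τ₂))
          (wCoord (zCoord t τ₁) (zCoord t τ₂)) := by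
      funext n
      rw [legQ_eq, Finset.mul_sum]
      refine Finset.sum_congr rfl fun m hm => ?_
      rw [seriesTerm_eq _ _ _ hm, hwe]
    rw [e, FFun, ← hG τ₁ τ₂ hτ₁ hτ₂]
    exact (Summable.of_norm_bounded hs fun n =>
      norm_hypA_mul_legZ_le h0 h1 b2.le n b1.le).hasSum

end

/-! ### The three cases -/

lemma isRootNearCusp_sq {f φ : ℂ → ℂ} (h : OnDisc f φ) (h1 : φ 0 = 1) :
    IsRootNearCusp f fun τ => f τ ^ 2 :=
  ⟨⟨0, fun _ hτ => ⟨h.differentiableAt hτ, rfl⟩⟩, h1 ▸ h.tendsto⟩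

/-- As g tends to 1, it lies in the slit plane for large Im τ, and there the principal root is
holomorphic. -/
theorem isRootNearCusp_fQuarter : IsRootNearCusp fQuarter gQuarter := by
  have h := uniformizes_quarter.tendsto_g
  have hf : ∀ τ, fQuarter τ = gQuarter τ ^ (1 / 2 : ℂ) := fun _ => rfl
  refine ⟨?_, ?_⟩
  · have h2 : ∀ᶠ τ in comap Complex.im atTop, gQuarter τ ∈ Complex.slitPlane :=
      h (Complex.isOpen_slitPlane.mem_nhds Complex.one_mem_slitPlane)
    obtain ⟨C, hC⟩ := eventually_comap_im.1 h2
    refine ⟨max 0 C, fun τ hτ => ?_⟩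
    rw [max_lt_iff] at hτ
    refine ⟨?_, ?_⟩
    · exact (uniformizes_quarter.hol_g τ hτ.1).cpow_const (hC τ hτ.2)
    · rw [hf, ← Complex.cpow_nat_mul]
      norm_num
  · have := (continuousAt_cpow_const (b := 1 / 2) Complex.one_mem_slitPlane).tendsto.comp h
    rw [Complex.one_cpow] at this
    exact this

theorem hasHypergeometricExpansion_half : HasHypergeometricExpansion (1 / 2) tHalf fHalf := by
  have h : Uniformizes (((1 / 2 : ℝ) : ℂ) * (1 - ((1 / 2 : ℝ) : ℂ))) tHalf fun τ => fHalf τ ^ 2 := by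
    have := uniformizes_half; push_cast; exact this
  have := h.hasHypergeometricExpansion
    (isRootNearCusp_sq onDisc_fHalf (by simp [thetaA_zero])) (by norm_num) (by norm_num)
  push_cast at this
  exact this

theorem hasHypergeometricExpansion_third : HasHypergeometricExpansion (1 / 3) tThird fThird := by
  have h : Uniformizes (((1 / 3 : ℝ) : ℂ) * (1 - ((1 / 3 : ℝ) : ℂ))) tThird
      fun τ => fThird τ ^ 2 := by
    have := uniformizes_third; push_cast; exact this
  have := h.hasHypergeometricExpansion
    (isRootNearCusp_sq onDisc_fThird cubicA_zero) (by norm_num) (by norm_num)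
  push_cast at this
  exact this

theorem hasHypergeometricExpansion_quarter :
    HasHypergeometricExpansion (1 / 4) tQuarter fQuarter := by
  have h : Uniformizes (((1 / 4 : ℝ) : ℂ) * (1 - ((1 / 4 : ℝ) : ℂ))) tQuarter gQuarter := by
    have := uniformizes_quarter; push_cast; exact this
  have := h.hasHypergeometricExpansion isRootNearCusp_fQuarter (by norm_num) (by norm_num)
  push_cast at this
  exact this

/-! ### The operators `θ_x` and `θ_y` on analytic functions -/

/-- `Φ` is analytic at `(x, y)`. -/
def An (Φ : ℂ → ℂ → ℂ) (x y : ℂ) : Prop := AnalyticAt ℂ (fun p : ℂ × ℂ => Φ p.1 p.2) (x, y)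

section An
variable {Φ Ψ : ℂ → ℂ → ℂ} {x y : ℂ}

lemma An.eventually (h : An Φ x y) : ∀ᶠ p : ℂ × ℂ in 𝓝 (x, y), An Φ p.1 p.2 :=
  h.eventually_analyticAt

lemma An.hasDerivAt_comp (h : An Φ x y) {X Y : ℂ → ℂ} {X' Y' s : ℂ} (hX : HasDerivAt X X' s)
    (hY : HasDerivAt Y Y' s) (hx : X s = x) (hy : Y s = y) :
    HasDerivAt (fun s => Φ (X s) (Y s))
      (fderiv ℂ (fun p : ℂ × ℂ => Φ p.1 p.2) (x, y) (X', Y')) s := by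
  subst hx hy
  exact h.differentiableAt.hasFDerivAt.comp_hasDerivAt s (hX.prodMk hY)

lemma An.hasDerivAt_left (h : An Φ x y) :
    HasDerivAt (fun s => Φ s y) (fderiv ℂ (fun p : ℂ × ℂ => Φ p.1 p.2) (x, y) (1, 0)) x :=
  h.hasDerivAt_comp (hasDerivAt_id x) (hasDerivAt_const x y) rfl rfl

lemma An.hasDerivAt_right (h : An Φ x y) :
    HasDerivAt (fun s => Φ x s) (fderiv ℂ (fun p : ℂ × ℂ => Φ p.1 p.2) (x, y) (0, 1)) y :=
  h.hasDerivAt_comp (hasDerivAt_const y x) (hasDerivAt_id y) rfl rfl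

lemma An.thetaX_eq (h : An Φ x y) :
    thetaX Φ x y = x * fderiv ℂ (fun p : ℂ × ℂ => Φ p.1 p.2) (x, y) (1, 0) := by
  rw [thetaX, h.hasDerivAt_left.deriv]

lemma An.thetaY_eq (h : An Φ x y) :
    thetaY Φ x y = y * fderiv ℂ (fun p : ℂ × ℂ => Φ p.1 p.2) (x, y) (0, 1) := by
  rw [thetaY, h.hasDerivAt_right.deriv]

lemma An.hasDerivAt_theta (h : An Φ x y) {X Y : ℂ → ℂ} {c α β s : ℂ}
    (hX : HasDerivAt X (c * (α * X s)) s) (hY : HasDerivAt Y (c * (β * Y s)) s)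
    (hx : X s = x) (hy : Y s = y) :
    HasDerivAt (fun s => Φ (X s) (Y s)) (c * (α * thetaX Φ x y + β * thetaY Φ x y)) s := by
  refine (h.hasDerivAt_comp hX hY hx hy).congr_deriv ?_
  rw [h.thetaX_eq, h.thetaY_eq, hx, hy]
  have : ((c * (α * x), c * (β * y)) : ℂ × ℂ) =
      (c * α * x) • ((1, 0) : ℂ × ℂ) + (c * β * y) • ((0, 1) : ℂ × ℂ) := by
    ext <;> simp <;> ring
  rw [this, map_add, map_smul, map_smul, smul_eq_mul, smul_eq_mul]
  ring

lemma An.fderiv_apply (h : An Φ x y) (v : ℂ × ℂ) :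
    An (fun x y => fderiv ℂ (fun p : ℂ × ℂ => Φ p.1 p.2) (x, y) v) x y :=
  ((ContinuousLinearMap.apply ℂ ℂ v).analyticAt _).comp (AnalyticAt.fderiv h)

lemma An.thetaX (h : An Φ x y) : An (thetaX Φ) x y := by
  have h1 : An (fun x' y' => x' * fderiv ℂ (fun p : ℂ × ℂ => Φ p.1 p.2) (x', y') (1, 0)) x y :=
    AnalyticAt.mul analyticAt_fst (h.fderiv_apply (1, 0))
  refine AnalyticAt.congr h1 ?_
  filter_upwards [h.eventually] with p hp using hp.thetaX_eq.symm

lemma An.thetaY (h : An Φ x y) : An (thetaY Φ) x y := by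
  have h1 : An (fun x' y' => y' * fderiv ℂ (fun p : ℂ × ℂ => Φ p.1 p.2) (x', y') (0, 1)) x y :=
    AnalyticAt.mul analyticAt_snd (h.fderiv_apply (0, 1))
  refine AnalyticAt.congr h1 ?_
  filter_upwards [h.eventually] with p hp using hp.thetaY_eq.symm

lemma thetaX_add (h : An Φ x y) (h' : An Ψ x y) :
    thetaX (Φ + Ψ) x y = thetaX Φ x y + thetaX Ψ x y := by
  have := (h.hasDerivAt_left.add h'.hasDerivAt_left).deriv
  rw [h.thetaX_eq, h'.thetaX_eq, ← mul_add, ← this]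
  rfl

lemma thetaX_smul (c : ℂ) (h : An Φ x y) : thetaX (c • Φ) x y = c * thetaX Φ x y := by
  have := (h.hasDerivAt_left.const_mul c).deriv
  rw [h.thetaX_eq, mul_left_comm, ← this]
  rfl

lemma thetaY_add (h : An Φ x y) (h' : An Ψ x y) :
    thetaY (Φ + Ψ) x y = thetaY Φ x y + thetaY Ψ x y := by
  have := (h.hasDerivAt_right.add h'.hasDerivAt_right).deriv
  rw [h.thetaY_eq, h'.thetaY_eq, ← mul_add, ← this]
  rfl

lemma thetaY_smul (c : ℂ) (h : An Φ x y) : thetaY (c • Φ) x y = c * thetaY Φ x y := by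
  have := (h.hasDerivAt_right.const_mul c).deriv
  rw [h.thetaY_eq, mul_left_comm, ← this]
  rfl

lemma An.smul (c : ℂ) (h : An Φ x y) : An (c • Φ) x y := AnalyticAt.mul analyticAt_const h

lemma thetaX_sub (h : An Φ x y) (h' : An Ψ x y) :
    thetaX (Φ - Ψ) x y = thetaX Φ x y - thetaX Ψ x y := by
  have e : Φ - Ψ = Φ + (-1 : ℂ) • Ψ := by rw [neg_one_smul, sub_eq_add_neg]
  rw [e, thetaX_add h (h'.smul _), thetaX_smul _ h']
  ring

lemma thetaY_sub (h : An Φ x y) (h' : An Ψ x y) :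
    thetaY (Φ - Ψ) x y = thetaY Φ x y - thetaY Ψ x y := by
  have e : Φ - Ψ = Φ + (-1 : ℂ) • Ψ := by rw [neg_one_smul, sub_eq_add_neg]
  rw [e, thetaY_add h (h'.smul _), thetaY_smul _ h']
  ring

lemma hasDerivAt_fderiv_apply {F : ℂ × ℂ → ℂ} {c : ℂ → ℂ × ℂ} {c' v : ℂ × ℂ} {s : ℂ}
    (h : AnalyticAt ℂ F (c s)) (hc : HasDerivAt c c' s) :
    HasDerivAt (fun s => fderiv ℂ F (c s) v) (fderiv ℂ (fderiv ℂ F) (c s) c' v) s := by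
  have h1 := h.fderiv.differentiableAt.hasFDerivAt.comp_hasDerivAt s hc
  exact (ContinuousLinearMap.apply ℂ ℂ v).hasFDerivAt.comp_hasDerivAt s h1

lemma An.thetaX_thetaY (h : An Φ x y) :
    Bimodular.thetaX (Bimodular.thetaY Φ) x y = Bimodular.thetaY (Bimodular.thetaX Φ) x y := by
  have hs := (ContDiffAt.isSymmSndFDerivAt_of_omega (AnalyticAt.contDiffAt h)).eq (1, 0) (0, 1)
  have c1 : HasDerivAt (fun s : ℂ => (s, y)) ((1, 0) : ℂ × ℂ) x :=
    (hasDerivAt_id x).prodMk (hasDerivAt_const x y)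
  have c2 : HasDerivAt (fun s : ℂ => (x, s)) ((0, 1) : ℂ × ℂ) y :=
    (hasDerivAt_const y x).prodMk (hasDerivAt_id y)
  have d1 := (hasDerivAt_fderiv_apply (v := (0, 1)) (c := fun s => (s, y)) h c1).const_mul y
  have d2 := (hasDerivAt_fderiv_apply (v := (1, 0)) (c := fun s => (x, s)) h c2).const_mul x
  have e1 : ∀ᶠ s in 𝓝 x, Bimodular.thetaY Φ s y =
      y * fderiv ℂ (fun p : ℂ × ℂ => Φ p.1 p.2) (s, y) (0, 1) := by
    filter_upwards [c1.continuousAt.eventually h.eventually] with s hs using hs.thetaY_eq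
  have e2 : ∀ᶠ s in 𝓝 y, Bimodular.thetaX Φ x s =
      x * fderiv ℂ (fun p : ℂ × ℂ => Φ p.1 p.2) (x, s) (1, 0) := by
    filter_upwards [c2.continuousAt.eventually h.eventually] with s hs using hs.thetaX_eq
  rw [Bimodular.thetaX, Bimodular.thetaY, EventuallyEq.deriv_eq e1, EventuallyEq.deriv_eq e2,
    d1.deriv, d2.deriv, hs]
  ring

end An

/-- The first operator of the system. -/
def hyperX (a : ℂ) (Φ : ℂ → ℂ → ℂ) (x y : ℂ) : ℂ :=
  thetaX (thetaX Φ) x y - 2 * thetaY (thetaX Φ) x y -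
    x * (thetaX (thetaX Φ) x y + thetaX Φ x y + a * (1 - a) * Φ x y)

/-- The second operator of the system. -/
def hyperY (Φ : ℂ → ℂ → ℂ) (x y : ℂ) : ℂ :=
  thetaY (thetaY Φ) x y - y * (4 * thetaY (thetaY Φ) x y - 4 * thetaY (thetaX Φ) x y +
    thetaX (thetaX Φ) x y + 2 * thetaY Φ x y - thetaX Φ x y)

lemma An.hypergeometricSystem {a : ℂ} {Φ : ℂ → ℂ → ℂ} {x y : ℂ} (h : An Φ x y)
    (hX : hyperX a Φ x y = 0) (hY : hyperY Φ x y = 0) : HypergeometricSystem a Φ x y := by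
  rw [hyperX] at hX
  rw [hyperY] at hY
  constructor
  · dsimp only
    rw [thetaX_sub h.thetaX (h.thetaY.smul _), thetaX_smul _ h.thetaY,
      thetaX_add h.thetaX (h.smul _), thetaX_smul _ h, h.thetaX_thetaY]
    simp only [Pi.add_apply, Pi.smul_apply, smul_eq_mul]
    linear_combination hX
  · dsimp only
    rw [thetaX_sub (h.thetaY.smul _) h.thetaX, thetaX_smul _ h.thetaY,
      thetaY_sub (h.thetaY.smul _) h.thetaX, thetaY_smul _ h.thetaY, h.thetaX_thetaY]
    simp only [Pi.sub_apply, Pi.smul_apply, smul_eq_mul]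
    linear_combination hY

/-! ### The differential equations along the two coordinate directions -/

/-- The logarithmic derivative of `x` with respect to `t d/dt`. -/
def dlogX (t u : ℂ) : ℂ := t / (t + u) + t / (1 - t)

/-- The logarithmic derivative of `y` with respect to `t d/dt`. -/
def dlogY (t u : ℂ) : ℂ := (u - t) / (t + u)

section
variable {κ : ℂ} {t g : ℂ → ℂ} {τ τ' : ℂ}

lemma xFun_comm (t : ℂ → ℂ) (τ τ' : ℂ) : xFun t τ τ' = xFun t τ' τ := by
  rw [xFun, xFun, add_comm, mul_comm]

lemma yFun_comm (t : ℂ → ℂ) (τ τ' : ℂ) : yFun t τ τ' = yFun t τ' τ := by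
  rw [yFun, yFun, add_comm, mul_comm]

lemma Uniformizes.hasDerivAt_t (U : Uniformizes κ t g) (hτ : 0 < τ.im) :
    HasDerivAt t (2 * Real.pi * Complex.I * (t τ * g τ)) τ :=
  U.D_t τ hτ ▸ hasDerivAt_D (U.hol_t τ hτ)

lemma Uniformizes.hasDerivAt_xFun (U : Uniformizes κ t g) (hτ : 0 < τ.im) (h1 : t τ ≠ 1)
    (h2 : t τ' ≠ 1) (h3 : t τ + t τ' ≠ 0) :
    HasDerivAt (fun s => xFun t s τ')
      (2 * Real.pi * Complex.I * (g τ * dlogX (t τ) (t τ') * xFun t τ τ')) τ := by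
  have h := U.hasDerivAt_t hτ
  have e1 : 1 - t τ ≠ 0 := sub_ne_zero.2 h1.symm
  have e2 : 1 - t τ' ≠ 0 := sub_ne_zero.2 h2.symm
  refine ((h.add_const (t τ')).div ((h.const_sub 1).mul_const (1 - t τ'))
    (mul_ne_zero e1 e2)).neg.congr_deriv ?_
  rw [xFun, dlogX]
  field_simp
  ring

lemma Uniformizes.hasDerivAt_yFun (U : Uniformizes κ t g) (hτ : 0 < τ.im)
    (h3 : t τ + t τ' ≠ 0) :
    HasDerivAt (fun s => yFun t s τ')
      (2 * Real.pi * Complex.I * (g τ * dlogY (t τ) (t τ') * yFun t τ τ')) τ := by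
  have h := U.hasDerivAt_t hτ
  refine ((h.mul_const (t τ')).div ((h.add_const (t τ')).fun_pow 2)
    (pow_ne_zero 2 h3)).congr_deriv ?_
  rw [yFun, dlogY]
  field_simp
  push_cast
  ring

lemma Uniformizes.hasDerivAt_dlogX (U : Uniformizes κ t g) (hτ : 0 < τ.im) (h1 : t τ ≠ 1)
    (h3 : t τ + t τ' ≠ 0) : HasDerivAt (fun s => dlogX (t s) (t τ'))
      (2 * Real.pi * Complex.I *
        (g τ * (t τ * (t τ' / (t τ + t τ') ^ 2 + 1 / (1 - t τ) ^ 2)))) τ := by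
  have h := U.hasDerivAt_t hτ
  have e1 : 1 - t τ ≠ 0 := sub_ne_zero.2 h1.symm
  refine ((h.div (h.add_const (t τ')) h3).add (h.div (h.const_sub 1) e1)).congr_deriv ?_
  field_simp
  ring

lemma Uniformizes.hasDerivAt_dlogY (U : Uniformizes κ t g) (hτ : 0 < τ.im)
    (h3 : t τ + t τ' ≠ 0) : HasDerivAt (fun s => dlogY (t s) (t τ'))
      (2 * Real.pi * Complex.I * (g τ * (t τ * (-2 * t τ' / (t τ + t τ') ^ 2)))) τ := by
  have h := U.hasDerivAt_t hτ
  refine ((h.const_sub (t τ')).div (h.add_const (t τ')) h3).congr_deriv ?_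
  field_simp
  ring

/-- A square root of a multiple of `g`. -/
lemma hasDerivAt_sqrt {b : ℂ → ℂ} {k : ℂ} (hg : Hol g) (hτ : 0 < τ.im)
    (hb : DifferentiableAt ℂ b τ) (hbg : ∀ᶠ s in 𝓝 τ, b s ^ 2 = g s * k) (hk : k ≠ 0)
    (h0 : g τ ≠ 0) :
    HasDerivAt b (2 * Real.pi * Complex.I * (b τ * D g τ / (2 * g τ))) τ := by
  refine hb.hasDerivAt.congr_deriv ?_
  have h1 : HasDerivAt (fun s => g s * k) (2 * b τ * deriv b τ) τ := by
    have := (hb.hasDerivAt.fun_pow 2).congr_of_eventuallyEq (hbg.mono fun _ h => h.symm)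
    exact this.congr_deriv (by simp)
  have h2 := h1.unique ((hasDerivAt_D (hg τ hτ)).mul_const k)
  have h3 := hbg.self_of_nhds
  have h4 : b τ ≠ 0 := fun h => mul_ne_zero h0 hk (by rw [← h3, h]; ring)
  field_simp
  refine mul_left_cancel₀ h4 ?_
  linear_combination g τ * h2 / 2 - Real.pi * Complex.I * D g τ * h3

/-- M, N, R, E, K stand for θ_x², θ_yθ_x, θ_y², θ_x, θ_y applied to Φ. The right side is the outcome
of differentiating twice along one variable. Comparing the coefficients of N forces the multiplier
2y - dlogX · dlogY. -/
lemma hyper_identity {T T' : ℂ} (e1 : 1 - T ≠ 0) (e2 : 1 - T' ≠ 0) (h3 : T + T' ≠ 0)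
    (κ M N R E K b : ℂ) :
    (2 * (T * T' / (T + T') ^ 2) - dlogX T T' * dlogY T T') *
      (M - 2 * N - -((T + T') / ((1 - T) * (1 - T'))) * (M + E + κ * b)) +
      (R - T * T' / (T + T') ^ 2 * (4 * R - 4 * N + M + 2 * K - E)) =
    dlogX T T' ^ 2 * M + 2 * dlogX T T' * dlogY T T' * N + dlogY T T' ^ 2 * R +
      T * (T' / (T + T') ^ 2 + 1 / (1 - T) ^ 2) * E + T * (-2 * T' / (T + T') ^ 2) * K +
      κ * T / (1 - T) ^ 2 * b := by
  rw [dlogX, dlogY]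
  field_simp
  ring

/-- The restriction b satisfies b² = g k, so D b = b Dg/(2g). The chain rule gives D b = g(dlogX θ_x
+ dlogY θ_y)Φ. Dividing by g, differentiating once more and inserting the bracket equation gives one
linear relation between the two operators. -/
theorem Uniformizes.hyper_along (U : Uniformizes κ t g) {a : ℂ} (ha : a * (1 - a) = κ)
    (hτ : 0 < τ.im) (h1 : t τ ≠ 1) (h2 : t τ' ≠ 1) (h3 : t τ + t τ' ≠ 0) (hg : g τ ≠ 0)
    {b : ℂ → ℂ} {k : ℂ} (hb : AnalyticAt ℂ b τ) (hbg : ∀ᶠ s in 𝓝 τ, b s ^ 2 = g s * k)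
    (hk : k ≠ 0) {Φ : ℂ → ℂ → ℂ} (hΦ : An Φ (xFun t τ τ') (yFun t τ τ'))
    (hbΦ : ∀ᶠ s in 𝓝 τ, b s = Φ (xFun t s τ') (yFun t s τ')) :
    (2 * yFun t τ τ' - dlogX (t τ) (t τ') * dlogY (t τ) (t τ')) *
      hyperX a Φ (xFun t τ τ') (yFun t τ τ') + hyperY Φ (xFun t τ τ') (yFun t τ τ') = 0 := by
  have ht := (U.hol_t τ hτ).continuousAt
  have hX := U.hasDerivAt_xFun hτ h1 h2 h3
  have hY := U.hasDerivAt_yFun hτ h3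
  -- The first-order relation is needed on a neighbourhood, because it is differentiated again
  -- below.
  have key : ∀ᶠ s in 𝓝 τ,
      dlogX (t s) (t τ') * thetaX Φ (xFun t s τ') (yFun t s τ') +
        dlogY (t s) (t τ') * thetaY Φ (xFun t s τ') (yFun t s τ') =
      b s * D g s / (2 * g s ^ 2) := by
    filter_upwards [eventually_im_pos hτ, ht.eventually_ne h1,
      (ht.add_const (t τ')).eventually_ne h3, (U.hol_g τ hτ).continuousAt.eventually_ne hg,
      hb.eventually_analyticAt, eventually_eventually_nhds.2 hbg, eventually_eventually_nhds.2 hbΦ,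
      (hX.continuousAt.prodMk hY.continuousAt).eventually hΦ.eventually] with
      s sτ s1 s3 sg sb sbg sbΦ sΦ
    have d1 := hasDerivAt_sqrt U.hol_g sτ sb.differentiableAt sbg hk sg
    have d2 := (An.hasDerivAt_theta sΦ (U.hasDerivAt_xFun sτ s1 h2 s3) (U.hasDerivAt_yFun sτ s3)
      rfl rfl).congr_of_eventuallyEq sbΦ
    have d3 := mul_left_cancel₀ Complex.two_pi_I_ne_zero (d1.unique d2)
    refine mul_left_cancel₀ sg ?_
    rw [show g s * (b s * D g s / (2 * g s ^ 2)) = b s * D g s / (2 * g s) by field_simp, d3]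
    ring
  have c1 := An.hasDerivAt_theta hΦ.thetaX hX hY rfl rfl
  have c2 := An.hasDerivAt_theta hΦ.thetaY hX hY rfl rfl
  have hd := hasDerivAt_sqrt U.hol_g hτ hb.differentiableAt hbg hk hg
  have l := ((U.hasDerivAt_dlogX hτ h1 h3).mul c1).add ((U.hasDerivAt_dlogY hτ h3).mul c2)
  have r := ((hd.mul (hasDerivAt_D (U.hol_g.D τ hτ))).div
    (((hasDerivAt_D (U.hol_g τ hτ)).fun_pow 2).const_mul 2)
    (mul_ne_zero two_ne_zero (pow_ne_zero 2 hg))).congr_of_eventuallyEq key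
  have h := l.unique r
  simp only [Pi.mul_apply] at h
  have ode := U.ode τ hτ
  rw [hΦ.thetaX_thetaY] at h
  rw [hyperX, hyperY]
  have hv := hbΦ.self_of_nhds
  have e1 : 1 - t τ ≠ 0 := sub_ne_zero.2 h1.symm
  have e2 : 1 - t τ' ≠ 0 := sub_ne_zero.2 h2.symm
  rw [bracket] at ode
  rw [← hv, ha]
  have h' : dlogX (t τ) (t τ') ^ 2 * thetaX (thetaX Φ) (xFun t τ τ') (yFun t τ τ') +
      2 * dlogX (t τ) (t τ') * dlogY (t τ) (t τ') *
        thetaY (thetaX Φ) (xFun t τ τ') (yFun t τ τ') +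
      dlogY (t τ) (t τ') ^ 2 * thetaY (thetaY Φ) (xFun t τ τ') (yFun t τ τ') +
      t τ * (t τ' / (t τ + t τ') ^ 2 + 1 / (1 - t τ) ^ 2) *
        thetaX Φ (xFun t τ τ') (yFun t τ τ') +
      t τ * (-2 * t τ' / (t τ + t τ') ^ 2) * thetaY Φ (xFun t τ τ') (yFun t τ τ') +
      κ * t τ / (1 - t τ) ^ 2 * b τ = 0 := by
    generalize thetaX (thetaX Φ) (xFun t τ τ') (yFun t τ τ') = M at *
    generalize thetaY (thetaX Φ) (xFun t τ τ') (yFun t τ τ') = N at *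
    generalize thetaY (thetaY Φ) (xFun t τ τ') (yFun t τ τ') = R at *
    generalize thetaX Φ (xFun t τ τ') (yFun t τ τ') = E at *
    generalize thetaY Φ (xFun t τ τ') (yFun t τ τ') = K at *
    have hr : ∀ c : ℂ, ((c * (b τ * D g τ / (2 * g τ)) * D g τ + b τ * (c * D (D g) τ)) *
        (2 * g τ ^ 2) - b τ * D g τ * (2 * ((2 : ℕ) * g τ ^ (2 - 1) * (c * D g τ)))) /
        (2 * g τ ^ 2) ^ 2 = c * g τ * -(κ * t τ / (1 - t τ) ^ 2 * b τ) := by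
      intro c
      clear * - ode hg e1
      field_simp
      push_cast
      linear_combination (c * b τ * g τ) * ode
    rw [hr] at h
    refine mul_left_cancel₀ (mul_ne_zero Complex.two_pi_I_ne_zero hg) ?_
    linear_combination h
  rw [← h']
  exact hyper_identity e1 e2 h3 _ _ _ _ _ _ _

end

/-! ### Local coordinates -/

lemma exists_localInverse {X Y : ℂ → ℂ → ℂ} {a b : ℂ} (hX : An X a b) (hY : An Y a b)
    (hJ : jacobian X Y a b ≠ 0) : ∃ σ : ℂ × ℂ → ℂ × ℂ, AnalyticAt ℂ σ (X a b, Y a b) ∧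
      σ (X a b, Y a b) = (a, b) ∧
      (∀ᶠ p : ℂ × ℂ in 𝓝 (a, b), σ (X p.1 p.2, Y p.1 p.2) = p) ∧
      ∀ᶠ q in 𝓝 (X a b, Y a b), (X (σ q).1 (σ q).2, Y (σ q).1 (σ q).2) = q := by
  set P : ℂ × ℂ → ℂ × ℂ := fun p => (X p.1 p.2, Y p.1 p.2) with hP
  have hPa : AnalyticAt ℂ P (a, b) := AnalyticAt.prod hX hY
  set LX := fderiv ℂ (fun p : ℂ × ℂ => X p.1 p.2) (a, b)
  set LY := fderiv ℂ (fun p : ℂ × ℂ => Y p.1 p.2) (a, b)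
  have hd : HasFDerivAt P (LX.prod LY) (a, b) :=
    hX.differentiableAt.hasFDerivAt.prodMk hY.differentiableAt.hasFDerivAt
  have hJ' : LX (1, 0) * LY (0, 1) - LX (0, 1) * LY (1, 0) ≠ 0 := by
    rw [jacobian, hX.hasDerivAt_left.deriv, hX.hasDerivAt_right.deriv, hY.hasDerivAt_left.deriv,
      hY.hasDerivAt_right.deriv] at hJ
    exact hJ
  have hlin : ∀ (L : ℂ × ℂ →L[ℂ] ℂ) (v : ℂ × ℂ), L v = v.1 * L (1, 0) + v.2 * L (0, 1) := by
    intro L v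
    have : v = v.1 • ((1, 0) : ℂ × ℂ) + v.2 • ((0, 1) : ℂ × ℂ) := by ext <;> simp
    conv_lhs => rw [this]
    rw [map_add, map_smul, map_smul, smul_eq_mul, smul_eq_mul]
  have hinj : Function.Injective ((LX.prod LY : ℂ × ℂ →L[ℂ] ℂ × ℂ) : ℂ × ℂ →ₗ[ℂ] ℂ × ℂ) := by
    rw [injective_iff_map_eq_zero]
    intro v hv
    have h1 : LX v = 0 := congrArg Prod.fst hv
    have h2 : LY v = 0 := congrArg Prod.snd hv
    rw [hlin] at h1 h2
    ext
    · refine (mul_eq_zero.1 (?_ : v.1 * _ = 0)).resolve_right hJ'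
      linear_combination LY (0, 1) * h1 - LX (0, 1) * h2
    · refine (mul_eq_zero.1 (?_ : v.2 * _ = 0)).resolve_right hJ'
      linear_combination LX (1, 0) * h2 - LY (1, 0) * h1
  let e : (ℂ × ℂ) ≃L[ℂ] (ℂ × ℂ) :=
    (LinearEquiv.ofInjectiveEndo _ hinj).toContinuousLinearEquiv
  have he : HasFDerivAt P (e : ℂ × ℂ →L[ℂ] ℂ × ℂ) (a, b) := by
    refine hd.congr_fderiv ?_
    ext <;> rfl
  -- Here `⊤` is the analytic smoothness exponent, so the inverse function theorem returns an
  -- analytic local inverse.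
  have hc : ContDiffAt ℂ ⊤ P (a, b) := hPa.contDiffAt
  have hn : (⊤ : WithTop ℕ∞) ≠ 0 := by simp
  have hs := hc.hasStrictFDerivAt' he hn
  refine ⟨hc.localInverse he hn, (hc.to_localInverse he hn).analyticAt,
    hc.localInverse_apply_image he hn, hs.eventually_left_inverse, hs.eventually_right_inverse⟩

/-! ### The system at regular points. -/

section
variable {κ : ℂ} {t g : ℂ → ℂ} {τ₁ τ₂ : ℂ}

lemma An.comp_fst {f : ℂ → ℂ} (h : AnalyticAt ℂ f τ₁) : An (fun s _ => f s) τ₁ τ₂ :=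
  AnalyticAt.fun_comp (g := f) (f := Prod.fst) h analyticAt_fst

lemma An.comp_snd {f : ℂ → ℂ} (h : AnalyticAt ℂ f τ₂) : An (fun _ s => f s) τ₁ τ₂ :=
  AnalyticAt.fun_comp (g := f) (f := Prod.snd) h analyticAt_snd

lemma Uniformizes.analyticAt_t (U : Uniformizes κ t g) (h : 0 < τ₁.im) : AnalyticAt ℂ t τ₁ := by
  obtain ⟨T, -, h'⟩ := U.exists_disc_t
  exact h'.analyticAt_comp h

lemma Uniformizes.analyticAt_g (U : Uniformizes κ t g) (h : 0 < τ₁.im) : AnalyticAt ℂ g τ₁ := by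
  obtain ⟨T, h', -⟩ := U.exists_disc_g
  exact h'.analyticAt_comp h

lemma Uniformizes.an_xFun (U : Uniformizes κ t g) (h₁ : 0 < τ₁.im) (h₂ : 0 < τ₂.im)
    (t1 : t τ₁ ≠ 1) (t2 : t τ₂ ≠ 1) : An (xFun t) τ₁ τ₂ := by
  have a1 : An (fun s _ => t s) τ₁ τ₂ := An.comp_fst (U.analyticAt_t h₁)
  have a2 : An (fun _ s => t s) τ₁ τ₂ := An.comp_snd (U.analyticAt_t h₂)
  exact ((AnalyticAt.add a1 a2).div ((analyticAt_const.sub a1).mul (analyticAt_const.sub a2))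
    (mul_ne_zero (sub_ne_zero.2 t1.symm) (sub_ne_zero.2 t2.symm))).neg

lemma Uniformizes.an_yFun (U : Uniformizes κ t g) (h₁ : 0 < τ₁.im) (h₂ : 0 < τ₂.im)
    (t3 : t τ₁ + t τ₂ ≠ 0) : An (yFun t) τ₁ τ₂ := by
  have a1 : An (fun s _ => t s) τ₁ τ₂ := An.comp_fst (U.analyticAt_t h₁)
  have a2 : An (fun _ s => t s) τ₁ τ₂ := An.comp_snd (U.analyticAt_t h₂)
  exact (AnalyticAt.mul a1 a2).div ((AnalyticAt.add a1 a2).pow 2) (pow_ne_zero 2 t3)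

/-- The Jacobian determinant in terms of logarithmic derivatives. -/
def logJacobian (t u : ℂ) : ℂ := dlogX t u * dlogY u t - dlogX u t * dlogY t u

/-- The factorization shows that at a regular point neither g(τ₁), g(τ₂) nor `logJacobian` vanishes.
-/
lemma Uniformizes.jacobian_eq (U : Uniformizes κ t g) (h₁ : 0 < τ₁.im) (h₂ : 0 < τ₂.im)
    (t1 : t τ₁ ≠ 1) (t2 : t τ₂ ≠ 1) (t3 : t τ₁ + t τ₂ ≠ 0) :
    jacobian (xFun t) (yFun t) τ₁ τ₂ = (2 * Real.pi * Complex.I) ^ 2 * g τ₁ * g τ₂ *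
      xFun t τ₁ τ₂ * yFun t τ₁ τ₂ * logJacobian (t τ₁) (t τ₂) := by
  have t3' : t τ₂ + t τ₁ ≠ 0 := add_comm (t τ₁) (t τ₂) ▸ t3
  have d1 := (U.hasDerivAt_xFun h₂ t2 t1 t3').congr_of_eventuallyEq
    (Eventually.of_forall fun s => xFun_comm t τ₁ s)
  have d2 := (U.hasDerivAt_yFun h₂ t3').congr_of_eventuallyEq
    (Eventually.of_forall fun s => yFun_comm t τ₁ s)
  rw [jacobian, (U.hasDerivAt_xFun h₁ t1 t2 t3).deriv, (U.hasDerivAt_yFun h₁ t3).deriv, d1.deriv,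
    d2.deriv, xFun_comm t τ₂, yFun_comm t τ₂, logJacobian]
  ring

/-- The open condition on a pair of points under which the differential system is derived. -/
structure Regular (t g : ℂ → ℂ) (p : ℂ × ℂ) : Prop where
  im_fst : 0 < p.1.im
  im_snd : 0 < p.2.im
  fst_ne : t p.1 ≠ 1
  snd_ne : t p.2 ≠ 1
  add_ne : t p.1 + t p.2 ≠ 0
  g_fst : g p.1 ≠ 0
  g_snd : g p.2 ≠ 0
  log_ne : logJacobian (t p.1) (t p.2) ≠ 0

lemma Uniformizes.regular (U : Uniformizes κ t g) (h₁ : 0 < τ₁.im) (h₂ : 0 < τ₂.im)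
    (h : IsRegularPoint t τ₁ τ₂) : Regular t g (τ₁, τ₂) := by
  obtain ⟨t1, t2, t3, hJ⟩ := h
  rw [U.jacobian_eq h₁ h₂ t1 t2 t3] at hJ
  exact ⟨h₁, h₂, t1, t2, t3, fun h => hJ (by simp [h]), fun h => hJ (by simp [h]),
    fun h => hJ (by simp [h])⟩

lemma Uniformizes.eventually_regular (U : Uniformizes κ t g) {p : ℂ × ℂ} (h : Regular t g p) :
    ∀ᶠ p' in 𝓝 p, Regular t g p' := by
  have c1 : ContinuousAt (fun p' : ℂ × ℂ => t p'.1) p :=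
    (U.hol_t _ h.im_fst).continuousAt.comp' continuousAt_fst
  have c2 : ContinuousAt (fun p' : ℂ × ℂ => t p'.2) p :=
    (U.hol_t _ h.im_snd).continuousAt.comp' continuousAt_snd
  have c3 : ContinuousAt (fun p' : ℂ × ℂ => g p'.1) p :=
    (U.hol_g _ h.im_fst).continuousAt.comp' continuousAt_fst
  have c4 : ContinuousAt (fun p' : ℂ × ℂ => g p'.2) p :=
    (U.hol_g _ h.im_snd).continuousAt.comp' continuousAt_snd
  have e1 : 1 - t p.1 ≠ 0 := sub_ne_zero.2 h.fst_ne.symm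
  have e2 : 1 - t p.2 ≠ 0 := sub_ne_zero.2 h.snd_ne.symm
  have e3 := h.add_ne
  have e3' : t p.2 + t p.1 ≠ 0 := add_comm (t p.1) (t p.2) ▸ h.add_ne
  have c5' : ContinuousAt (fun z : ℂ × ℂ => logJacobian z.1 z.2) (t p.1, t p.2) := by
    simp only [logJacobian, dlogX, dlogY]
    fun_prop (disch := assumption)
  have c5 : ContinuousAt (fun p' : ℂ × ℂ => logJacobian (t p'.1) (t p'.2)) p :=
    ContinuousAt.comp (f := fun p' : ℂ × ℂ => (t p'.1, t p'.2)) c5' (c1.prodMk c2)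
  filter_upwards [(isOpen_lt continuous_const (Complex.continuous_im.comp continuous_fst)).mem_nhds
      h.im_fst, (isOpen_lt continuous_const (Complex.continuous_im.comp continuous_snd)).mem_nhds
      h.im_snd, c1.eventually_ne h.fst_ne, c2.eventually_ne h.snd_ne,
    (c1.add c2).eventually_ne h.add_ne, c3.eventually_ne h.g_fst, c4.eventually_ne h.g_snd,
    c5.eventually_ne h.log_ne] with p' h1 h2 h3 h4 h5 h6 h7 h8
  exact ⟨h1, h2, h3, h4, h5, h6, h7, h8⟩

/-- The relations along τ₁ and τ₂ both contain `hyperY` with coefficient 1, and their multipliers of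
`hyperX` differ by `logJacobian` ≠ 0. Subtracting kills `hyperX`, and then `hyperY`. -/
theorem Uniformizes.hypergeometricSystem (U : Uniformizes κ t g) {a : ℂ} (ha : a * (1 - a) = κ)
    (h : Regular t g (τ₁, τ₂)) {B Φ : ℂ → ℂ → ℂ} (hB : An B τ₁ τ₂)
    (hBg : ∀ᶠ p : ℂ × ℂ in 𝓝 (τ₁, τ₂), B p.1 p.2 ^ 2 = g p.1 * g p.2)
    (hΦ : An Φ (xFun t τ₁ τ₂) (yFun t τ₁ τ₂))
    (hBΦ : ∀ᶠ p : ℂ × ℂ in 𝓝 (τ₁, τ₂), B p.1 p.2 = Φ (xFun t p.1 p.2) (yFun t p.1 p.2)) :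
    HypergeometricSystem a Φ (xFun t τ₁ τ₂) (yFun t τ₁ τ₂) := by
  obtain ⟨h₁, h₂, t1, t2, t3, g1, g2, hJ⟩ := h
  dsimp only at *
  have c1 : AnalyticAt ℂ (fun s : ℂ => (s, τ₂)) τ₁ := analyticAt_id.prod analyticAt_const
  have c2 : AnalyticAt ℂ (fun s : ℂ => (τ₁, s)) τ₂ := analyticAt_const.prod analyticAt_id
  have E1 := U.hyper_along (Φ := Φ) (b := fun s => B s τ₂) (k := g τ₂) ha h₁ t1 t2 t3 g1
    (AnalyticAt.fun_comp (g := fun p : ℂ × ℂ => B p.1 p.2) (f := fun s : ℂ => (s, τ₂)) hB c1)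
    (c1.continuousAt.eventually hBg) g2 hΦ (c1.continuousAt.eventually hBΦ)
  rw [xFun_comm, yFun_comm] at hΦ
  have E2 := U.hyper_along (Φ := Φ) (b := fun s => B τ₁ s) (k := g τ₁) ha h₂ t2 t1
    (add_comm (t τ₁) (t τ₂) ▸ t3) g2
    (AnalyticAt.fun_comp (g := fun p : ℂ × ℂ => B p.1 p.2) (f := fun s : ℂ => (τ₁, s)) hB c2)
    ((c2.continuousAt.eventually hBg).mono fun s hs => by rw [hs, mul_comm]) g1 hΦ
    ((c2.continuousAt.eventually hBΦ).mono fun s hs => by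
      rw [hs, xFun_comm, yFun_comm])
  rw [xFun_comm, yFun_comm] at hΦ
  rw [xFun_comm t τ₂, yFun_comm t τ₂] at E2
  have hneg : dlogY (t τ₂) (t τ₁) = -dlogY (t τ₁) (t τ₂) := by
    rw [dlogY, dlogY, add_comm (t τ₂)]; ring
  rw [logJacobian, hneg] at hJ
  rw [hneg] at E2
  have hX : hyperX a Φ (xFun t τ₁ τ₂) (yFun t τ₁ τ₂) = 0 := by
    refine mul_left_cancel₀ hJ ?_
    linear_combination E1 - E2
  refine hΦ.hypergeometricSystem hX ?_
  rw [hX] at E1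
  linear_combination E1

/-- Φ is B composed with the local inverse of (x, y). Regularity is an open condition, so the
pointwise theorem applies at the preimage of every nearby (x, y). -/
theorem Uniformizes.satisfiesSystemAt (U : Uniformizes κ t g) {a : ℂ} (ha : a * (1 - a) = κ)
    (h₁ : 0 < τ₁.im) (h₂ : 0 < τ₂.im) (h : IsRegularPoint t τ₁ τ₂) {B : ℂ → ℂ → ℂ}
    (hB : An B τ₁ τ₂) (hBg : ∀ᶠ p : ℂ × ℂ in 𝓝 (τ₁, τ₂), B p.1 p.2 ^ 2 = g p.1 * g p.2) :
    SatisfiesSystemAt a (xFun t) (yFun t) B τ₁ τ₂ := by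
  have hr := U.regular h₁ h₂ h
  have hX := U.an_xFun h₁ h₂ h.1 h.2.1
  have hY := U.an_yFun h₁ h₂ h.2.2.1
  obtain ⟨σ, hσ, hσ0, hl, hrt⟩ := exists_localInverse hX hY h.2.2.2
  have hB' : AnalyticAt ℂ (fun p : ℂ × ℂ => B p.1 p.2) (σ (xFun t τ₁ τ₂, yFun t τ₁ τ₂)) := by
    rw [hσ0]; exact hB
  set Φ : ℂ → ℂ → ℂ := fun x y => B (σ (x, y)).1 (σ (x, y)).2
  have hΦ : An Φ (xFun t τ₁ τ₂) (yFun t τ₁ τ₂) :=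
    AnalyticAt.fun_comp (g := fun p : ℂ × ℂ => B p.1 p.2) (f := σ) hB' hσ
  have hBΦ : ∀ᶠ p : ℂ × ℂ in 𝓝 (τ₁, τ₂), B p.1 p.2 = Φ (xFun t p.1 p.2) (yFun t p.1 p.2) := by
    filter_upwards [hl] with p hp
    simp only [Φ, hp]
  refine ⟨Φ, hΦ, hBΦ, ?_⟩
  have hc : Tendsto σ (𝓝 (xFun t τ₁ τ₂, yFun t τ₁ τ₂)) (𝓝 (τ₁, τ₂)) :=
    hσ0 ▸ hσ.continuousAt.tendsto
  filter_upwards [hrt, hc.eventually (U.eventually_regular hr), hc.eventually hB.eventually,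
    hc.eventually (eventually_eventually_nhds.2 hBg),
    hc.eventually (eventually_eventually_nhds.2 hBΦ), hΦ.eventually] with q q1 q2 q3 q4 q5 q6
  have e1 : xFun t (σ q).1 (σ q).2 = q.1 := congrArg Prod.fst q1
  have e2 : yFun t (σ q).1 (σ q).2 = q.2 := congrArg Prod.snd q1
  rw [← e1, ← e2] at q6 ⊢
  exact U.hypergeometricSystem ha q2 q3 q4 q6 q5

lemma Uniformizes.exists_root (U : Uniformizes κ t g) (h₁ : 0 < τ₁.im) (h₂ : 0 < τ₂.im)
    (g1 : g τ₁ ≠ 0) (g2 : g τ₂ ≠ 0) : ∃ B : ℂ → ℂ → ℂ, An B τ₁ τ₂ ∧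
      ∀ p₁ p₂ : ℂ, B p₁ p₂ ^ 2 = g p₁ * g p₂ := by
  have h0 : g τ₁ * g τ₂ ≠ 0 := mul_ne_zero g1 g2
  have a1 : An (fun s _ => g s) τ₁ τ₂ := An.comp_fst (U.analyticAt_g h₁)
  have a2 : An (fun _ s => g s) τ₁ τ₂ := An.comp_snd (U.analyticAt_g h₂)
  have hsq : ∀ z : ℂ, (z ^ (1 / 2 : ℂ)) ^ 2 = z := by
    intro z
    rw [← Complex.cpow_nat_mul]
    norm_num
  -- Dividing by the value at the base point makes the radicand 1 there, away from the branch cut.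
  refine ⟨fun p₁ p₂ => (g τ₁ * g τ₂) ^ (1 / 2 : ℂ) *
    (g p₁ * g p₂ / (g τ₁ * g τ₂)) ^ (1 / 2 : ℂ), ?_, fun p₁ p₂ => ?_⟩
  · refine AnalyticAt.mul analyticAt_const (AnalyticAt.cpow ?_ analyticAt_const ?_)
    · exact (AnalyticAt.mul a1 a2).div analyticAt_const h0
    · simp only [div_self h0]
      exact Complex.one_mem_slitPlane
  · rw [mul_pow, hsq, hsq, mul_div_cancel₀ _ h0]

end

/-! ### The three cases -/

lemma system_of_sq {κ a : ℂ} {t f : ℂ → ℂ} (U : Uniformizes κ t fun τ => f τ ^ 2)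
    (ha : a * (1 - a) = κ) (hf : ∀ τ : ℂ, 0 < τ.im → AnalyticAt ℂ f τ) (τ₁ τ₂ : ℍ)
    (h : IsRegularPoint t τ₁ τ₂) : SatisfiesSystemAt a (xFun t) (yFun t) (FFun f) τ₁ τ₂ :=
  U.satisfiesSystemAt ha τ₁.im_pos τ₂.im_pos h
    (AnalyticAt.mul (An.comp_fst (hf _ τ₁.im_pos)) (An.comp_snd (hf _ τ₂.im_pos)))
    (Eventually.of_forall fun p => by simp only [FFun]; ring)

theorem system_half (τ₁ τ₂ : ℍ) (h : IsRegularPoint tHalf τ₁ τ₂) :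
    SatisfiesSystemAt (1 / 2) (xFun tHalf) (yFun tHalf) (FFun fHalf) τ₁ τ₂ :=
  system_of_sq uniformizes_half rfl (fun _ hτ => onDisc_fHalf.analyticAt_comp hτ) τ₁ τ₂ h

theorem system_third (τ₁ τ₂ : ℍ) (h : IsRegularPoint tThird τ₁ τ₂) :
    SatisfiesSystemAt (1 / 3) (xFun tThird) (yFun tThird) (FFun fThird) τ₁ τ₂ :=
  system_of_sq uniformizes_third rfl (fun _ hτ => onDisc_fThird.analyticAt_comp hτ) τ₁ τ₂ h

lemma fQuarter_sq (τ : ℂ) : fQuarter τ ^ 2 = gQuarter τ := by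
  rw [fQuarter, ← Complex.cpow_nat_mul]
  norm_num [gQuarter]

theorem system_quarter (τ₁ τ₂ : ℍ) (h : IsRegularPoint tQuarter τ₁ τ₂) :
    (∃ B, IsBranchAt (FFun fQuarter) B τ₁ τ₂) ∧
      ∀ B, IsBranchAt (FFun fQuarter) B τ₁ τ₂ →
        SatisfiesSystemAt (1 / 4) (xFun tQuarter) (yFun tQuarter) B τ₁ τ₂ := by
  have U := uniformizes_quarter
  have hr := U.regular τ₁.im_pos τ₂.im_pos h
  have hF : ∀ p₁ p₂ : ℂ, FFun fQuarter p₁ p₂ ^ 2 = gQuarter p₁ * gQuarter p₂ := fun p₁ p₂ => by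
    rw [FFun, mul_pow, fQuarter_sq, fQuarter_sq]
  refine ⟨?_, fun B hB => U.satisfiesSystemAt rfl τ₁.im_pos τ₂.im_pos h hB.1
    (hB.2.mono fun p hp => hp.trans (hF _ _))⟩
  obtain ⟨B, hB, hB2⟩ := U.exists_root τ₁.im_pos τ₂.im_pos hr.g_fst hr.g_snd
  exact ⟨B, hB, Eventually.of_forall fun p => (hB2 _ _).trans (hF _ _).symm⟩

/-! ### Automorphy factors -/

/-- The factor `c τ + d`. -/
def aut (g : SL(2, ℝ)) (τ : ℂ) : ℂ := (g 1 0 : ℂ) * τ + (g 1 1 : ℂ)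

lemma aut_ne_zero (g : SL(2, ℝ)) (τ : ℍ) : aut g τ ≠ 0 :=
  denom_ne_zero (g : GL (Fin 2) ℝ) τ

lemma coe_smul_real (g : SL(2, ℝ)) (τ : ℍ) :
    ((g • τ : ℍ) : ℂ) = ((g 0 0 : ℂ) * τ + (g 0 1 : ℂ)) / aut g τ := by
  rw [coe_specialLinearGroup_apply]
  rfl

lemma coe_smul_int (g : SL(2, ℤ)) (τ : ℍ) :
    ((g • τ : ℍ) : ℂ) = ((g 0 0 : ℂ) * τ + (g 0 1 : ℂ)) / ((g 1 0 : ℂ) * τ + (g 1 1 : ℂ)) := by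
  rw [coe_specialLinearGroup_apply]
  simp

lemma toReal_apply (γ : SL(2, ℤ)) (i j : Fin 2) : toReal γ i j = (γ i j : ℝ) := rfl

lemma aut_toReal (γ : SL(2, ℤ)) (τ : ℂ) :
    aut (toReal γ) τ = (γ 1 0 : ℂ) * τ + (γ 1 1 : ℂ) := by
  simp [aut, toReal_apply]

lemma toReal_smul (γ : SL(2, ℤ)) (τ : ℍ) : toReal γ • τ = γ • τ := by
  apply UpperHalfPlane.ext
  rw [coe_smul_real, coe_smul_int, aut_toReal]
  simp [toReal_apply]

lemma aut_mul (g h : SL(2, ℝ)) (τ : ℍ) :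
    aut (g * h) τ = aut g ((h • τ : ℍ) : ℂ) * aut h τ := by
  have := aut_ne_zero h τ
  rw [coe_smul_real, aut, aut, add_mul, mul_assoc, div_mul_cancel₀ _ this]
  simp only [Matrix.SpecialLinearGroup.coe_mul, Matrix.mul_apply, Fin.sum_univ_two, aut]
  push_cast
  ring

lemma toReal_injective : Function.Injective toReal := by
  intro γ δ h
  ext i j
  have : toReal γ i j = toReal δ i j := by rw [h]
  rw [toReal_apply, toReal_apply] at this
  exact_mod_cast this

/-- `f` is multiplied by `s (c τ + d) ^ k` under `g`. -/
def HasFactor (f : ℂ → ℂ) (k : ℤ) (g : SL(2, ℝ)) (s : ℂ) : Prop :=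
  ∀ τ : ℍ, f ↑(g • τ) = s * aut g τ ^ k * f τ

section
variable {f : ℂ → ℂ} {k : ℤ} {g h : SL(2, ℝ)} {s s' : ℂ}

lemma HasFactor.mul (hg : HasFactor f k g s) (hh : HasFactor f k h s') :
    HasFactor f k (g * h) (s * s') := by
  intro τ
  rw [mul_smul, hg, hh, aut_mul, mul_zpow]
  ring

lemma HasFactor.one : HasFactor f k 1 1 := by
  intro τ
  simp [aut]

lemma HasFactor.inv (hg : HasFactor f k g s) (hs : s ≠ 0) : HasFactor f k g⁻¹ s⁻¹ := by
  intro τ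
  have h1 := hg (g⁻¹ • τ)
  have h2 := aut_mul g g⁻¹ τ
  rw [smul_inv_smul] at h1
  rw [mul_inv_cancel] at h2
  have h3 : aut 1 τ = 1 := by simp [aut]
  rw [h3] at h2
  have h4 : (aut g ↑(g⁻¹ • τ)) ^ k * (aut g⁻¹ τ) ^ k = 1 := by rw [← mul_zpow, ← h2, one_zpow]
  rw [h1]
  field_simp
  linear_combination (-f ↑(g⁻¹ • τ)) * h4

end

/-! ### Generators of `Γ₀(N)` for `N ≤ 4` -/

/-- The matrix `(1 0; n 1)`. -/
def lowerMat (n : ℤ) : SL(2, ℤ) := ⟨!![1, 0; n, 1], by simp [Matrix.det_fin_two]⟩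

lemma coe_lowerMat (n : ℤ) : (lowerMat n : Matrix (Fin 2) (Fin 2) ℤ) = !![1, 0; n, 1] := rfl

lemma exists_two_mul_abs_le (a : ℤ) {c : ℤ} (hc : c ≠ 0) : ∃ k : ℤ, 2 * |a + k * c| ≤ |c| := by
  have h1 := Int.emod_add_mul_ediv a c
  have h2 := Int.emod_nonneg a hc
  have h3 := Int.emod_lt_abs a hc
  rcases le_or_gt (2 * (a % c)) |c| with h | h
  · refine ⟨-(a / c), ?_⟩
    rw [show a + -(a / c) * c = a % c by linear_combination -h1, abs_of_nonneg h2]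
    exact h
  · refine ⟨-(a / c) - SignType.sign c, ?_⟩
    have h4 : ((SignType.sign c : ℤ)) * c = |c| := by rw [mul_comm, mul_comm]; exact sign_mul_self c
    rw [show a + (-(a / c) - SignType.sign c) * c = a % c - |c| by linear_combination -h1 - h4,
      abs_of_neg (by linarith)]
    linarith

lemma mem_Gamma0_iff {N : ℕ} {γ : SL(2, ℤ)} : γ ∈ Gamma0 N ↔ (N : ℤ) ∣ γ 1 0 := by
  rw [Gamma0_mem, ZMod.intCast_zmod_eq_zero_iff_dvd]

lemma det_eq (γ : SL(2, ℤ)) : γ 0 0 * γ 1 1 - γ 0 1 * γ 1 0 = 1 := by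
  have := γ.det_coe
  rwa [Matrix.det_fin_two] at this

lemma T_zpow_mul_apply (k : ℤ) (γ : SL(2, ℤ)) :
    (ModularGroup.T ^ k * γ) 0 0 = γ 0 0 + k * γ 1 0 ∧ (ModularGroup.T ^ k * γ) 1 0 = γ 1 0 := by
  constructor <;>
  simp [ModularGroup.coe_T_zpow, Matrix.mul_apply, Fin.sum_univ_two]

lemma lowerMat_mul_apply (n : ℤ) (γ : SL(2, ℤ)) :
    (lowerMat n * γ) 0 0 = γ 0 0 ∧ (lowerMat n * γ) 1 0 = γ 1 0 + n * γ 0 0 := by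
  constructor <;>
  simp [coe_lowerMat, Matrix.mul_apply, Fin.sum_univ_two, add_comm]

/-- Euclidean descent on |c|, for first column (a, c). A translation achieves 2|a| ≤ |c|; then a
lower triangular matrix reduces c modulo Na to size at most N|a|/2 ≤ N|c|/4. This is less than |c|
unless N = 4 and 2|a| = |c|; in that case a divides c, so a = ±1 and c = ±2, contrary to 4 ∣ c. -/
theorem Gamma0_le {N : ℕ} (hN2 : 2 ≤ N) (hN4 : N ≤ 4) {K : Subgroup SL(2, ℤ)}
    (hT : ∀ k : ℤ, ModularGroup.T ^ k ∈ K) (hV : ∀ k : ℤ, lowerMat (N * k) ∈ K) (hneg : -1 ∈ K) :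
    Gamma0 N ≤ K := by
  have key : ∀ (n : ℕ) (γ : SL(2, ℤ)), (N : ℤ) ∣ γ 1 0 → (γ 1 0).natAbs = n → γ ∈ K := by
    intro n
    induction n using Nat.strong_induction_on with
    | _ n ih =>
    intro γ hγ hn
    by_cases hc : γ 1 0 = 0
    · have hd := det_eq γ
      rw [hc, mul_zero, sub_zero] at hd
      rcases Int.mul_eq_one_iff_eq_one_or_neg_one.1 hd with ⟨h1, h2⟩ | ⟨h1, h2⟩
      · have : γ = ModularGroup.T ^ (γ 0 1) := by
          ext i j
          fin_cases i <;> fin_cases j <;> simp [ModularGroup.coe_T_zpow, h1, h2, hc]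
        rw [this]; exact hT _
      · have : γ = -1 * ModularGroup.T ^ (-(γ 0 1)) := by
          ext i j
          fin_cases i <;> fin_cases j <;> simp [ModularGroup.coe_T_zpow, h1, h2, hc]
        rw [this]; exact K.mul_mem hneg (hT _)
    · obtain ⟨k, hk⟩ := exists_two_mul_abs_le (γ 0 0) hc
      obtain ⟨e1, e2⟩ := T_zpow_mul_apply k γ
      have hdet := det_eq (ModularGroup.T ^ k * γ)
      rw [← e1] at hk
      set δ := ModularGroup.T ^ k * γ
      have hδ : δ ∈ K → γ ∈ K := fun h => by
        have := K.mul_mem (K.inv_mem (hT k)) h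
        rwa [inv_mul_cancel_left] at this
      rw [← e2] at hγ hn hc hk
      obtain ⟨m, hm⟩ := hγ
      have ha : δ 0 0 ≠ 0 := by
        intro h
        rw [h, zero_mul, zero_sub, hm] at hdet
        have : (N : ℤ) ∣ 1 := ⟨-(δ 0 1 * m), by linear_combination -hdet⟩
        have := Int.le_of_dvd one_pos this
        omega
      have hNa : (N : ℤ) * δ 0 0 ≠ 0 := mul_ne_zero (by omega) ha
      obtain ⟨l, hl⟩ := exists_two_mul_abs_le (δ 1 0) hNa
      obtain ⟨e3, e4⟩ := lowerMat_mul_apply (N * l) δ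
      have hlt : ((lowerMat (N * l) * δ) 1 0).natAbs < n := by
        rw [← hn, e4]
        zify
        rw [show δ 1 0 + N * l * δ 0 0 = δ 1 0 + l * (N * δ 0 0) by ring]
        rw [abs_mul, abs_of_nonneg (by omega : (0 : ℤ) ≤ N)] at hl
        have hpos : 0 < |δ 1 0| := abs_pos.2 hc
        have hapos : 0 < |δ 0 0| := abs_pos.2 ha
        have hcases : 2 * |δ 0 0| < |δ 1 0| ∨ N < 4 := by
          by_contra! hcon
          have hN : N = 4 := by omega
          have heq : 2 * |δ 0 0| = |δ 1 0| := le_antisymm hk hcon.1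
          subst hN
          have hdvd : δ 0 0 ∣ δ 1 0 := (abs_dvd_abs _ _).1 ⟨2, by linarith⟩
          have h1 : δ 0 0 ∣ 1 := by
            have := dvd_sub (Dvd.intro (δ 1 1) rfl) (hdvd.mul_left (δ 0 1))
            rwa [hdet] at this
          have h2 : |δ 0 0| = 1 := by
            have := Int.isUnit_iff_abs_eq.1 (isUnit_of_dvd_one h1)
            exact this
          have h3 : |δ 1 0| = 2 := by omega
          have h4 : (4 : ℤ) ∣ |δ 1 0| := (dvd_abs _ _).2 ⟨m, by exact_mod_cast hm⟩
          rw [h3] at h4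
          norm_num at h4
        have hN4' : (N : ℤ) ≤ 4 := by exact_mod_cast hN4
        rcases hcases with h | h
        · nlinarith
        · have : (N : ℤ) ≤ 3 := by omega
          nlinarith
      refine hδ ?_
      have := ih _ hlt (lowerMat (N * l) * δ) (by
        rw [e4, hm]; exact ⟨m + l * δ 0 0, by ring⟩) rfl
      have := K.mul_mem (K.inv_mem (hV l)) this
      rwa [inv_mul_cancel_left] at this
  intro γ hγ
  exact key _ γ (mem_Gamma0_iff.1 hγ) rfl

/-! ### Adjoining an involution -/

/-- `w` normalizes `Γ` and its square lies in `Γ`. -/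
structure IsInvolutive {G : Type*} [Group G] (Γ : Subgroup G) (w : G) : Prop where
  conj : ∀ γ ∈ Γ, w * γ * w⁻¹ ∈ Γ
  sq : w * w ∈ Γ

namespace IsInvolutive
variable {G : Type*} [Group G] {Γ : Subgroup G} {w : G}

lemma conj_inv (h : IsInvolutive Γ w) {γ : G} (hγ : γ ∈ Γ) : w⁻¹ * γ * w ∈ Γ := by
  have := Γ.mul_mem (Γ.mul_mem (Γ.inv_mem h.sq) (h.conj γ hγ)) h.sq
  convert this using 1
  group

lemma le_normalizer (h : IsInvolutive Γ w) :
    Γ ⊔ Subgroup.zpowers w ≤ Subgroup.normalizer (Γ : Set G) := by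
  refine sup_le Subgroup.le_normalizer ?_
  rw [Subgroup.zpowers_le, Subgroup.mem_normalizer_iff]
  refine fun γ => ⟨h.conj γ, fun hγ => ?_⟩
  have := h.conj_inv hγ
  convert this using 1
  group

/-- Γ ∪ Γw is already a group, because w normalizes Γ and w² lies in Γ. -/
lemma mem_sup_iff (h : IsInvolutive Γ w) {g : G} (hg : g ∈ Γ ⊔ Subgroup.zpowers w) :
    g ∈ Γ ∨ g * w⁻¹ ∈ Γ := by
  let H : Subgroup G :=
    { carrier := {g | g ∈ Γ ∨ g * w⁻¹ ∈ Γ}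
      one_mem' := Or.inl Γ.one_mem
      mul_mem' := by
        rintro a b (ha | ha) (hb | hb)
        · exact Or.inl (Γ.mul_mem ha hb)
        · refine Or.inr ?_
          rw [mul_assoc]
          exact Γ.mul_mem ha hb
        · refine Or.inr ?_
          convert Γ.mul_mem ha (h.conj b hb) using 1
          group
        · refine Or.inl ?_
          convert Γ.mul_mem (Γ.mul_mem ha (h.conj _ hb)) h.sq using 1
          group
      inv_mem' := by
        rintro a (ha | ha)
        · exact Or.inl (Γ.inv_mem ha)
        · refine Or.inr ?_
          convert Γ.mul_mem (h.conj_inv (Γ.inv_mem ha)) (Γ.inv_mem h.sq) using 1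
          group }
  have : Γ ⊔ Subgroup.zpowers w ≤ H := by
    refine sup_le (fun γ hγ => Or.inl hγ) ?_
    rw [Subgroup.zpowers_le]
    exact Or.inr (by rw [mul_inv_cancel]; exact Γ.one_mem)
  exact this hg

open Classical in
/-- The character of the extended group that is trivial precisely on `Γ`. -/
def sign (h : IsInvolutive Γ w) (hw : w ∉ Γ) : ↥(Γ ⊔ Subgroup.zpowers w) →* ℂˣ where
  toFun g := if (g : G) ∈ Γ then 1 else -1
  map_one' := by simp
  map_mul' a b := by
    have hne : ∀ g : G, g * w⁻¹ ∈ Γ → g ∉ Γ := fun g h1 h2 => hw (by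
      have := Γ.mul_mem (Γ.inv_mem h1) h2
      convert this using 1
      group)
    by_cases ha : (a : G) ∈ Γ <;> by_cases hb : (b : G) ∈ Γ
    · simp [ha, hb, Γ.mul_mem ha hb]
    · have : (a : G) * b ∉ Γ := fun hab => hb ((Γ.mul_mem_cancel_left ha).1 hab)
      simp [ha, hb, this]
    · have : (a : G) * b ∉ Γ := fun hab => ha ((Γ.mul_mem_cancel_right hb).1 hab)
      simp [ha, hb, this]
    · have h1 := (h.mem_sup_iff a.2).resolve_left ha
      have h2 := (h.mem_sup_iff b.2).resolve_left hb
      have : (a : G) * b ∈ Γ := by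
        convert Γ.mul_mem (Γ.mul_mem h1 (h.conj _ h2)) h.sq using 1
        group
      simp [ha, hb, this]

lemma sign_of_mem (h : IsInvolutive Γ w) (hw : w ∉ Γ) (g : ↥(Γ ⊔ Subgroup.zpowers w))
    (hg : (g : G) ∈ Γ) : h.sign hw g = 1 := if_pos hg

lemma sign_of_not_mem (h : IsInvolutive Γ w) (hw : w ∉ Γ) (g : ↥(Γ ⊔ Subgroup.zpowers w))
    (hg : (g : G) ∉ Γ) : h.sign hw g = -1 := if_neg hg

end IsInvolutive

/-! ### Functions with a factor on `Γ₀(N)` -/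

section
variable {N : ℕ} {f : ℂ → ℂ} {k : ℤ}

/-- By the cocycle property `aut_mul`, the matrices for which the law holds form a subgroup, so
generators suffice. -/
theorem hasFactor_Gamma0 (hN2 : 2 ≤ N) (hN4 : N ≤ 4) (χ : Gamma0 N →* ℂˣ)
    (hT : ∀ (n : ℤ) (h : ModularGroup.T ^ n ∈ Gamma0 N),
      HasFactor f k (toReal (ModularGroup.T ^ n)) (χ ⟨_, h⟩))
    (hV : ∀ (n : ℤ) (h : lowerMat (N * n) ∈ Gamma0 N),
      HasFactor f k (toReal (lowerMat (N * n))) (χ ⟨_, h⟩))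
    (hneg : ∀ h : -1 ∈ Gamma0 N, HasFactor f k (toReal (-1)) (χ ⟨-1, h⟩)) (γ : Gamma0 N) :
    HasFactor f k (toReal γ) (χ γ) := by
  let K : Subgroup SL(2, ℤ) :=
    { carrier := {γ | ∃ h : γ ∈ Gamma0 N, HasFactor f k (toReal γ) (χ ⟨γ, h⟩)}
      one_mem' := ⟨(Gamma0 N).one_mem, by
        have : χ ⟨1, (Gamma0 N).one_mem⟩ = 1 := χ.map_one
        rw [this, map_one]
        exact HasFactor.one⟩
      mul_mem' := by
        rintro a b ⟨ha, ha'⟩ ⟨hb, hb'⟩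
        refine ⟨(Gamma0 N).mul_mem ha hb, ?_⟩
        have : χ ⟨a * b, (Gamma0 N).mul_mem ha hb⟩ = χ ⟨a, ha⟩ * χ ⟨b, hb⟩ :=
          χ.map_mul ⟨a, ha⟩ ⟨b, hb⟩
        rw [this, map_mul, Units.val_mul]
        exact ha'.mul hb'
      inv_mem' := by
        rintro a ⟨ha, ha'⟩
        refine ⟨(Gamma0 N).inv_mem ha, ?_⟩
        have : χ ⟨a⁻¹, (Gamma0 N).inv_mem ha⟩ = (χ ⟨a, ha⟩)⁻¹ := χ.map_inv ⟨a, ha⟩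
        rw [this, map_inv, Units.val_inv_eq_inv_val]
        exact ha'.inv (Units.ne_zero _) }
  have hK : Gamma0 N ≤ K := by
    refine Gamma0_le hN2 hN4 (fun n => ?_) (fun n => ?_) ?_
    · have h : ModularGroup.T ^ n ∈ Gamma0 N := by
        rw [mem_Gamma0_iff, ModularGroup.coe_T_zpow]; simp
      exact ⟨h, hT n h⟩
    · have h : lowerMat (N * n) ∈ Gamma0 N := by
        rw [mem_Gamma0_iff, coe_lowerMat]; simp
      exact ⟨h, hV n h⟩
    · have h : -1 ∈ Gamma0 N := by
        rw [mem_Gamma0_iff]; simp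
      exact ⟨h, hneg h⟩
  obtain ⟨_, h⟩ := hK γ.2
  exact h

/-! ### Cusps -/

/-- `f` is bounded at the cusp `γ ∞`. -/
def BoundedAtCusp (f : ℂ → ℂ) (k : ℤ) (γ : SL(2, ℤ)) : Prop :=
  IsBoundedAtImInfty fun τ : ℍ => f ↑(γ • τ) * aut (toReal γ) τ ^ (-k)

lemma BoundedAtCusp.mul_left {γ δ : SL(2, ℤ)} {s : ℂ} (hδ : HasFactor f k (toReal δ) s)
    (h : BoundedAtCusp f k γ) : BoundedAtCusp f k (δ * γ) := by
  obtain ⟨M, A, hM⟩ := isBoundedAtImInfty_iff.1 h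
  refine isBoundedAtImInfty_iff.2 ⟨‖s‖ * M, A, fun τ hτ => ?_⟩
  have h1 := hδ (γ • τ)
  rw [toReal_smul] at h1
  have h2 := aut_mul (toReal δ) (toReal γ) τ
  rw [toReal_smul] at h2
  have h3 : aut (toReal δ) ↑(γ • τ) ^ k ≠ 0 := zpow_ne_zero k (aut_ne_zero _ _)
  rw [mul_smul, h1, map_mul, h2, mul_zpow, zpow_neg, zpow_neg]
  have h4 := hM τ hτ
  rw [zpow_neg] at h4
  rw [show s * aut (toReal δ) ↑(γ • τ) ^ k * f ↑(γ • τ) *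
    ((aut (toReal δ) ↑(γ • τ) ^ k)⁻¹ * (aut (toReal γ) τ ^ k)⁻¹) =
    s * (f ↑(γ • τ) * (aut (toReal γ) τ ^ k)⁻¹) by field_simp, norm_mul]
  gcongr

lemma BoundedAtCusp.mul_T_zpow {γ : SL(2, ℤ)} (h : BoundedAtCusp f k γ) (n : ℤ) :
    BoundedAtCusp f k (γ * ModularGroup.T ^ n) := by
  obtain ⟨M, A, hM⟩ := isBoundedAtImInfty_iff.1 h
  refine isBoundedAtImInfty_iff.2 ⟨M, A, fun τ hτ => ?_⟩
  have h1 := hM (ModularGroup.T ^ n • τ) (by rw [modular_T_zpow_smul]; simpa using hτ)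
  have h2 := aut_mul (toReal γ) (toReal (ModularGroup.T ^ n)) τ
  rw [toReal_smul] at h2
  have h3 : aut (toReal (ModularGroup.T ^ n)) τ = 1 := by
    rw [aut_toReal, ModularGroup.coe_T_zpow]; simp
  rw [h3, mul_one] at h2
  rw [mul_smul, map_mul, h2]
  exact h1

/-- The cusps ∞, 0 and, for N = 4, also 1/2 represent all classes: γ differs from 1, S Tᵏ or
`lowerMat 2` by a left factor in Γ₀(N). -/
theorem boundedAtCusp (hN : N = 2 ∨ N = 3 ∨ N = 4) (χ : Gamma0 N →* ℂˣ)
    (hf : ∀ γ : Gamma0 N, HasFactor f k (toReal γ) (χ γ)) (h1 : BoundedAtCusp f k 1)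
    (hS : BoundedAtCusp f k ModularGroup.S) (h4 : N = 4 → BoundedAtCusp f k (lowerMat 2))
    (γ : SL(2, ℤ)) : BoundedAtCusp f k γ := by
  have key : ∀ ρ : SL(2, ℤ), BoundedAtCusp f k ρ → (N : ℤ) ∣ (γ * ρ⁻¹) 1 0 →
      BoundedAtCusp f k γ := by
    intro ρ hρ hd
    have := BoundedAtCusp.mul_left (hf ⟨γ * ρ⁻¹, mem_Gamma0_iff.2 hd⟩) hρ
    simpa using this
  have hdet := det_eq γ
  -- With exponent k = cd the lower left entry is (c² - 1)d, divisible by N as soon as c² ≡ 1 mod N.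
  have e1 : (γ * (ModularGroup.S * ModularGroup.T ^ (γ 1 0 * γ 1 1))⁻¹) 1 0 =
      γ 1 0 * (γ 1 0 * γ 1 1) - γ 1 1 := by
    simp [Matrix.SpecialLinearGroup.coe_inv, Matrix.adjugate_fin_two, Matrix.mul_apply,
      Fin.sum_univ_two, ModularGroup.coe_T_zpow, ModularGroup.coe_S]
    ring
  have e2 : (γ * (lowerMat 2)⁻¹) 1 0 = γ 1 0 - 2 * γ 1 1 := by
    simp [Matrix.SpecialLinearGroup.coe_inv, Matrix.adjugate_fin_two, Matrix.mul_apply,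
      Fin.sum_univ_two, coe_lowerMat]
    ring
  have hodd : (N : ℤ) ∣ γ 1 0 ^ 2 - 1 → BoundedAtCusp f k γ := fun h => by
    refine key _ (hS.mul_T_zpow (γ 1 0 * γ 1 1)) ?_
    rw [e1, show γ 1 0 * (γ 1 0 * γ 1 1) - γ 1 1 = (γ 1 0 ^ 2 - 1) * γ 1 1 by ring]
    exact h.mul_right _
  by_cases h0 : (N : ℤ) ∣ γ 1 0
  · exact key 1 h1 (by simpa using h0)
  rcases hN with rfl | rfl | rfl
  · refine hodd ?_
    obtain ⟨m, hm⟩ : ∃ m, γ 1 0 = 2 * m + 1 := ⟨γ 1 0 / 2, by push_cast at h0; omega⟩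
    exact ⟨2 * m ^ 2 + 2 * m, by rw [hm]; push_cast; ring⟩
  · refine hodd ?_
    obtain ⟨m, hm⟩ : ∃ m, γ 1 0 = 3 * m + 1 ∨ γ 1 0 = 3 * m + 2 :=
      ⟨γ 1 0 / 3, by push_cast at h0; omega⟩
    rcases hm with hm | hm
    · exact ⟨3 * m ^ 2 + 2 * m, by rw [hm]; push_cast; ring⟩
    · exact ⟨3 * m ^ 2 + 4 * m + 1, by rw [hm]; push_cast; ring⟩
  · rcases Int.even_or_odd' (γ 1 0) with ⟨m, hm | hm⟩
    · refine key _ (h4 rfl) ?_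
      have hd : Odd (γ 1 1) := by
        by_contra hd
        rw [Int.not_odd_iff_even] at hd
        obtain ⟨l, hl⟩ := hd
        rw [hm, hl] at hdet
        have : (2 : ℤ) ∣ 1 := ⟨γ 0 0 * l - γ 0 1 * m, by linear_combination -hdet⟩
        norm_num at this
      obtain ⟨l, hl⟩ := hd
      have hm' : Odd m := by
        by_contra hm'
        rw [Int.not_odd_iff_even] at hm'
        obtain ⟨r, hr⟩ := hm'
        exact h0 ⟨r, by rw [hm, hr]; push_cast; ring⟩
      obtain ⟨r, hr⟩ := hm'
      rw [e2]
      exact ⟨r - l, by rw [hm, hr, hl]; push_cast; ring⟩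
    · refine hodd ⟨m ^ 2 + m, by rw [hm]; push_cast; ring⟩

/-! ### Bimodular forms -/

lemma isBimodularPair_of_isInvolutive [NeZero N] {w : SL(2, ℝ)}
    (h : IsInvolutive ((Gamma0 N).map toReal) w) :
    IsBimodularPair (Gamma0 N) (adjoin (Gamma0 N) w) :=
  ⟨Gamma0_is_congruence N, le_sup_left, h.le_normalizer⟩

/-- On the diagonal a one-variable factor s appears squared. Each element of G is γ or γw, with s =
χ₁(γ) or χ₁(γ)ω, and in both cases s² is the value of χ₂. -/
theorem isBimodularForm_of_hasFactor [NeZero N] {w : SL(2, ℝ)}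
    (h : IsInvolutive ((Gamma0 N).map toReal) w) {χ₁ : Gamma0 N →* ℂˣ}
    {χ₂ : adjoin (Gamma0 N) w →* ℂˣ} {ω : ℂ}
    (hχ : ∀ (γ : Gamma0 N) (h : toReal γ ∈ adjoin (Gamma0 N) w), χ₂ ⟨toReal γ, h⟩ = χ₁ γ ^ 2)
    (hω : (χ₂ ⟨w, mem_adjoin _ _⟩ : ℂ) = ω ^ 2) (hol : Hol f)
    (hf : ∀ γ : Gamma0 N, HasFactor f k (toReal γ) (χ₁ γ)) (hw : HasFactor f k w ω)
    (hb : ∀ γ : SL(2, ℤ), BoundedAtCusp f k γ) :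
    IsBimodularForm k (Gamma0 N) (adjoin (Gamma0 N) w) χ₁ χ₂ (FFun f) where
  pair := isBimodularPair_of_isInvolutive h
  compat := hχ
  holomorphic := by
    rintro ⟨τ₁, τ₂⟩ ⟨h₁, h₂⟩
    have d1 : DifferentiableAt ℂ (fun p : ℂ × ℂ => f p.1) (τ₁, τ₂) :=
      DifferentiableAt.fun_comp' (τ₁, τ₂) (g := f) (hol τ₁ h₁) differentiableAt_fst
    have d2 : DifferentiableAt ℂ (fun p : ℂ × ℂ => f p.2) (τ₁, τ₂) :=
      DifferentiableAt.fun_comp' (τ₁, τ₂) (g := f) (hol τ₂ h₂) differentiableAt_snd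
    exact (d1.mul d2).differentiableWithinAt
  left γ τ₁ τ₂ := by
    have := hf γ τ₁
    rw [toReal_smul, aut_toReal] at this
    rw [FFun, FFun, this]
    ring
  right γ τ₁ τ₂ := by
    have := hf γ τ₂
    rw [toReal_smul, aut_toReal] at this
    rw [FFun, FFun, this]
    ring
  diag g τ₁ τ₂ := by
    have key : ∃ s : ℂ, (χ₂ g : ℂ) = s ^ 2 ∧ HasFactor f k g s := by
      rcases h.mem_sup_iff g.2 with ⟨γ, hγ, hg⟩ | ⟨γ, hγ, hg⟩
      · have hm : toReal γ ∈ adjoin (Gamma0 N) w := by rw [hg]; exact g.2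
        have e : g = ⟨toReal (⟨γ, hγ⟩ : Gamma0 N), hm⟩ := Subtype.ext hg.symm
        refine ⟨χ₁ ⟨γ, hγ⟩, ?_, hg ▸ hf ⟨γ, hγ⟩⟩
        rw [e, hχ ⟨γ, hγ⟩ hm]
        simp
      · have hm : toReal γ ∈ adjoin (Gamma0 N) w :=
          (le_sup_left : _ ≤ adjoin (Gamma0 N) w) ⟨γ, hγ, rfl⟩
        have hg' : (g : SL(2, ℝ)) = toReal γ * w := by rw [hg]; group
        have e : g = ⟨toReal (⟨γ, hγ⟩ : Gamma0 N), hm⟩ * ⟨w, mem_adjoin _ _⟩ := Subtype.ext hg'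
        refine ⟨χ₁ ⟨γ, hγ⟩ * ω, ?_, hg' ▸ (hf ⟨γ, hγ⟩).mul hw⟩
        rw [e, map_mul, hχ ⟨γ, hγ⟩ hm, Units.val_mul, hω, mul_pow]
        simp
    obtain ⟨s, hs, hg⟩ := key
    rw [FFun, FFun, hg τ₁, hg τ₂, hs, aut, aut]
    ring
  cusps_left γ τ₂ := by
    obtain ⟨M, A, hM⟩ := isBoundedAtImInfty_iff.1 (hb γ)
    refine isBoundedAtImInfty_iff.2 ⟨M * ‖f τ₂‖, A, fun τ hτ => ?_⟩
    rw [ModularForm.SL_slash_apply, FFun, mul_right_comm, norm_mul]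
    exact mul_le_mul_of_nonneg_right (hM τ hτ) (norm_nonneg _)
  cusps_right γ τ₁ := by
    obtain ⟨M, A, hM⟩ := isBoundedAtImInfty_iff.1 (hb γ)
    refine isBoundedAtImInfty_iff.2 ⟨‖f τ₁‖ * M, A, fun τ hτ => ?_⟩
    rw [ModularForm.SL_slash_apply, FFun, mul_assoc, norm_mul]
    exact mul_le_mul_of_nonneg_left (hM τ hτ) (norm_nonneg _)

end

/-! ### Bimodular functions -/

section
variable {κ : ℂ} {t g : ℂ → ℂ}

/-- If t were locally constant, it would be constant by the identity theorem, hence 0 by its limit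
at i∞; but t has no zeros. -/
lemma Uniformizes.frequently_ne (U : Uniformizes κ t g) {τ : ℂ} (hτ : 0 < τ.im) (c : ℂ) :
    ∃ᶠ σ in 𝓝 τ, t σ ≠ c := by
  intro h
  have h' : ∀ᶠ σ in 𝓝 τ, t σ = c := h.mono fun σ hσ => not_not.1 hσ
  have ho : IsOpen {σ : ℂ | 0 < σ.im} := isOpen_lt continuous_const Complex.continuous_im
  have ha : AnalyticOnNhd ℂ t {σ : ℂ | 0 < σ.im} := fun σ hσ => U.analyticAt_t hσ
  have hall : Set.EqOn t (fun _ => c) {σ : ℂ | 0 < σ.im} :=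
    ha.eqOn_of_preconnected_of_eventuallyEq (fun σ _ => analyticAt_const)
      (convex_halfSpace_im_gt 0).isPreconnected hτ h'
  have h0 : c = 0 := by
    have h1 : (0 : ℝ) < 1 := one_pos
    have : (comap Complex.im atTop).NeBot := by
      refine comap_neBot fun s hs => ?_
      obtain ⟨b, hb⟩ := (mem_atTop_sets.1 hs)
      exact ⟨⟨0, b⟩, hb b le_rfl⟩
    refine tendsto_nhds_unique (tendsto_const_nhds.congr' ?_) U.tendsto_t
    filter_upwards [preimage_mem_comap (Ioi_mem_atTop 0)] with σ hσ using (hall hσ).symm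
  exact U.ne_zero τ hτ ((hall hτ).trans h0)

lemma isMeromorphic_div {A B : ℂ → ℂ → ℂ}
    (hA : ∀ p ∈ upperHalfPlaneProd, An A p.1 p.2) (hB : ∀ p ∈ upperHalfPlaneProd, An B p.1 p.2)
    (hne : ∀ p ∈ upperHalfPlaneProd, ∃ᶠ s in 𝓝 p.1, ∃ᶠ s' in 𝓝 p.2, B s s' ≠ 0) :
    IsMeromorphic fun τ₁ τ₂ => A τ₁ τ₂ / B τ₁ τ₂ := by
  intro p hp
  refine ⟨fun q => A q.1 q.2, fun q => B q.1 q.2, hA p hp, hB p hp, ?_,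
    Eventually.of_forall fun q _ => rfl⟩
  intro h
  have h' : ∀ᶠ q in 𝓝 p.1 ×ˢ 𝓝 p.2, ¬(fun q : ℂ × ℂ => B q.1 q.2) q ≠ 0 := by
    rw [← nhds_prod_eq]; exact h
  refine hne p hp (h'.curry.mono fun s hs => ?_)
  simpa using hs

lemma Uniformizes.isMeromorphic_xFun (U : Uniformizes κ t g) : IsMeromorphic (xFun t) := by
  have e : xFun t = fun τ₁ τ₂ => -(t τ₁ + t τ₂) / ((1 - t τ₁) * (1 - t τ₂)) := by
    funext τ₁ τ₂
    rw [xFun, neg_div]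
  rw [e]
  have a1 : ∀ p ∈ upperHalfPlaneProd, An (fun s _ => t s) p.1 p.2 := fun p hp =>
    An.comp_fst (U.analyticAt_t hp.1)
  have a2 : ∀ p ∈ upperHalfPlaneProd, An (fun _ s => t s) p.1 p.2 := fun p hp =>
    An.comp_snd (U.analyticAt_t hp.2)
  refine isMeromorphic_div (A := fun τ₁ τ₂ => -(t τ₁ + t τ₂))
    (B := fun τ₁ τ₂ => (1 - t τ₁) * (1 - t τ₂))
    (fun p hp => (AnalyticAt.add (a1 p hp) (a2 p hp)).neg)
    (fun p hp => (analyticAt_const.sub (a1 p hp)).mul (analyticAt_const.sub (a2 p hp)))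
    fun p hp => ?_
  refine (U.frequently_ne hp.1 1).mono fun s hs => ?_
  refine (U.frequently_ne hp.2 1).mono fun s' hs' => ?_
  exact mul_ne_zero (sub_ne_zero.2 hs.symm) (sub_ne_zero.2 hs'.symm)

lemma Uniformizes.isMeromorphic_yFun (U : Uniformizes κ t g) : IsMeromorphic (yFun t) := by
  have a1 : ∀ p ∈ upperHalfPlaneProd, An (fun s _ => t s) p.1 p.2 := fun p hp =>
    An.comp_fst (U.analyticAt_t hp.1)
  have a2 : ∀ p ∈ upperHalfPlaneProd, An (fun _ s => t s) p.1 p.2 := fun p hp =>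
    An.comp_snd (U.analyticAt_t hp.2)
  refine isMeromorphic_div (A := fun τ₁ τ₂ => t τ₁ * t τ₂)
    (B := fun τ₁ τ₂ => (t τ₁ + t τ₂) ^ 2) (fun p hp => AnalyticAt.mul (a1 p hp) (a2 p hp))
    (fun p hp => (AnalyticAt.add (a1 p hp) (a2 p hp)).pow 2) fun p hp => ?_
  refine (U.frequently_ne hp.1 0).mono fun s hs => ?_
  refine (U.frequently_ne hp.2 (-t s)).mono fun s' hs' => pow_ne_zero 2 fun h => hs' ?_
  linear_combination h

/-- Numerator and denominator are both divided by t₁t₂ ≠ 0, so equality persists where the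
denominator vanishes. -/
lemma xFun_inv {T : ℂ → ℂ} {σ₁ σ₂ τ₁ τ₂ : ℂ} (h₁ : T σ₁ = (T τ₁)⁻¹) (h₂ : T σ₂ = (T τ₂)⁻¹)
    (h₁' : T τ₁ ≠ 0) (h₂' : T τ₂ ≠ 0) : xFun T σ₁ σ₂ = xFun T τ₁ τ₂ := by
  have e1 : (T τ₁)⁻¹ + (T τ₂)⁻¹ = (T τ₁ + T τ₂) / (T τ₁ * T τ₂) := by field_simp; ring
  have e2 : (1 - (T τ₁)⁻¹) * (1 - (T τ₂)⁻¹) = (1 - T τ₁) * (1 - T τ₂) / (T τ₁ * T τ₂) := by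
    field_simp; ring
  rw [xFun, xFun, h₁, h₂, e1, e2, div_div_div_cancel_right₀ (mul_ne_zero h₁' h₂')]

lemma yFun_inv {T : ℂ → ℂ} {σ₁ σ₂ τ₁ τ₂ : ℂ} (h₁ : T σ₁ = (T τ₁)⁻¹) (h₂ : T σ₂ = (T τ₂)⁻¹)
    (h₁' : T τ₁ ≠ 0) (h₂' : T τ₂ ≠ 0) : yFun T σ₁ σ₂ = yFun T τ₁ τ₂ := by
  have e1 : (T τ₁)⁻¹ + (T τ₂)⁻¹ = (T τ₁ + T τ₂) / (T τ₁ * T τ₂) := by field_simp; ring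
  have e2 : (T τ₁)⁻¹ * (T τ₂)⁻¹ = T τ₁ * T τ₂ / (T τ₁ * T τ₂) ^ 2 := by
    field_simp
  rw [yFun, yFun, h₁, h₂, e1, e2, div_pow,
    div_div_div_cancel_right₀ (pow_ne_zero 2 (mul_ne_zero h₁' h₂'))]

theorem Uniformizes.isBimodularFunction (U : Uniformizes κ t g) {N : ℕ} [NeZero N]
    {w : SL(2, ℝ)} (h : IsInvolutive ((Gamma0 N).map toReal) w)
    (ht : ∀ γ : Gamma0 N, HasFactor t 0 (toReal γ) 1)
    (hw : ∀ τ : ℍ, t ↑(w • τ) = (t τ)⁻¹) :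
    IsBimodularFunction (Gamma0 N) (adjoin (Gamma0 N) w) (xFun t) ∧
      IsBimodularFunction (Gamma0 N) (adjoin (Gamma0 N) w) (yFun t) := by
  have ht' : ∀ (γ : Gamma0 N) (τ : ℍ), t ↑((γ : SL(2, ℤ)) • τ) = t τ := fun γ τ => by
    have := ht γ τ
    rw [toReal_smul] at this
    simpa using this
  have key : ∀ g : adjoin (Gamma0 N) w, (∀ τ : ℍ, t ↑((g : SL(2, ℝ)) • τ) = t τ) ∨
      ∀ τ : ℍ, t ↑((g : SL(2, ℝ)) • τ) = (t τ)⁻¹ := by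
    intro g
    rcases h.mem_sup_iff g.2 with ⟨γ, hγ, hg⟩ | ⟨γ, hγ, hg⟩
    · refine Or.inl fun τ => ?_
      rw [← hg, toReal_smul]
      exact ht' ⟨γ, hγ⟩ τ
    · refine Or.inr fun τ => ?_
      have hg' : (g : SL(2, ℝ)) = toReal γ * w := by rw [hg]; group
      rw [hg', mul_smul, toReal_smul, ← hw]
      exact ht' ⟨γ, hγ⟩ _
  have h0 : ∀ τ : ℍ, t τ ≠ 0 := fun τ => U.ne_zero τ τ.im_pos
  refine ⟨⟨isBimodularPair_of_isInvolutive h, U.isMeromorphic_xFun, ?_, ?_, ?_⟩,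
    ⟨isBimodularPair_of_isInvolutive h, U.isMeromorphic_yFun, ?_, ?_, ?_⟩⟩
  · intro γ τ₁ τ₂
    rw [xFun, xFun, ht']
  · intro γ τ₁ τ₂
    rw [xFun, xFun, ht']
  · intro γ τ₁ τ₂
    rcases key γ with h | h
    · rw [xFun, xFun, h, h]
    · exact xFun_inv (h _) (h _) (h0 _) (h0 _)
  · intro γ τ₁ τ₂
    rw [yFun, yFun, ht']
  · intro γ τ₁ τ₂
    rw [yFun, yFun, ht']
  · intro γ τ₁ τ₂
    rcases key γ with h | h
    · rw [yFun, yFun, h, h]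
    · exact yFun_inv (h _) (h _) (h0 _) (h0 _)

end

/-! ### The involutions -/

section
variable {N : ℕ} [NeZero N]

lemma sqrt_natCast_ne_zero (N : ℕ) [NeZero N] : √(N : ℝ) ≠ 0 :=
  Real.sqrt_ne_zero'.2 (Nat.cast_pos.2 (Nat.pos_of_ne_zero (NeZero.ne N)))

lemma aut_atkinLehner (N : ℕ) [NeZero N] (τ : ℂ) : aut (atkinLehner N) τ = (√(N : ℝ) : ℝ) * τ := by
  simp [aut, atkinLehner]

lemma coe_atkinLehner_smul (N : ℕ) [NeZero N] (τ : ℍ) :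
    ((atkinLehner N • τ : ℍ) : ℂ) = -1 / (N * τ) := by
  rw [coe_smul_real, aut_atkinLehner]
  have h0 : ((√(N : ℝ) : ℝ) : ℂ) ≠ 0 := Complex.ofReal_ne_zero.2 (sqrt_natCast_ne_zero N)
  have h1 := ne_zero_of_im_pos τ.im_pos
  have h2 := sqrt_natCast_sq N
  have h3 : (N : ℂ) ≠ 0 := Nat.cast_ne_zero.2 (NeZero.ne N)
  simp only [atkinLehner, Matrix.of_apply, Matrix.cons_val', Matrix.cons_val_zero,
    Matrix.cons_val_one, Matrix.cons_val_fin_one, Complex.ofReal_zero, zero_mul, zero_add]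
  push_cast
  field_simp
  linear_combination h2

lemma coe_atkinLehner (N : ℕ) [NeZero N] :
    (atkinLehner N : Matrix (Fin 2) (Fin 2) ℝ) = !![0, -1 / √(N : ℝ); √(N : ℝ), 0] := rfl

lemma coe_toReal (γ : SL(2, ℤ)) : (toReal γ : Matrix (Fin 2) (Fin 2) ℝ) =
    !![(γ 0 0 : ℝ), (γ 0 1 : ℝ); (γ 1 0 : ℝ), (γ 1 1 : ℝ)] := by
  ext i j
  fin_cases i <;> fin_cases j <;> rfl

/-- Conjugation by w_N sends (a b; c d) to (d, -c/N; -Nb, a), and the square of w_N is -1. -/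
lemma isInvolutive_atkinLehner (N : ℕ) [NeZero N] :
    IsInvolutive ((Gamma0 N).map toReal) (atkinLehner N) where
  conj := by
    rintro _ ⟨γ, hγ, rfl⟩
    obtain ⟨m, hm⟩ := mem_Gamma0_iff.1 hγ
    have hdet := det_eq γ
    obtain ⟨δ, hδ⟩ : ∃ δ : SL(2, ℤ), (δ : Matrix (Fin 2) (Fin 2) ℤ) =
        !![γ 1 1, -m; -(N * γ 0 1), γ 0 0] := by
      refine ⟨⟨!![γ 1 1, -m; -(N * γ 0 1), γ 0 0], ?_⟩, rfl⟩
      rw [hm] at hdet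
      rw [Matrix.det_fin_two_of]
      linear_combination hdet
    refine ⟨δ, ?_, ?_⟩
    · refine mem_Gamma0_iff.2 ?_
      simp [hδ]
    · rw [eq_mul_inv_iff_mul_eq]
      have h0 := sqrt_natCast_ne_zero N
      have h1 : √(N : ℝ) * √(N : ℝ) = N := Real.mul_self_sqrt N.cast_nonneg
      apply Subtype.ext
      rw [Matrix.SpecialLinearGroup.coe_mul, Matrix.SpecialLinearGroup.coe_mul, coe_atkinLehner,
        coe_toReal, coe_toReal]
      simp only [Matrix.of_apply, Matrix.cons_val', Matrix.cons_val_zero, Matrix.cons_val_one,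
        Matrix.cons_val_fin_one, hm, hδ]
      push_cast
      ext i j
      fin_cases i <;> fin_cases j <;>
        simp [Matrix.mul_apply, Fin.sum_univ_two] <;> field_simp
      · linear_combination -(m : ℝ) * h1
      · linear_combination -(γ 0 1 : ℝ) * h1
  sq := by
    refine ⟨-1, mem_Gamma0_iff.2 (by simp), ?_⟩
    have h0 := sqrt_natCast_ne_zero N
    apply Subtype.ext
    rw [Matrix.SpecialLinearGroup.coe_mul, coe_atkinLehner, coe_toReal]
    ext i j
    fin_cases i <;> fin_cases j <;>
      simp [Matrix.mul_apply, Fin.sum_univ_two] <;> field_simp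

lemma atkinLehner_not_mem (hN : 2 ≤ N) : atkinLehner N ∉ (Gamma0 N).map toReal := by
  rintro ⟨γ, hγ, h⟩
  obtain ⟨m, hm⟩ := mem_Gamma0_iff.1 hγ
  have h0 : toReal γ 0 0 = atkinLehner N 0 0 := by rw [h]
  rw [toReal_apply] at h0
  have h1 : γ 0 0 = 0 := by
    have : (γ 0 0 : ℝ) = 0 := h0
    exact_mod_cast this
  have hdet := det_eq γ
  rw [h1, hm] at hdet
  have : (N : ℤ) ∣ 1 := ⟨-(γ 0 1 * m), by linear_combination -hdet⟩
  have := Int.le_of_dvd one_pos this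
  omega

end

lemma odd_of_mem_Gamma0_four {γ : SL(2, ℤ)} (h : γ ∈ Gamma0 4) : Odd (γ 0 0) ∧ Odd (γ 1 1) := by
  obtain ⟨m, hm⟩ := mem_Gamma0_iff.1 h
  have hdet := det_eq γ
  rw [hm] at hdet
  push_cast at hdet
  exact Int.odd_mul.1 ⟨2 * (γ 0 1 * m), by linear_combination hdet⟩

lemma toReal_lowerMat_two : toReal (lowerMat 2) = wMat := by
  apply Subtype.ext
  rw [coe_toReal]
  simp [coe_lowerMat, wMat]

lemma isInvolutive_wMat : IsInvolutive ((Gamma0 4).map toReal) wMat where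
  conj := by
    rintro _ ⟨γ, hγ, rfl⟩
    obtain ⟨m, hm⟩ := mem_Gamma0_iff.1 hγ
    refine ⟨lowerMat 2 * γ * (lowerMat 2)⁻¹, mem_Gamma0_iff.2 ?_, ?_⟩
    · have e : (lowerMat 2 * γ * (lowerMat 2)⁻¹) 1 0 =
          γ 1 0 + 2 * (γ 0 0 - γ 1 1) - 4 * γ 0 1 := by
        simp [Matrix.SpecialLinearGroup.coe_inv, Matrix.adjugate_fin_two, Matrix.mul_apply,
          Fin.sum_univ_two, coe_lowerMat, Matrix.vecMul, dotProduct]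
        ring
      rw [e]
      obtain ⟨⟨p, hp⟩, ⟨r, hr⟩⟩ := odd_of_mem_Gamma0_four hγ
      exact ⟨m + (p - r) - γ 0 1, by rw [hm, hp, hr]; push_cast; ring⟩
    · rw [map_mul, map_mul, map_inv, toReal_lowerMat_two]
  sq := by
    refine ⟨lowerMat 2 * lowerMat 2, mem_Gamma0_iff.2 ?_, ?_⟩
    · simp [Matrix.mul_apply, Fin.sum_univ_two, coe_lowerMat]
    · rw [map_mul, toReal_lowerMat_two]

lemma wMat_not_mem : wMat ∉ (Gamma0 4).map toReal := by
  rintro ⟨γ, hγ, h⟩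
  obtain ⟨m, hm⟩ := mem_Gamma0_iff.1 hγ
  rw [← toReal_lowerMat_two] at h
  rw [toReal_injective h] at hm
  simp [coe_lowerMat] at hm
  omega

/-! ### The characters -/

/-- The character `(-3 / d)` of `Γ₀(3)`. -/
def chiThird : Gamma0 3 →* ℂˣ :=
  (((Int.castRingHom ℂ : ℤ →* ℂ).comp (quadraticChar (ZMod 3)).toMonoidHom).comp
    (Gamma0Map 3)).toHomUnits

lemma chiThird_apply (γ : Gamma0 3) : (chiThird γ : ℂ) =
    (quadraticChar (ZMod 3) ((γ : SL(2, ℤ)) 1 1 : ZMod 3) : ℂ) := rfl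

lemma chiThird_sq (γ : Gamma0 3) : chiThird γ ^ 2 = 1 := by
  apply Units.ext
  have h : ((γ : SL(2, ℤ)) 1 1 : ZMod 3) ≠ 0 := ((Group.isUnit γ).map (Gamma0Map 3)).ne_zero
  have := quadraticChar_sq_one h
  rw [Units.val_pow_eq_pow_val, chiThird_apply, Units.val_one]
  exact_mod_cast this

lemma neg_one_zpow_congr {a b : ℤ} (h : Even (a - b)) : (-1 : ℂ) ^ a = (-1 : ℂ) ^ b := by
  have : a = b + (a - b) := by ring
  rw [this, zpow_add₀ (by norm_num), h.neg_one_zpow, mul_one]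

/-- The character `(-1) ^ (c / 4) (-4 / d)` of `Γ₀(4)`. -/
def chiHalf : Gamma0 4 →* ℂˣ :=
  MonoidHom.toHomUnits
    { toFun := fun γ => (-1 : ℂ) ^ ((γ : SL(2, ℤ)) 1 0 / 4 : ℤ) *
        (ZMod.χ₄ ((γ : SL(2, ℤ)) 1 1 : ZMod 4) : ℂ)
      map_one' := by simp
      map_mul' := by
        rintro ⟨γ, hγ⟩ ⟨δ, hδ⟩
        obtain ⟨m, hm⟩ := mem_Gamma0_iff.1 hγ
        obtain ⟨n, hn⟩ := mem_Gamma0_iff.1 hδ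
        obtain ⟨p, hp⟩ := (odd_of_mem_Gamma0_four hδ).1
        obtain ⟨r, hr⟩ := (odd_of_mem_Gamma0_four hγ).2
        have e1 : (γ * δ) 1 0 = 4 * (m * δ 0 0 + γ 1 1 * n) := by
          rw [Matrix.SpecialLinearGroup.coe_mul, Matrix.mul_apply, Fin.sum_univ_two, hm, hn]
          push_cast; ring
        have e2 : (γ * δ) 1 1 = γ 1 0 * δ 0 1 + γ 1 1 * δ 1 1 := by
          rw [Matrix.SpecialLinearGroup.coe_mul, Matrix.mul_apply, Fin.sum_univ_two]
        have e3 : (((γ * δ) 1 1 : ℤ) : ZMod 4) = (γ 1 1 : ZMod 4) * (δ 1 1 : ZMod 4) := by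
          rw [e2]
          push_cast
          rw [Gamma0_mem.1 hγ, zero_mul, zero_add]
        have e4 : γ 1 0 / 4 = m := by rw [hm]; push_cast; omega
        have e5 : δ 1 0 / 4 = n := by rw [hn]; push_cast; omega
        have e6 : (γ * δ) 1 0 / 4 = m * δ 0 0 + γ 1 1 * n := by rw [e1]; omega
        change (-1 : ℂ) ^ ((γ * δ) 1 0 / 4 : ℤ) * (ZMod.χ₄ (((γ * δ) 1 1 : ℤ) : ZMod 4) : ℂ) =
          (-1 : ℂ) ^ (γ 1 0 / 4 : ℤ) * (ZMod.χ₄ (γ 1 1 : ZMod 4) : ℂ) *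
            ((-1 : ℂ) ^ (δ 1 0 / 4 : ℤ) * (ZMod.χ₄ (δ 1 1 : ZMod 4) : ℂ))
        -- The diagonal entries of elements of Γ₀(4) are odd, so c/4 is additive modulo 2 under
        -- multiplication.
        rw [e6, e4, e5, e3, map_mul, neg_one_zpow_congr (b := m + n)
          ⟨m * p + r * n, by rw [hp, hr]; ring⟩, zpow_add₀ (by norm_num)]
        push_cast
        ring }

lemma chiHalf_apply (γ : Gamma0 4) : (chiHalf γ : ℂ) =
    (-1 : ℂ) ^ ((γ : SL(2, ℤ)) 1 0 / 4 : ℤ) * (ZMod.χ₄ ((γ : SL(2, ℤ)) 1 1 : ZMod 4) : ℂ) := rfl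

lemma chiHalf_sq (γ : Gamma0 4) : chiHalf γ ^ 2 = 1 := by
  apply Units.ext
  have h : IsUnit ((γ : SL(2, ℤ)) 1 1 : ZMod 4) := (Group.isUnit γ).map (Gamma0Map 4)
  have h4 : ∀ u : ZMod 4, IsUnit u → ZMod.χ₄ u ^ 2 = 1 := by decide
  have h1 : (ZMod.χ₄ ((γ : SL(2, ℤ)) 1 1 : ZMod 4) : ℂ) ^ 2 = 1 := by exact_mod_cast h4 _ h
  rw [Units.val_pow_eq_pow_val, chiHalf_apply, Units.val_one, mul_pow, h1, mul_one, ← zpow_natCast,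
    ← zpow_mul, mul_comm, zpow_mul]
  norm_num

/-! ### Factors on the generators -/

section
variable {f : ℂ → ℂ} {k : ℤ} {g w : SL(2, ℝ)} {s : ℂ}

lemma HasFactor.zpow (hg : HasFactor f k g s) (hs : s ≠ 0) (n : ℤ) :
    HasFactor f k (g ^ n) (s ^ n) := by
  induction n with
  | zero => simpa using HasFactor.one
  | succ n ih =>
    rw [zpow_add_one, zpow_add_one₀ hs]
    exact ih.mul hg
  | pred n ih =>
    rw [zpow_sub_one, zpow_sub_one₀ hs]
    exact ih.mul (hg.inv hs)

lemma lowerMat_mul (m n : ℤ) : lowerMat m * lowerMat n = lowerMat (m + n) := by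
  apply Subtype.ext
  rw [Matrix.SpecialLinearGroup.coe_mul, coe_lowerMat, coe_lowerMat, coe_lowerMat]
  simp

lemma lowerMat_zero : lowerMat 0 = 1 := by
  apply Subtype.ext
  rw [coe_lowerMat, Matrix.SpecialLinearGroup.coe_one, Matrix.one_fin_two]

lemma lowerMat_zpow (m n : ℤ) : lowerMat m ^ n = lowerMat (m * n) := by
  induction n with
  | zero => rw [zpow_zero, mul_zero, lowerMat_zero]
  | succ n ih => rw [zpow_add_one, ih, lowerMat_mul, mul_add_one]
  | pred n ih =>
    rw [zpow_sub_one, ih, mul_inv_eq_iff_eq_mul, lowerMat_mul]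
    congr 1
    ring

lemma HasFactor.lowerMat {m : ℤ} (h : HasFactor f k (toReal (lowerMat m)) s) (hs : s ≠ 0) (n : ℤ) :
    HasFactor f k (toReal (lowerMat (m * n))) (s ^ n) := by
  rw [← lowerMat_zpow, map_zpow]
  exact h.zpow hs n

lemma hasFactor_T_zpow {φ : ℂ → ℂ} (h : OnDisc f φ) (n : ℤ) :
    HasFactor f k (toReal (ModularGroup.T ^ n)) 1 := by
  intro τ
  have h1 := eq_of_add_int_mul (h := 1) (fun τ hτ => h.periodic hτ) n τ τ.im_pos
  have h2 : ((ModularGroup.T ^ n • τ : ℍ) : ℂ) = τ + n * 1 := by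
    rw [modular_T_zpow_smul, coe_vadd]
    push_cast
    ring
  rw [Complex.ofReal_one] at h1
  rw [toReal_smul, h2, h1, aut_toReal, ModularGroup.coe_T_zpow]
  simp

/-- The lower triangular generator of Γ₀(N) is thus controlled by periodicity and the law under w_N.
-/
lemma lowerMat_eq_conj (N : ℕ) [NeZero N] : toReal (lowerMat N) =
    atkinLehner N * toReal (ModularGroup.T ^ (-1 : ℤ)) * (atkinLehner N)⁻¹ := by
  rw [eq_mul_inv_iff_mul_eq]
  have h0 := sqrt_natCast_ne_zero N
  have h1 : √(N : ℝ) * √(N : ℝ) = N := Real.mul_self_sqrt N.cast_nonneg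
  apply Subtype.ext
  rw [Matrix.SpecialLinearGroup.coe_mul, Matrix.SpecialLinearGroup.coe_mul, coe_atkinLehner,
    coe_toReal, coe_toReal, ModularGroup.coe_T_zpow, coe_lowerMat]
  ext i j
  fin_cases i <;> fin_cases j <;>
    simp [Matrix.mul_apply, Fin.sum_univ_two]
  field_simp
  linear_combination h1

lemma hasFactor_lowerMat_of_atkinLehner {N : ℕ} [NeZero N] {φ : ℂ → ℂ} (h : OnDisc f φ)
    (hw : HasFactor f k (atkinLehner N) s) (hs : s ≠ 0) (n : ℤ) :
    HasFactor f k (toReal (lowerMat (N * n))) 1 := by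
  have h1 := (hw.mul (hasFactor_T_zpow h (-1))).mul (hw.inv hs)
  rw [← lowerMat_eq_conj, mul_one, mul_inv_cancel₀ hs] at h1
  simpa using h1.lowerMat one_ne_zero n

lemma hasFactor_neg_one (hs : s * (-1) ^ k = 1) : HasFactor f k (toReal (-1)) s := by
  intro τ
  have h1 : ((-1 : SL(2, ℤ)) • τ : ℍ) = τ := by
    apply UpperHalfPlane.ext
    rw [coe_smul_int]
    simp
  rw [toReal_smul, h1, aut_toReal]
  simp [hs]

/-- Inversion under `w` gives invariance under conjugates by `w`. -/
lemma hasFactor_zero_conj (hw : ∀ τ : ℍ, f ↑(w • τ) = (f τ)⁻¹) (hg : HasFactor f 0 g 1) :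
    HasFactor f 0 (w * g * w⁻¹) 1 := by
  intro τ
  have h1 := hw (w⁻¹ • τ)
  rw [smul_inv_smul] at h1
  have h2 := hg (w⁻¹ • τ)
  rw [zpow_zero, one_mul, one_mul] at h2 ⊢
  rw [mul_smul, mul_smul, hw, h2, h1]

lemma hasFactor_zero_lowerMat {N : ℕ} [NeZero N] {φ : ℂ → ℂ} (h : OnDisc f φ)
    (hw : ∀ τ : ℍ, f ↑(atkinLehner N • τ) = (f τ)⁻¹) (n : ℤ) :
    HasFactor f 0 (toReal (lowerMat (N * n))) 1 := by
  have h1 := hasFactor_zero_conj hw (hasFactor_T_zpow h (-1))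
  rw [← lowerMat_eq_conj] at h1
  simpa using h1.lowerMat one_ne_zero n

lemma hasFactor_zero_Gamma0 {N : ℕ} (hN2 : 2 ≤ N) (hN4 : N ≤ 4) {φ : ℂ → ℂ} (h : OnDisc f φ)
    (hV : ∀ n : ℤ, HasFactor f 0 (toReal (lowerMat (N * n))) 1) (γ : Gamma0 N) :
    HasFactor f 0 (toReal γ) 1 := by
  have := hasFactor_Gamma0 (f := f) (k := 0) hN2 hN4 1 (fun n _ => by
    simpa using hasFactor_T_zpow h n) (fun n _ => by simpa using hV n)
    (fun _ => hasFactor_neg_one (by simp)) γ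
  simpa using this

lemma boundedAtCusp_one {l : ℂ} (h : Tendsto f (comap Complex.im atTop) (𝓝 l)) :
    BoundedAtCusp f k 1 := by
  have h1 : ∀ᶠ τ in comap Complex.im atTop, ‖f τ‖ < ‖l‖ + 1 :=
    h.norm.eventually_lt_const (lt_add_one _)
  obtain ⟨C, hC⟩ := eventually_comap_im.1 h1
  refine isBoundedAtImInfty_iff.2 ⟨‖l‖ + 1, C + 1, fun τ hτ => ?_⟩
  have : C < (τ : ℂ).im := lt_of_lt_of_le (lt_add_one C) hτ
  rw [aut_toReal]
  simpa using (hC τ this).le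

/-- Since -1/τ = -1/(N · τ/N), the law at τ/N transfers the bound for h at i∞ to f at the cusp 0. -/
lemma boundedAtCusp_S {N : ℕ} (hN : 0 < N) {c : ℂ} {h : ℂ → ℂ}
    (hb : ∀ᶠ τ in comap Complex.im atTop, ‖h τ‖ < 2)
    (hf : ∀ τ : ℂ, 0 < τ.im → f (-1 / (N * τ)) = c * τ ^ k * h τ) :
    BoundedAtCusp f k ModularGroup.S := by
  obtain ⟨C, hC⟩ := eventually_comap_im.1 hb
  have hN' : (0 : ℝ) < N := Nat.cast_pos.2 hN
  have hNc : (N : ℂ) ≠ 0 := Nat.cast_ne_zero.2 hN.ne'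
  refine isBoundedAtImInfty_iff.2 ⟨‖c * (N : ℂ) ^ (-k)‖ * 2, N * C + 1, fun τ hτ => ?_⟩
  have h0 := ne_zero_of_im_pos τ.im_pos
  have him : ((τ : ℂ) / N).im = (τ : ℂ).im / N := by
    rw [← Complex.ofReal_natCast, Complex.div_ofReal_im]
  have h1 : 0 < ((τ : ℂ) / N).im := by rw [him]; exact div_pos τ.im_pos hN'
  have h2 : C < ((τ : ℂ) / N).im := by
    rw [him, lt_div_iff₀ hN']
    have : (N : ℝ) * C + 1 ≤ (τ : ℂ).im := hτ
    linarith
  have h3 : ((ModularGroup.S • τ : ℍ) : ℂ) = -1 / (N * ((τ : ℂ) / N)) := by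
    rw [mul_div_cancel₀ _ hNc, coe_smul_int, ModularGroup.coe_S]
    simp
  rw [h3, hf _ h1, aut_toReal, ModularGroup.coe_S]
  have h4 : c * ((τ : ℂ) / N) ^ k * h (τ / N) * ((((1 : ℤ) : ℂ) * τ + ((0 : ℤ) : ℂ)) ^ (-k)) =
      c * (N : ℂ) ^ (-k) * h (τ / N) := by
    have h5 := zpow_ne_zero k h0
    have h6 := zpow_ne_zero k hNc
    rw [div_zpow, zpow_neg, zpow_neg]
    push_cast
    rw [one_mul, add_zero]
    field_simp
  have h7 : (!![0, -1; 1, 0] : Matrix (Fin 2) (Fin 2) ℤ) 1 0 = 1 := rfl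
  have h8 : (!![0, -1; 1, 0] : Matrix (Fin 2) (Fin 2) ℤ) 1 1 = 0 := rfl
  rw [h7, h8, h4, norm_mul]
  gcongr
  exact (hC _ h2).le

end

/-! ### The case `a = 1/2` -/

lemma coe_wMat_smul (τ : ℍ) : ((wMat • τ : ℍ) : ℂ) = τ / (2 * τ + 1) := by
  rw [← toReal_lowerMat_two, toReal_smul, coe_smul_int, coe_lowerMat]
  simp

lemma aut_wMat (τ : ℂ) : aut wMat τ = 2 * τ + 1 := by
  rw [← toReal_lowerMat_two, aut_toReal, coe_lowerMat]
  simp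

/-- The point `σ` with `σ + 1/2 = -1/(4τ)` and `w τ = -1/(4σ)`. -/
lemma exists_between (τ : ℍ) : ∃ σ : ℂ, 0 < σ.im ∧ σ + 1 / 2 = -1 / (4 * τ) ∧
    ((wMat • τ : ℍ) : ℂ) = -1 / (4 * σ) ∧ 4 * τ * σ = -(2 * τ + 1) := by
  have h0 := ne_zero_of_im_pos τ.im_pos
  have h1 : (2 * τ + 1 : ℂ) ≠ 0 := aut_wMat τ ▸ aut_ne_zero wMat τ
  have hσ : 4 * (τ : ℂ) * (-1 / (4 * τ) - 1 / 2) = -(2 * τ + 1) := by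
    field_simp
    ring
  have hσ0 : (-1 / (4 * τ) - 1 / 2 : ℂ) ≠ 0 := fun h => by
    rw [h, mul_zero, zero_eq_neg] at hσ
    exact h1 hσ
  refine ⟨-1 / (4 * τ) - 1 / 2, ?_, by ring, ?_, hσ⟩
  · have : (-1 / (4 * τ) - 1 / 2 : ℂ).im = (-1 / (4 * τ) : ℂ).im := by simp
    rw [this]
    exact im_four_pos τ.im_pos
  · rw [coe_wMat_smul, div_eq_div_iff h1 (mul_ne_zero (by norm_num : (4 : ℂ) ≠ 0) hσ0)]
    linear_combination hσ

/-- With wτ = -1/(4σ) and σ + 1/2 = -1/(4τ), θ₄(wτ) becomes θ₂(σ), then θ₂(σ + 1/2) up to an eighth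
root of unity, then θ₄(τ); after squaring, the product of the factors is -i(2τ + 1). -/
lemma hasFactor_fHalf_wMat : HasFactor fHalf 1 wMat (-Complex.I) := by
  intro τ
  obtain ⟨σ, hσ, e1, e2, e3⟩ := exists_between τ
  have h1 := theta₄_fricke hσ
  have h2 := theta₂_fricke τ.im_pos
  rw [← e1, theta₂_add_half] at h2
  have h3 : Complex.I * theta₂ σ ^ 2 = -Complex.I * (2 * τ) * theta₄ τ ^ 2 := by
    rw [← nome_eighth_sq, ← mul_pow, h2, mul_pow, thetaFactor_sq, nome_eighth_sq]
  rw [fHalf, fHalf, e2, h1, mul_pow, thetaFactor_sq, aut_wMat, zpow_one]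
  linear_combination (-2 * σ) * h3 - Complex.I * theta₄ τ ^ 2 * (-1) * e3

/-- Along the same chain θ₂⁴/θ₃⁴ at wτ becomes θ₄⁴/θ₃⁴ at σ, then θ₃⁴/θ₄⁴ at σ + 1/2 = -1/(4τ), then
θ₃⁴/θ₂⁴ at τ. -/
lemma tHalf_wMat (τ : ℍ) : tHalf ↑(wMat • τ) = (tHalf τ)⁻¹ := by
  obtain ⟨σ, hσ, e1, e2, -⟩ := exists_between τ
  have h0 : (-4 * σ ^ 2 : ℂ) ≠ 0 :=
    mul_ne_zero (by norm_num) (pow_ne_zero 2 (ne_zero_of_im_pos hσ))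
  have h0' : (-4 * (τ : ℂ) ^ 2) ≠ 0 :=
    mul_ne_zero (by norm_num) (pow_ne_zero 2 (ne_zero_of_im_pos τ.im_pos))
  have a := g₃_add_half σ
  have b := g₄_add_half σ
  rw [e1] at a b
  rw [tHalf_eq, tHalf_eq, e2, g₂_fricke hσ, g₃_fricke hσ, mul_div_mul_left _ _ h0, inv_div,
    ← a, ← b, g₃_fricke τ.im_pos, g₄_fricke τ.im_pos, mul_div_mul_left _ _ h0']

lemma hasFactor_fHalf (γ : Gamma0 4) : HasFactor fHalf 1 (toReal γ) (chiHalf γ) := by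
  refine hasFactor_Gamma0 (by norm_num) le_rfl chiHalf (fun n h => ?_) (fun n h => ?_)
    (fun h => ?_) γ
  · have : (chiHalf ⟨_, h⟩ : ℂ) = 1 := by
      rw [chiHalf_apply]
      simp [ModularGroup.coe_T_zpow]
    rw [this]
    exact hasFactor_T_zpow onDisc_fHalf n
  -- The generator `lowerMat 4` is w², so its factor is (-i)² = -1.
  · have h2 : HasFactor fHalf 1 (toReal (lowerMat 4)) (-1) := by
      have := hasFactor_fHalf_wMat.mul hasFactor_fHalf_wMat
      rw [← toReal_lowerMat_two, ← map_mul, lowerMat_mul] at this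
      simpa using this
    have : (chiHalf ⟨_, h⟩ : ℂ) = (-1) ^ n := by
      rw [chiHalf_apply]
      simp [coe_lowerMat]
    rw [this]
    exact h2.lowerMat (by norm_num) n
  · refine hasFactor_neg_one ?_
    have e : ZMod.χ₄ (((-1 : SL(2, ℤ)) 1 1 : ℤ) : ZMod 4) = -1 := by decide
    rw [chiHalf_apply, e]
    simp

lemma boundedAtCusp_fHalf (γ : SL(2, ℤ)) : BoundedAtCusp fHalf 1 γ := by
  have h1 : BoundedAtCusp fHalf 1 1 := boundedAtCusp_one onDisc_fHalf.tendsto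
  refine boundedAtCusp (N := 4) (Or.inr (Or.inr rfl)) chiHalf hasFactor_fHalf h1 ?_ ?_ γ
  · refine boundedAtCusp_S (N := 4) (c := -Complex.I * 2) (h := fun τ => theta₂ τ ^ 2)
      four_pos ?_ fun τ hτ => ?_
    · have h := onDisc_g₂.tendsto.norm.eventually_lt_const (u := 1) (by simp)
      filter_upwards [h] with τ hτ
      rw [g₂, norm_pow] at hτ
      rw [norm_pow]
      nlinarith [sq_nonneg (‖theta₂ τ‖ ^ 2)]
    · push_cast
      rw [fHalf, theta₄_fricke hτ, mul_pow, thetaFactor_sq, zpow_one]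
      ring
  -- The cusp 1/2 is the image of ∞ under w, for which f has a factor.
  · intro _
    have h2 := hasFactor_fHalf_wMat
    rw [← toReal_lowerMat_two] at h2
    simpa using h1.mul_left h2

theorem bimodular_half :
    IsBimodularFunction (Gamma0 4) (adjoin (Gamma0 4) wMat) (xFun tHalf) ∧
      IsBimodularFunction (Gamma0 4) (adjoin (Gamma0 4) wMat) (yFun tHalf) := by
  obtain ⟨T, -, hT⟩ := uniformizes_half.exists_disc_t
  refine uniformizes_half.isBimodularFunction isInvolutive_wMat
    (hasFactor_zero_Gamma0 (by norm_num) le_rfl hT fun n => ?_) tHalf_wMat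
  have h2 : HasFactor tHalf 0 (toReal (lowerMat 4)) 1 := by
    intro τ
    have e : lowerMat 4 = lowerMat 2 * lowerMat 2 := by rw [lowerMat_mul]; norm_num
    rw [e, map_mul, toReal_lowerMat_two, mul_smul, tHalf_wMat, tHalf_wMat]
    simp
  simpa using h2.lowerMat one_ne_zero n

/-- As χ₁² = 1, the character χ₂ may be the sign character of the index two extension; its value -1
at w is ω² for ω = -i. -/
theorem bimodularForm_half :
    ∃ (χ₁ : Gamma0 4 →* ℂˣ) (χ₂ : adjoin (Gamma0 4) wMat →* ℂˣ),
      (∀ γ : Gamma0 4, (χ₁ γ : ℂ) =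
        (-1 : ℂ) ^ ((γ : SL(2, ℤ)) 1 0 / 4 : ℤ) *
          (ZMod.χ₄ ((γ : SL(2, ℤ)) 1 1 : ZMod 4) : ℂ)) ∧
      χ₂ ⟨wMat, mem_adjoin _ _⟩ = -1 ∧
      IsBimodularForm 1 (Gamma0 4) (adjoin (Gamma0 4) wMat) χ₁ χ₂ (FFun fHalf) := by
  have hw := isInvolutive_wMat.sign_of_not_mem wMat_not_mem ⟨wMat, mem_adjoin _ _⟩ wMat_not_mem
  refine ⟨chiHalf, isInvolutive_wMat.sign wMat_not_mem, chiHalf_apply, hw,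
    isBimodularForm_of_hasFactor isInvolutive_wMat (ω := -Complex.I) (fun γ h => ?_) ?_
      onDisc_fHalf.hol hasFactor_fHalf hasFactor_fHalf_wMat boundedAtCusp_fHalf⟩
  · rw [chiHalf_sq]
    exact isInvolutive_wMat.sign_of_mem wMat_not_mem ⟨toReal γ, h⟩ ⟨γ, γ.2, rfl⟩
  · exact (congrArg Units.val hw).trans (by simp)

/-! ### The case `a = 1/3` -/

lemma hasFactor_fThird_atkinLehner : HasFactor fThird 1 (atkinLehner 3) (-Complex.I) := by
  intro τ
  rw [coe_atkinLehner_smul, fThird_fricke τ.im_pos, aut_atkinLehner, zpow_one]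
  ring

lemma hasFactor_fThird (γ : Gamma0 3) : HasFactor fThird 1 (toReal γ) (chiThird γ) := by
  refine hasFactor_Gamma0 (by norm_num) (by norm_num) chiThird (fun n h => ?_) (fun n h => ?_)
    (fun h => ?_) γ
  · have : (chiThird ⟨_, h⟩ : ℂ) = 1 := by
      rw [chiThird_apply]
      simp [ModularGroup.coe_T_zpow]
    rw [this]
    exact hasFactor_T_zpow onDisc_fThird n
  · have : (chiThird ⟨_, h⟩ : ℂ) = 1 := by
      rw [chiThird_apply]
      simp [coe_lowerMat]
    rw [this]
    exact hasFactor_lowerMat_of_atkinLehner onDisc_fThird hasFactor_fThird_atkinLehner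
      (neg_ne_zero.2 Complex.I_ne_zero) n
  · refine hasFactor_neg_one ?_
    have e : quadraticChar (ZMod 3) (-1) = -1 := by decide
    rw [chiThird_apply]
    simp [e]

lemma boundedAtCusp_fThird (γ : SL(2, ℤ)) : BoundedAtCusp fThird 1 γ := by
  refine boundedAtCusp (N := 3) (Or.inr (Or.inl rfl)) chiThird hasFactor_fThird
    (boundedAtCusp_one onDisc_fThird.tendsto) ?_ (fun h => by norm_num at h) γ
  refine boundedAtCusp_S (N := 3) (c := (√((3 : ℕ) : ℝ) : ℝ) * -Complex.I) (h := fThird)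
    three_pos ?_ fun τ hτ => ?_
  · exact onDisc_fThird.tendsto.norm.eventually_lt_const (by rw [cubicA_zero]; norm_num)
  · rw [fThird_fricke hτ, zpow_one]
    ring

theorem bimodular_third :
    IsBimodularFunction (Gamma0 3) (adjoin (Gamma0 3) (atkinLehner 3)) (xFun tThird) ∧
      IsBimodularFunction (Gamma0 3) (adjoin (Gamma0 3) (atkinLehner 3)) (yFun tThird) := by
  obtain ⟨T, -, hT⟩ := uniformizes_third.exists_disc_t
  have hw : ∀ τ : ℍ, tThird ↑(atkinLehner 3 • τ) = (tThird τ)⁻¹ := fun τ => by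
    rw [coe_atkinLehner_smul, tThird_fricke τ.im_pos]
  exact uniformizes_third.isBimodularFunction (isInvolutive_atkinLehner 3)
    (hasFactor_zero_Gamma0 (by norm_num) (by norm_num) hT (hasFactor_zero_lowerMat hT hw)) hw

theorem bimodularForm_third :
    ∃ (χ₁ : Gamma0 3 →* ℂˣ) (χ₂ : adjoin (Gamma0 3) (atkinLehner 3) →* ℂˣ),
      (∀ γ : Gamma0 3, (χ₁ γ : ℂ) =
        (quadraticChar (ZMod 3) ((γ : SL(2, ℤ)) 1 1 : ZMod 3) : ℂ)) ∧
      χ₂ ⟨atkinLehner 3, mem_adjoin _ _⟩ = -1 ∧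
      IsBimodularForm 1 (Gamma0 3) (adjoin (Gamma0 3) (atkinLehner 3)) χ₁ χ₂ (FFun fThird) := by
  have hi := isInvolutive_atkinLehner 3
  have hn := atkinLehner_not_mem (N := 3) (by norm_num)
  have hw := hi.sign_of_not_mem hn ⟨atkinLehner 3, mem_adjoin _ _⟩ hn
  refine ⟨chiThird, hi.sign hn, chiThird_apply, hw,
    isBimodularForm_of_hasFactor hi (ω := -Complex.I) (fun γ h => ?_) ?_
      onDisc_fThird.hol hasFactor_fThird hasFactor_fThird_atkinLehner boundedAtCusp_fThird⟩
  · rw [chiThird_sq]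
    exact hi.sign_of_mem hn ⟨toReal γ, h⟩ ⟨γ, γ.2, rfl⟩
  · exact (congrArg Units.val hw).trans (by simp)

/-! ### The case `a = 1/4` -/

/-- The one-variable factor -1 squares to 1 on the diagonal, so χ₂ is trivial. -/
lemma hasFactor_gQuarter_atkinLehner : HasFactor gQuarter 2 (atkinLehner 2) (-1) := by
  intro τ
  have h := sqrt_natCast_sq 2
  rw [coe_atkinLehner_smul, gQuarter_fricke τ.im_pos, aut_atkinLehner]
  rw [zpow_ofNat, mul_pow, h]
  push_cast
  ring

lemma hasFactor_gQuarter (γ : Gamma0 2) :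
    HasFactor gQuarter 2 (toReal γ) ((1 : Gamma0 2 →* ℂˣ) γ) := by
  obtain ⟨φ, hφ, -⟩ := onDisc_gQuarter
  refine hasFactor_Gamma0 le_rfl (by norm_num) 1 (fun n h => ?_) (fun n h => ?_) (fun h => ?_) γ
  · simpa using hasFactor_T_zpow hφ n
  · simpa using hasFactor_lowerMat_of_atkinLehner hφ hasFactor_gQuarter_atkinLehner (by norm_num) n
  · exact hasFactor_neg_one (by simp)

lemma boundedAtCusp_gQuarter (γ : SL(2, ℤ)) : BoundedAtCusp gQuarter 2 γ := by
  refine boundedAtCusp (N := 2) (Or.inl rfl) 1 hasFactor_gQuarter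
    (boundedAtCusp_one uniformizes_quarter.tendsto_g) ?_ (fun h => by norm_num at h) γ
  refine boundedAtCusp_S (N := 2) (c := -2) (h := gQuarter) two_pos ?_ fun τ hτ => ?_
  · exact uniformizes_quarter.tendsto_g.norm.eventually_lt_const (by norm_num)
  · rw [gQuarter_fricke hτ, zpow_ofNat]

theorem bimodular_quarter :
    IsBimodularFunction (Gamma0 2) (adjoin (Gamma0 2) (atkinLehner 2)) (xFun tQuarter) ∧
      IsBimodularFunction (Gamma0 2) (adjoin (Gamma0 2) (atkinLehner 2)) (yFun tQuarter) := by
  obtain ⟨T, -, hT⟩ := uniformizes_quarter.exists_disc_t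
  have hw : ∀ τ : ℍ, tQuarter ↑(atkinLehner 2 • τ) = (tQuarter τ)⁻¹ := fun τ => by
    rw [coe_atkinLehner_smul, tQuarter_fricke τ.im_pos]
  exact uniformizes_quarter.isBimodularFunction (isInvolutive_atkinLehner 2)
    (hasFactor_zero_Gamma0 le_rfl (by norm_num) hT (hasFactor_zero_lowerMat hT hw)) hw

theorem bimodularForm_quarter :
    IsBimodularForm 2 (Gamma0 2) (adjoin (Gamma0 2) (atkinLehner 2)) 1 1
      (fun τ₁ τ₂ => FFun fQuarter τ₁ τ₂ ^ 2) := by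
  have e : (fun τ₁ τ₂ => FFun fQuarter τ₁ τ₂ ^ 2) = FFun gQuarter := by
    funext τ₁ τ₂
    rw [FFun, mul_pow, fQuarter_sq, fQuarter_sq, FFun]
  rw [e]
  exact isBimodularForm_of_hasFactor (isInvolutive_atkinLehner 2) (ω := -1)
    (fun γ h => by simp) (by simp) uniformizes_quarter.hol_g hasFactor_gQuarter
    hasFactor_gQuarter_atkinLehner boundedAtCusp_gQuarter

end Bimodular

end

theorem mainTheorem11 :
    -- the case a = 1/2
    (HasHypergeometricExpansion (1 / 2) tHalf fHalf ∧
      (∀ τ₁ τ₂ : ℍ, IsRegularPoint tHalf τ₁ τ₂ →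
        SatisfiesSystemAt (1 / 2) (xFun tHalf) (yFun tHalf) (FFun fHalf) τ₁ τ₂) ∧
      IsBimodularFunction (Gamma0 4) (adjoin (Gamma0 4) wMat) (xFun tHalf) ∧
      IsBimodularFunction (Gamma0 4) (adjoin (Gamma0 4) wMat) (yFun tHalf) ∧
      ∃ (χ₁ : Gamma0 4 →* ℂˣ) (χ₂ : adjoin (Gamma0 4) wMat →* ℂˣ),
        (∀ γ : Gamma0 4, (χ₁ γ : ℂ) =
          (-1 : ℂ) ^ ((γ : SL(2, ℤ)) 1 0 / 4 : ℤ) *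
            (ZMod.χ₄ ((γ : SL(2, ℤ)) 1 1 : ZMod 4) : ℂ)) ∧
        χ₂ ⟨wMat, mem_adjoin _ _⟩ = -1 ∧
        IsBimodularForm 1 (Gamma0 4) (adjoin (Gamma0 4) wMat) χ₁ χ₂ (FFun fHalf)) ∧
    -- the case a = 1/3
    (HasHypergeometricExpansion (1 / 3) tThird fThird ∧
      (∀ τ₁ τ₂ : ℍ, IsRegularPoint tThird τ₁ τ₂ →
        SatisfiesSystemAt (1 / 3) (xFun tThird) (yFun tThird) (FFun fThird) τ₁ τ₂) ∧
      IsBimodularFunction (Gamma0 3) (adjoin (Gamma0 3) (atkinLehner 3)) (xFun tThird) ∧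
      IsBimodularFunction (Gamma0 3) (adjoin (Gamma0 3) (atkinLehner 3)) (yFun tThird) ∧
      ∃ (χ₁ : Gamma0 3 →* ℂˣ) (χ₂ : adjoin (Gamma0 3) (atkinLehner 3) →* ℂˣ),
        -- the Kronecker symbol (-3 / d) is the quadratic character modulo 3
        (∀ γ : Gamma0 3, (χ₁ γ : ℂ) =
          (quadraticChar (ZMod 3) ((γ : SL(2, ℤ)) 1 1 : ZMod 3) : ℂ)) ∧
        χ₂ ⟨atkinLehner 3, mem_adjoin _ _⟩ = -1 ∧
        IsBimodularForm 1 (Gamma0 3) (adjoin (Gamma0 3) (atkinLehner 3)) χ₁ χ₂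
          (FFun fThird)) ∧
    -- the case a = 1/4
    (HasHypergeometricExpansion (1 / 4) tQuarter fQuarter ∧
      (∀ τ₁ τ₂ : ℍ, IsRegularPoint tQuarter τ₁ τ₂ →
        (∃ B, IsBranchAt (FFun fQuarter) B τ₁ τ₂) ∧
        ∀ B, IsBranchAt (FFun fQuarter) B τ₁ τ₂ →
          SatisfiesSystemAt (1 / 4) (xFun tQuarter) (yFun tQuarter) B τ₁ τ₂) ∧
      IsBimodularFunction (Gamma0 2) (adjoin (Gamma0 2) (atkinLehner 2)) (xFun tQuarter) ∧
      IsBimodularFunction (Gamma0 2) (adjoin (Gamma0 2) (atkinLehner 2)) (yFun tQuarter) ∧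
      IsBimodularForm 2 (Gamma0 2) (adjoin (Gamma0 2) (atkinLehner 2)) 1 1
        (fun τ₁ τ₂ => FFun fQuarter τ₁ τ₂ ^ 2)) :=
  ⟨⟨hasHypergeometricExpansion_half, system_half, bimodular_half.1, bimodular_half.2,
      bimodularForm_half⟩,
    ⟨hasHypergeometricExpansion_third, system_third, bimodular_third.1, bimodular_third.2,
      bimodularForm_third⟩,
    ⟨hasHypergeometricExpansion_quarter, system_quarter, bimodular_quarter.1, bimodular_quarter.2,
      bimodularForm_quarter⟩⟩
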